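/- Let $p$ be a prime and let $S$ be a nonzero reduced affinoid $\mathbf{Q}_p$-algebra with its Banach topology. Let $v_{\rm sp}$ be its spectral valuation ($p^{-v_{\rm sp}(f)}=\lim_n\|f^n\|^{1/n}$) and $\mathcal{O}_S=\{f\in S: v_{\rm sp}(f)\ge 0\}$. Let $\overline S$ be the maximal étale extension of $S$: an extension ring of $S$ which is a directed union of finite étale $S$-algebras, has no idempotents other than those of $S$, and is such that every finite étale cover of $\overline S$ has a section. Let $\mathcal{O}_{\overline S}$ be its ring of integers (the integral closure of $\mathcal{O}_S$ in $\overline S$) and $\widehat{\mathcal O}=\varprojlim_n \mathcal{O}_{\overline S}/p^n$. Equip $\widehat{\mathcal O}[\frac1p]$ with the topology for which the $p^n\widehat{\mathcal O}$ form a basis of neighbourhoods of $0$. Let $A_{\rm inf}=W(\widehat{\mathcal O}^\flat)$ with $\widehat{\mathcal O}^\flat=\varprojlim_{x\mapsto x^p}\widehat{\mathcal O}/p$, and let $\theta:\mathcal{O}_S\otimes_{\mathbf Z}A_{\rm inf}\to\widehat{\mathcal O}$ be the $\mathcal{O}_S$-linear extension of Fontaine's map $A_{\rm inf}\to\widehat{\mathcal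 O}$. Let $\mathcal{O}\mathbf{A}_{\rm inf}(\overline S)$ be the completion of $\mathcal{O}_S\otimes_{\mathbf Z}A_{\rm inf}$ for the $\theta^{-1}(p\widehat{\mathcal O})$-adic topology, and extend $\theta$ by continuity to $\mathcal{O}\mathbf{A}_{\rm inf}(\overline S)\to\widehat{\mathcal O}$, then to $\mathcal{O}\mathbf{A}_{\rm inf}(\overline S)[\frac1p]\to\widehat{\mathcal O}[\frac1p]$. Let $B_{\rm dR}^+(\overline S)$ be the $\operatorname{Ker}\theta$-adic completion of the $S$-algebra $\mathcal{O}\mathbf{A}_{\rm inf}(\overline S)[\frac1p]$, and let $\theta:B_{\rm dR}^+(\overline S)\to\widehat{\mathcal O}[\frac1p]$ be the induced map. Equip $B_{\rm dR}^+(\overline S)$ with the projective limit of the topologies of the quotients $\mathcal{O}\mathbf{A}_{\rm inf}(\overline S)[\frac1p]/(\operatorname{Ker}\theta)^n$, in which the $p^m$-multiples ($m\ge0$) of the image of $\mathcal{O}\mathbf{A}_{\rm inf}(\overline S)$ form a basis of neighbourhoods of $0$. Let $\theta_B:B\to\widehat{\mathcal O}[\frac1p]$ be an $S$-thickening, that is,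 a continuous surjective homomorphism of $S$-algebras, where $B$ is a (commutative, ultrametric) $S$-Banach algebra and $(\operatorname{Ker}\theta_B)^{k+1}=0$ for some $k\in\mathbf{N}$. Then there is a unique continuous homomorphism of $S$-algebras $\alpha_B:B_{\rm dR}^+(\overline S)\to B$ such that $\theta_B\circ\alpha_B=\theta$. In other words, $B_{\rm dR}^+(\overline S)$ is the universal $S$-thickening of $\widehat{\mathcal O}[\frac1p]$. -/

import Mathlib

open scoped TensorProduct

universe u v w

noncomputable section

/-! ### Affinoid algebras and their integers -/

section Affinoid

variable (p : ℕ) [Fact p.Prime]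

/-- The Tate algebra `ℚ_p⟨T₁, …, Tₙ⟩`: power series whose coefficients tend to `0`. -/
def TateAlgebra (n : ℕ) : Subalgebra ℚ_[p] (MvPowerSeries (Fin n) ℚ_[p]) :=
  { MvPowerSeries.IsRestricted.subring (R := ℚ_[p]) (σ := Fin n) (fun _ => 1) with
    algebraMap_mem' := fun a =>
      MvPowerSeries.isRestricted_C (R := ℚ_[p]) (σ := Fin n) (fun _ => 1) a }

/-- A Banach algebra over `ℚ_p` is affinoid if it is the image of a Tate algebra under a
surjective homomorphism of `ℚ_p`-algebras which is bounded on the unit ball of the Gauss norm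
(that is, continuous). -/
def IsAffinoid (S : Type u) [NormedCommRing S] [NormedAlgebra ℚ_[p] S] : Prop :=
  ∃ (n : ℕ) (φ : TateAlgebra p n →ₐ[ℚ_[p]] S), Function.Surjective φ ∧
    ∃ C : ℝ, ∀ f : TateAlgebra p n,
      (∀ t, ‖MvPowerSeries.coeff t (f : MvPowerSeries (Fin n) ℚ_[p])‖ ≤ 1) → ‖φ f‖ ≤ C

variable (S : Type u) [NormedCommRing S] [NormOneClass S] [IsUltrametricDist S]

/-- The spectral seminorm `|f|_sp = lim ‖fⁿ‖^(1/n)`, i.e. `p ^ (-v_sp f)`. -/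
def spectralSeminorm : RingSeminorm S :=
  smoothingSeminorm (normRingSeminorm S) (norm_one (α := S)).le
    (fun x y => IsUltrametricDist.norm_add_le_max x y)

/-- The ring of integers `O_S = {f | v_sp f ≥ 0}`. -/
def spectralIntegers : Subring S where
  carrier := {f | spectralSeminorm S f ≤ 1}
  zero_mem' := by
    change spectralSeminorm S 0 ≤ 1
    rw [map_zero]; exact zero_le_one
  one_mem' := smoothingSeminorm_map_one_le_one _ _ _
  add_mem' := fun {a b} ha hb =>
    (isNonarchimedean_smoothingFun (normRingSeminorm S) (norm_one (α := S)).le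
      (fun x y => IsUltrametricDist.norm_add_le_max x y) a b).trans (max_le ha hb)
  neg_mem' := fun {a} ha => by
    change spectralSeminorm S (-a) ≤ 1
    rw [map_neg_eq_map]; exact ha
  mul_mem' := fun {a b} ha hb =>
    (map_mul_le_mul (spectralSeminorm S) a b).trans (mul_le_one₀ ha (apply_nonneg _ _) hb)

theorem mem_spectralIntegers {f : S} : f ∈ spectralIntegers S ↔ spectralSeminorm S f ≤ 1 :=
  Iff.rfl

theorem spectralSeminorm_le_norm (f : S) : spectralSeminorm S f ≤ ‖f‖ :=
  smoothingFun_le_self (normRingSeminorm S) f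

variable [NormedAlgebra ℚ_[p] S]

theorem natCast_isUnit_of_padic {R : Type*} [CommRing R] [Algebra ℚ_[p] R] :
    IsUnit (p : R) := by
  have h : IsUnit (p : ℚ_[p]) :=
    isUnit_iff_ne_zero.2 (Nat.cast_ne_zero.2 (Fact.out : p.Prime).ne_zero)
  simpa using h.map (algebraMap ℚ_[p] R)

/-- `S = O_S[1/p]`. -/
instance spectralIntegers_isLocalization :
    IsLocalization.Away (p : spectralIntegers S) S where
  map_units := by
    rintro ⟨_, n, rfl⟩
    simpa using (natCast_isUnit_of_padic p (R := S)).pow n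
  surj := by
    intro z
    obtain ⟨n, hn⟩ : ∃ n : ℕ, ‖((p : ℚ_[p]) ^ n)‖ * ‖z‖ ≤ 1 := by
      have h1 : Filter.Tendsto (fun n : ℕ => ((p : ℝ)⁻¹) ^ n * ‖z‖) Filter.atTop
          (nhds (0 * ‖z‖)) :=
        (tendsto_pow_atTop_nhds_zero_of_lt_one (by positivity)
          (inv_lt_one_of_one_lt₀ (by exact_mod_cast (Fact.out : p.Prime).one_lt))).mul_const _
      rw [zero_mul] at h1
      obtain ⟨n, hn⟩ := (h1.eventually (gt_mem_nhds one_pos)).exists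
      exact ⟨n, by simpa using hn.le⟩
    have hmem : z * (p : S) ^ n ∈ spectralIntegers S := by
      refine (spectralSeminorm_le_norm S _).trans ?_
      have : z * (p : S) ^ n = ((p : ℚ_[p]) ^ n) • z := by
        rw [Algebra.smul_def, mul_comm]; simp
      rw [this, norm_smul]; exact hn
    exact ⟨(⟨_, hmem⟩, ⟨(p : spectralIntegers S) ^ n, n, rfl⟩), by
      rw [map_pow, map_natCast]; rfl⟩
  exists_of_eq := by
    intro x y h
    exact ⟨1, by simpa using Subtype.ext h⟩

theorem spectralIntegers_not_isUnit : ¬ IsUnit (p : spectralIntegers S) := by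
  rintro ⟨u, hu⟩
  have hp : (0 : ℝ) < p := by exact_mod_cast (Fact.out : p.Prime).pos
  have hv : spectralSeminorm S ((u⁻¹ : (spectralIntegers S)ˣ) : spectralIntegers S) ≤ 1 :=
    ((u⁻¹ : (spectralIntegers S)ˣ) : spectralIntegers S).2
  have h1 : (1 : ℝ) ≤ spectralSeminorm S 1 := by
    change 1 ≤ smoothingFun (normRingSeminorm S) 1
    refine ge_of_tendsto' (tendsto_smoothingFun_of_map_one_le_one (normRingSeminorm S)
      (norm_one (α := S)).le 1) fun n => ?_
    have h0 : normRingSeminorm S ((1 : S) ^ n) = 1 := by rw [one_pow]; exact norm_one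
    rw [smoothingSeminormSeq, h0, Real.one_rpow]
  have h2 : spectralSeminorm S (p : S) ≤ (p : ℝ)⁻¹ := by
    refine (spectralSeminorm_le_norm S _).trans ?_
    have : (p : S) = algebraMap ℚ_[p] S p := by simp
    rw [this, norm_algebraMap']; simp
  have h3 : (p : S) * ((u⁻¹ : (spectralIntegers S)ˣ) : spectralIntegers S) = 1 := by
    have := congrArg (fun x : spectralIntegers S => (x : S)) u.mul_inv
    simpa [hu] using this
  have h4 := map_mul_le_mul (spectralSeminorm S) (p : S)
    ((u⁻¹ : (spectralIntegers S)ˣ) : spectralIntegers S)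
  rw [h3] at h4
  have h5 : (p : ℝ)⁻¹ < 1 :=
    inv_lt_one_of_one_lt₀ (by exact_mod_cast (Fact.out : p.Prime).one_lt)
  have h6 := mul_le_mul h2 hv (apply_nonneg _ _) (by positivity)
  linarith

end Affinoid

/-! ### The maximal étale extension -/

/-- `Sbar` is a maximal étale extension (universal pro-finite-étale cover) of `S`: it is an
extension of `S`, a directed union of finite étale `S`-algebras, it has no idempotents besides
those of `S` (for connected `S`: it is connected), and it has no nontrivial finite étale
covers: every finite étale cover of `Sbar` has a section. (A finite étale algebra `E` over
`Sbar` is a cover, i.e. surjective on spectra, exactly when `Sbar → E` is injective.) -/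
class IsMaximalEtaleExtension (S : Type u) (Sbar : Type v) [CommRing S] [CommRing Sbar]
    [Algebra S Sbar] : Prop where
  injective : Function.Injective (algebraMap S Sbar)
  exists_finite_etale : ∀ t : Finset Sbar, ∃ S' : Subalgebra S Sbar,
    (t : Set Sbar) ⊆ S' ∧ Module.Finite S S' ∧ Algebra.Etale S S'
  idempotent : ∀ e : Sbar, IsIdempotentElem e →
    ∃ e₀ : S, IsIdempotentElem e₀ ∧ algebraMap S Sbar e₀ = e
  exists_section : ∀ (E : Type v) [CommRing E] [Algebra Sbar E], Module.Finite Sbar E →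
    Algebra.Etale Sbar E → Function.Injective (algebraMap Sbar E) → Nonempty (E →ₐ[Sbar] Sbar)

section Integers

variable (p : ℕ) [Fact p.Prime]
variable (S : Type u) [NormedCommRing S] [NormOneClass S] [IsUltrametricDist S]
variable (Sbar : Type v) [CommRing Sbar] [Algebra S Sbar]

/-- The ring of integers of `Sbar`: the elements that are integral over `O_S`
(equivalently, of spectral valuation `≥ 0` in some finite étale subextension). -/
abbrev etaleIntegers : Subalgebra (spectralIntegers S) Sbar :=
  integralClosure (spectralIntegers S) Sbar

/-- The `p`-adic completion of the ring of integers of `Sbar`. -/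
abbrev OHat : Type v :=
  AdicCompletion (Ideal.span {(p : etaleIntegers S Sbar)}) (etaleIntegers S Sbar)

instance OHat_isAdicComplete :
    IsAdicComplete (Ideal.span {(p : OHat p S Sbar)}) (OHat p S Sbar) := by
  have h : (Ideal.span {(p : etaleIntegers S Sbar)}).map
      (algebraMap (etaleIntegers S Sbar) (OHat p S Sbar)) = Ideal.span {(p : OHat p S Sbar)} := by
    rw [Ideal.map_span, Set.image_singleton, map_natCast]
  rw [← h, IsAdicComplete.map_algebraMap_iff]
  exact AdicCompletion.isAdicComplete ⟨{(p : etaleIntegers S Sbar)}, by simp⟩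

instance OHat_not_isUnit [NormedAlgebra ℚ_[p] S] [IsMaximalEtaleExtension S Sbar] :
    Fact (¬ IsUnit (p : OHat p S Sbar)) := by
  refine ⟨fun h => spectralIntegers_not_isUnit p S ?_⟩
  have h1 := h.map (AdicCompletion.evalOneₐ (Ideal.span {(p : etaleIntegers S Sbar)}))
  rw [map_natCast, ← map_natCast (Ideal.Quotient.mk _), Ideal.Quotient.eq_zero_iff_mem.2
    (Ideal.mem_span_singleton_self _), isUnit_zero_iff, eq_comm, ← map_one (Ideal.Quotient.mk _),
    Ideal.Quotient.eq_zero_iff_mem, Ideal.mem_span_singleton] at h1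
  have h2 : IsUnit (p : etaleIntegers S Sbar) := isUnit_of_dvd_one h1
  have hinj : Function.Injective
      (algebraMap (spectralIntegers S) (etaleIntegers S Sbar)) := by
    intro x y hxy
    have := congrArg (algebraMap (etaleIntegers S Sbar) Sbar) hxy
    exact Subtype.ext (IsMaximalEtaleExtension.injective this)
  have : FaithfulSMul (spectralIntegers S) (etaleIntegers S Sbar) :=
    (faithfulSMul_iff_algebraMap_injective _ _).2 hinj
  rw [← map_natCast (algebraMap (spectralIntegers S) (etaleIntegers S Sbar))] at h2
  exact isUnit_of_map_unit _ _ h2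

end Integers

/-! ### Extension of a homomorphism by continuity to an adic completion -/

section AdicExtend

variable {Λ : Type u} {P : Type v} {V : Type w} [CommRing Λ] [CommRing P] [CommRing V]
  [Algebra Λ P] [Algebra Λ V] (f : P →ₐ[Λ] V) (J : Ideal P) (I : Ideal V)

theorem pow_le_comap_pow (h : J ≤ I.comap f) (n : ℕ) : J ^ n ≤ (I ^ n).comap f :=
  (Ideal.pow_right_mono h n).trans (Ideal.le_comap_pow f n)

/-- The map from the `J`-adic completion of `P` to `V / Iⁿ` induced by `f : P → V`, if
`f(J) ⊆ I`. -/
def adicExtendModPow (h : J ≤ I.comap f) (n : ℕ) : AdicCompletion J P →ₐ[Λ] V ⧸ I ^ n :=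
  (Ideal.quotientMapₐ (I ^ n) f (pow_le_comap_pow f J I h n)).comp
    ((AdicCompletion.evalₐ J n).restrictScalars Λ)

theorem adicExtendModPow_mk (h : J ≤ I.comap f) (n : ℕ)
    (x : AdicCompletion.AdicCauchySequence J P) :
    adicExtendModPow f J I h n (AdicCompletion.mk J P x) = Ideal.Quotient.mk (I ^ n) (f (x n)) := by
  change Ideal.quotientMapₐ (I ^ n) f (pow_le_comap_pow f J I h n)
    (AdicCompletion.evalₐ J n (AdicCompletion.mk J P x)) = _
  rw [AdicCompletion.evalₐ_mk]
  rfl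

theorem factor_adicExtendModPow (h : J ≤ I.comap f) {m n : ℕ} (hle : m ≤ n) :
    (Ideal.Quotient.factorₐ Λ (Ideal.pow_le_pow_right hle)).comp (adicExtendModPow f J I h n) =
      adicExtendModPow f J I h m := by
  ext x
  induction x using AdicCompletion.induction_on with
  | _ x =>
  rw [AlgHom.comp_apply, adicExtendModPow_mk, adicExtendModPow_mk]
  change Ideal.Quotient.mk (I ^ m) (f (x n)) = _
  rw [Ideal.Quotient.eq, ← map_sub]
  refine Ideal.pow_right_mono le_rfl m ?_
  have h1 := AdicCompletion.Ideal.mk_eq_mk J hle x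
  rw [Ideal.Quotient.eq] at h1
  exact pow_le_comap_pow f J I h m h1

variable [IsAdicComplete I V]

/-- The extension by continuity of `f : P → V` to the `J`-adic completion of `P`, if
`f(J) ⊆ I` and `V` is `I`-adically complete. -/
def adicExtend (h : J ≤ I.comap f) : AdicCompletion J P →ₐ[Λ] V :=
  IsAdicComplete.liftAlgHom I (adicExtendModPow f J I h) (factor_adicExtendModPow f J I h)

end AdicExtend

/-! ### The ring `OA_inf` and the map `θ` -/

section OAinf

variable (p : ℕ) [Fact p.Prime] (Λ : Type u) [CommRing Λ] (V : Type v) [CommRing V] [Algebra Λ V]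
  [Fact (¬ IsUnit (p : V))] [IsAdicComplete (Ideal.span {(p : V)}) V]

/-- `θ : Λ ⊗ A_inf(V) → V`, the `Λ`-linear extension of Fontaine's map, where
`A_inf(V) = W(V♭)`. -/
def thetaTensor : Λ ⊗[ℤ] WittVector p (PreTilt V p) →ₐ[Λ] V :=
  Algebra.TensorProduct.lift (Algebra.ofId Λ V) (WittVector.fontaineTheta V p).toIntAlgHom
    (fun _ _ => Commute.all _ _)

/-- The ideal `θ⁻¹(pV)` of `Λ ⊗ A_inf(V)`. -/
def thetaIdeal : Ideal (Λ ⊗[ℤ] WittVector p (PreTilt V p)) :=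
  (Ideal.span {(p : V)}).comap (thetaTensor p Λ V)

/-- Fontaine's ring `OA_inf`: the completion of `Λ ⊗ A_inf(V)` for the `θ⁻¹(pV)`-adic topology. -/
abbrev OAinf : Type max u v :=
  AdicCompletion (thetaIdeal p Λ V) (Λ ⊗[ℤ] WittVector p (PreTilt V p))

/-- `θ : OA_inf → V`, the extension of `θ` by continuity. -/
def thetaOAinf : OAinf p Λ V →ₐ[Λ] V :=
  adicExtend (thetaTensor p Λ V) (thetaIdeal p Λ V) (Ideal.span {(p : V)}) le_rfl

end OAinf

/-! ### Inverting `p` -/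

section InvertP

variable (p : ℕ) (Λ : Type u) (S : Type v) (R : Type w)
  [CommRing Λ] [CommRing S] [Algebra Λ S] [IsLocalization.Away (p : Λ) S]
  [CommRing R] [Algebra Λ R]

/-- If `S = Λ[1/p]` and `R` is a `Λ`-algebra, this is the structure map `S → R[1/p]`. -/
def awayStructure : S →+* Localization.Away (p : R) :=
  IsLocalization.Away.lift (p : Λ)
    (g := (algebraMap R (Localization.Away (p : R))).comp (algebraMap Λ R))
    (by simpa using IsLocalization.Away.algebraMap_isUnit (S := Localization.Away (p : R)) (p : R))

theorem awayStructure_algebraMap (a : Λ) :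
    awayStructure p Λ S R (algebraMap Λ S a) =
      algebraMap R (Localization.Away (p : R)) (algebraMap Λ R a) :=
  IsLocalization.Away.lift_eq _ _ a

end InvertP

/-- The topology on a commutative ring `M` for which the sets `x + pⁿ M₀` form a basis of
neighbourhoods of `x`. -/
@[reducible] def latticeTopology (p : ℕ) {M : Type*} [CommRing M] (M₀ : AddSubgroup M) :
    TopologicalSpace M where
  IsOpen U := ∀ x ∈ U, ∃ n : ℕ, ∀ y ∈ M₀, x + (p : M) ^ n * y ∈ U
  isOpen_univ := fun _ _ => ⟨0, fun _ _ => trivial⟩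
  isOpen_inter := by
    have key : ∀ (U : Set M) (x : M) (m n : ℕ), m ≤ n →
        (∀ y ∈ M₀, x + (p : M) ^ m * y ∈ U) → ∀ y ∈ M₀, x + (p : M) ^ n * y ∈ U := by
      intro U x m n hmn h y hy
      obtain ⟨k, rfl⟩ := Nat.exists_eq_add_of_le hmn
      have h1 : (p : M) ^ k * y ∈ M₀ := by
        have := M₀.nsmul_mem hy (p ^ k)
        rwa [nsmul_eq_mul, Nat.cast_pow] at this
      have := h _ h1
      rwa [← mul_assoc, ← pow_add] at this
    intro U₁ U₂ h₁ h₂ x hx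
    obtain ⟨n₁, hn₁⟩ := h₁ x hx.1
    obtain ⟨n₂, hn₂⟩ := h₂ x hx.2
    exact ⟨max n₁ n₂, fun y hy => ⟨key U₁ x _ _ (le_max_left _ _) hn₁ y hy,
      key U₂ x _ _ (le_max_right _ _) hn₂ y hy⟩⟩
  isOpen_sUnion := by
    intro s hs x hx
    obtain ⟨U, hU, hxU⟩ := hx
    obtain ⟨n, hn⟩ := hs U hU x hxU
    exact ⟨n, fun y hy => ⟨U, hU, hn y hy⟩⟩

/-! ### The rings `Ô[1/p]` and `B_dR^+` -/

section BdR

variable (p : ℕ) [Fact p.Prime]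
variable (S : Type u) [NormedCommRing S] [NormOneClass S] [IsUltrametricDist S]
  [NormedAlgebra ℚ_[p] S]
variable (Sbar : Type v) [CommRing Sbar] [Algebra S Sbar] [IsMaximalEtaleExtension S Sbar]

/-- `Ô[1/p]`, the completion of `Sbar`. -/
def CompletedSbar : Type v := Localization.Away (p : OHat p S Sbar)

instance : CommRing (CompletedSbar p S Sbar) :=
  inferInstanceAs (CommRing (Localization.Away (p : OHat p S Sbar)))

instance : Algebra S (CompletedSbar p S Sbar) :=
  (awayStructure p (spectralIntegers S) S (OHat p S Sbar)).toAlgebra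

instance : Algebra (OHat p S Sbar) (CompletedSbar p S Sbar) :=
  inferInstanceAs (Algebra (OHat p S Sbar) (Localization.Away (p : OHat p S Sbar)))

instance : IsLocalization.Away (p : OHat p S Sbar) (CompletedSbar p S Sbar) :=
  inferInstanceAs (IsLocalization.Away (p : OHat p S Sbar) (Localization.Away (p : OHat p S Sbar)))

/-- The Banach topology of `Ô[1/p]`: the image of `Ô` is an open bounded subring. -/
instance : TopologicalSpace (CompletedSbar p S Sbar) :=
  latticeTopology p (algebraMap (OHat p S Sbar) (CompletedSbar p S Sbar)).toAddMonoidHom.range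

/-- The ring `OA_inf(Sbar)`. -/
abbrev OAinfBar : Type max u v := OAinf p (spectralIntegers S) (OHat p S Sbar)

/-- The ring `OA_inf(Sbar)[1/p]`. -/
def OAinfInv : Type max u v := Localization.Away (p : OAinfBar p S Sbar)

instance : CommRing (OAinfInv p S Sbar) :=
  inferInstanceAs (CommRing (Localization.Away (p : OAinfBar p S Sbar)))

instance : Algebra S (OAinfInv p S Sbar) :=
  (awayStructure p (spectralIntegers S) S (OAinfBar p S Sbar)).toAlgebra

instance : Algebra (OAinfBar p S Sbar) (OAinfInv p S Sbar) :=
  inferInstanceAs (Algebra (OAinfBar p S Sbar) (Localization.Away (p : OAinfBar p S Sbar)))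

instance : IsLocalization.Away (p : OAinfBar p S Sbar) (OAinfInv p S Sbar) :=
  inferInstanceAs
    (IsLocalization.Away (p : OAinfBar p S Sbar) (Localization.Away (p : OAinfBar p S Sbar)))

/-- `θ : OA_inf(Sbar)[1/p] → Ô[1/p]` as a ring homomorphism. -/
def thetaInvRingHom : OAinfInv p S Sbar →+* CompletedSbar p S Sbar :=
  IsLocalization.Away.lift (p : OAinfBar p S Sbar)
    (g := (algebraMap (OHat p S Sbar) (CompletedSbar p S Sbar)).comp
      (thetaOAinf p (spectralIntegers S) (OHat p S Sbar)).toRingHom)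
    (by
      simpa using IsLocalization.Away.algebraMap_isUnit
        (S := CompletedSbar p S Sbar) (p : OHat p S Sbar))

theorem thetaInvRingHom_algebraMap (x : OAinfBar p S Sbar) :
    thetaInvRingHom p S Sbar (algebraMap _ (OAinfInv p S Sbar) x) =
      algebraMap (OHat p S Sbar) (CompletedSbar p S Sbar)
        (thetaOAinf p (spectralIntegers S) (OHat p S Sbar) x) :=
  IsLocalization.Away.lift_eq _ _ x

/-- `θ : OA_inf(Sbar)[1/p] → Ô[1/p]`. -/
def thetaInv : OAinfInv p S Sbar →ₐ[S] CompletedSbar p S Sbar :=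
  { thetaInvRingHom p S Sbar with
    commutes' := by
      have h : (thetaInvRingHom p S Sbar).comp (algebraMap S (OAinfInv p S Sbar)) =
          algebraMap S (CompletedSbar p S Sbar) := by
        refine IsLocalization.ringHom_ext
          (Submonoid.powers (p : spectralIntegers S)) (RingHom.ext fun a => ?_)
        change thetaInvRingHom p S Sbar
          (awayStructure p (spectralIntegers S) S (OAinfBar p S Sbar)
            (algebraMap (spectralIntegers S) S a)) =
          awayStructure p (spectralIntegers S) S (OHat p S Sbar)
            (algebraMap (spectralIntegers S) S a)
        rw [awayStructure_algebraMap, awayStructure_algebraMap]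
        refine (thetaInvRingHom_algebraMap p S Sbar _).trans ?_
        rw [AlgHom.commutes]
        rfl
      exact fun r => RingHom.congr_fun h r }

/-- `B_dR^+(Sbar)`: the `Ker θ`-adic completion of `OA_inf(Sbar)[1/p]`. -/
def BdRPlus : Type max u v :=
  AdicCompletion (RingHom.ker (thetaInv p S Sbar)) (OAinfInv p S Sbar)

instance : CommRing (BdRPlus p S Sbar) :=
  inferInstanceAs (CommRing
    (AdicCompletion (RingHom.ker (thetaInv p S Sbar)) (OAinfInv p S Sbar)))

instance : Algebra S (BdRPlus p S Sbar) :=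
  inferInstanceAs (Algebra S
    (AdicCompletion (RingHom.ker (thetaInv p S Sbar)) (OAinfInv p S Sbar)))

/-- The projection `B_dR^+(Sbar) → OA_inf(Sbar)[1/p] / (Ker θ)ⁿ`. -/
def BdRPlus.proj (n : ℕ) :
    BdRPlus p S Sbar →+* OAinfInv p S Sbar ⧸ RingHom.ker (thetaInv p S Sbar) ^ n :=
  (AdicCompletion.evalₐ (RingHom.ker (thetaInv p S Sbar)) n :
    AdicCompletion (RingHom.ker (thetaInv p S Sbar)) (OAinfInv p S Sbar) →+* _)

/-- The topology of `B_dR^+(Sbar)`: the projective limit of the topologies of the quotients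
`OA_inf(Sbar)[1/p] / (Ker θ)ⁿ`, in which the image of `OA_inf(Sbar)` is open and bounded. -/
instance : TopologicalSpace (BdRPlus p S Sbar) :=
  ⨅ n : ℕ, TopologicalSpace.induced (BdRPlus.proj p S Sbar n)
    (latticeTopology p ((Ideal.Quotient.mk (RingHom.ker (thetaInv p S Sbar) ^ n)).comp
      (algebraMap (OAinfBar p S Sbar) (OAinfInv p S Sbar))).toAddMonoidHom.range)

/-- `θ : B_dR^+(Sbar) → Ô[1/p]`. -/
def thetaBdR : BdRPlus p S Sbar →ₐ[S] CompletedSbar p S Sbar :=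
  (Ideal.Quotient.liftₐ (RingHom.ker (thetaInv p S Sbar)) (thetaInv p S Sbar)
    (fun _ ha => ha)).comp
    ((AdicCompletion.evalOneₐ (RingHom.ker (thetaInv p S Sbar))).restrictScalars S :
      AdicCompletion (RingHom.ker (thetaInv p S Sbar)) (OAinfInv p S Sbar) →ₐ[S] _)

end BdR

end

/-! The core is an integral statement. Let `V = Ô` and let `q : D → V` be a surjection of
`O_S`-algebras with nilpotent kernel and `D` `p`-adically complete; then `θ : OA_inf → V` lifts
uniquely to `D`. Existence: a high power of Frobenius on `D/p` kills the kernel of `D/p → V/p`,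
hence factors through `V/p`. Undoing that power on the perfect ring `V♭` gives a section `V♭ → D♭`
(`exists_preTilt_section`). Fontaine's map for `D`, composed with the Witt vectors of this section,
lifts `θ` to `A_inf`. The resulting map on `O_S ⊗ A_inf` sends `θ⁻¹(pV)` into `q⁻¹(pV)`, whose
powers define the `p`-adic topology of `D`, so it extends to the completion (`exists_OAinf_lift`).
Uniqueness: maps out of Witt vectors of a perfect ring are rigid
(`WittVector.ringHom_ext_of_sub_mem`), and the image of `O_S ⊗ A_inf` approximates every element of
the completion modulo the powers of `θ⁻¹(pV)` (`OAinf_lift_unique`). The latter needs `θ⁻¹(pV)` to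
be finitely generated (`thetaIdeal_fg`), which rests on three facts: `O_S/p` is of finite type,
Frobenius is surjective on `V/p`, and the kernel of `V♭ → V/p` is principal. The first comes from
finiteness of `O_S` over a ring of definition, proved by Noether normalization over a completed
polynomial ring; the other two come from `p`-th roots of units in `Sbar`. To pass from a Banach
thickening `B` to such a `D`, the open mapping theorem and nilpotence of the kernel place every
bounded subgroup of `B` that maps into `V` inside a bounded, `p`-adically complete subring
surjecting onto `V` (`exists_bounded_subring`, `exists_subring_of_thickening`). One then inverts
`p`. The map obtained kills `(Ker θ)^(k+1)`, so it descends to `B_dR^+`. Conversely, a continuous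
map on `B_dR^+` is bounded on `OA_inf` and determined on the dense image of `OA_inf[1/p]`. -/

/-! ### Rings complete for a principal ideal -/

section PrincipalComplete

variable {R : Type*} [CommRing R] {π : R}

theorem isHausdorff_span_singleton_iff :
    IsHausdorff (Ideal.span {π}) R ↔ ∀ x : R, (∀ n : ℕ, π ^ n ∣ x) → x = 0 := by
  simp only [isHausdorff_iff, SModEq.zero, smul_eq_mul, Ideal.mul_top, Ideal.span_singleton_pow,
    Ideal.mem_span_singleton]

/-- Consecutive differences of a Cauchy sequence are `π ^ n * u n`, so telescoping turns limits of
sequences into sums of series. The series form passes easily to quotients and subrings. -/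
theorem isPrecomplete_span_singleton_iff :
    IsPrecomplete (Ideal.span {π}) R ↔
      ∀ u : ℕ → R, ∃ s, ∀ n, π ^ n ∣ s - ∑ i ∈ Finset.range n, π ^ i * u i := by
  simp only [isPrecomplete_iff, SModEq.sub_mem, smul_eq_mul, Ideal.mul_top,
    Ideal.span_singleton_pow, Ideal.mem_span_singleton]
  constructor
  · intro h u
    obtain ⟨s, hs⟩ := h (fun n => ∑ i ∈ Finset.range n, π ^ i * u i) (by
      intro m n hmn
      rw [← Finset.sum_range_add_sum_Ico _ hmn, sub_add_cancel_left, dvd_neg]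
      refine Finset.dvd_sum fun i hi => (pow_dvd_pow _ (Finset.mem_Ico.1 hi).1).mul_right _)
    exact ⟨s, fun n => by rw [dvd_sub_comm]; exact hs n⟩
  · intro h f hf
    have h1 : ∀ n, ∃ u, f (n + 1) - f n = π ^ n * u := fun n => by
      obtain ⟨u, hu⟩ := hf (Nat.le_succ n)
      exact ⟨-u, by rw [mul_neg, ← hu, Nat.succ_eq_add_one]; ring⟩
    choose u hu using h1
    obtain ⟨s, hs⟩ := h u
    refine ⟨s + f 0, fun n => ?_⟩
    have h2 : ∑ i ∈ Finset.range n, π ^ i * u i = f n - f 0 := by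
      rw [← Finset.sum_range_sub]; exact Finset.sum_congr rfl fun i _ => (hu i).symm
    have := hs n
    rw [h2, dvd_sub_comm] at this
    convert this using 1; ring

theorem isAdicComplete_span_singleton_iff :
    IsAdicComplete (Ideal.span {π}) R ↔ (∀ x : R, (∀ n : ℕ, π ^ n ∣ x) → x = 0) ∧
      ∀ u : ℕ → R, ∃ s, ∀ n, π ^ n ∣ s - ∑ i ∈ Finset.range n, π ^ i * u i := by
  rw [← isHausdorff_span_singleton_iff, ← isPrecomplete_span_singleton_iff]
  exact ⟨fun h => ⟨h.toIsHausdorff, h.toIsPrecomplete⟩, fun h => { h.1, h.2 with }⟩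

/-- A separated module over a complete ring is finite if it is finite modulo `π`. -/
theorem Module.Finite.of_finite_mod_of_isPrecomplete [IsPrecomplete (Ideal.span {π}) R]
    {M : Type*} [AddCommGroup M] [Module R M]
    (haus : ∀ m : M, (∀ n : ℕ, ∃ m', m = π ^ n • m') → m = 0) (t : Finset M)
    (ht : ∀ m : M, ∃ y ∈ Submodule.span R (t : Set M), ∃ m', m = y + π • m') :
    Module.Finite R M := by
  have h1 : ∀ m : M, ∃ (c : M → R) (m' : M), m = ∑ i ∈ t, c i • i + π • m' := by
    intro m
    obtain ⟨y, hy, m', hm⟩ := ht m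
    obtain ⟨c, -, rfl⟩ := Submodule.mem_span_finset.1 hy
    exact ⟨c, m', hm⟩
  choose c r hcr using h1
  refine ⟨⟨t, eq_top_iff.2 fun m _ => ?_⟩⟩
  -- Iterating `m = ∑ c i • i + π • r m` expands `m` in powers of `π` with coefficients along `t`;
  -- the coefficient series converge in `R`, and separatedness of `M` identifies `m` with the limit.
  let x : ℕ → M := fun n => r^[n] m
  have hx : ∀ n, x n = ∑ i ∈ t, c (x n) i • i + π • x (n + 1) := fun n => by
    have : x (n + 1) = r (x n) := Function.iterate_succ_apply' _ _ _
    rw [this]; exact hcr _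
  have hsum : ∀ n, m = ∑ i ∈ t, (∑ k ∈ Finset.range n, π ^ k * c (x k) i) • i + π ^ n • x n := by
    intro n
    induction n with
    | zero => simp [x]
    | succ n ih =>
      conv_lhs => rw [ih, hx n]
      simp only [Finset.sum_range_succ, add_smul, Finset.sum_add_distrib, smul_add,
        Finset.smul_sum, smul_smul, pow_succ]
      abel
  have h2 : ∀ i, ∃ s, ∀ n, π ^ n ∣ s - ∑ k ∈ Finset.range n, π ^ k * c (x k) i := fun i =>
    isPrecomplete_span_singleton_iff.1 ‹_› _
  choose s hs using h2
  have h3 : m = ∑ i ∈ t, s i • i := by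
    refine sub_eq_zero.1 (haus _ fun n => ?_)
    have h4 : ∀ i, ∃ d, s i - ∑ k ∈ Finset.range n, π ^ k * c (x k) i = π ^ n * d := fun i => hs i n
    choose d hd using h4
    refine ⟨x n - ∑ i ∈ t, d i • i, ?_⟩
    conv_lhs => rw [hsum n]
    rw [add_sub_right_comm, ← Finset.sum_sub_distrib, smul_sub, Finset.smul_sum]
    simp only [← sub_smul, smul_smul, ← hd]
    rw [sub_eq_neg_add, ← Finset.sum_neg_distrib]
    congr 1
    exact Finset.sum_congr rfl fun i _ => by rw [← neg_smul, neg_sub]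
  rw [h3]
  exact Submodule.sum_mem _ fun i hi => Submodule.smul_mem _ _ (Submodule.subset_span hi)

theorem dvd_pow_imp_eq_zero [h : IsAdicComplete (Ideal.span {π}) R] {x : R}
    (hx : ∀ n : ℕ, π ^ n ∣ x) : x = 0 :=
  (isAdicComplete_span_singleton_iff.1 h).1 x hx

open Classical in
/-- A `π`-adically complete ring is noetherian if its reduction modulo `π` is. -/
theorem IsNoetherianRing.of_quotient_of_isAdicComplete [IsAdicComplete (Ideal.span {π}) R]
    [IsNoetherianRing (R ⧸ Ideal.span {π})] : IsNoetherianRing R := by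
  have key : ∀ I : Ideal R, (I.map (Ideal.Quotient.mk (Ideal.span {π}))).FG := fun I =>
    IsNoetherian.noetherian _
  -- Here `J = (I : π)`: the ideal `I ∩ (π)` is `πJ`, and `I` modulo `π` is finitely generated by
  -- assumption on the quotient.
  have step : ∀ I J : Ideal R, (∀ x, π * x ∈ I ↔ x ∈ J) → J.FG → I.FG := by
    intro I J hIJ hJ
    refine Ideal.fg_of_fg_map_of_fg_inf_ker_of_surjective (key I) ?_ Ideal.Quotient.mk_surjective
    have : I ⊓ RingHom.ker (Ideal.Quotient.mk (Ideal.span {π})) = Submodule.map (π • LinearMap.id) J := by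
      ext x
      simp only [Ideal.mk_ker, Submodule.mem_inf, Ideal.mem_span_singleton, Submodule.mem_map,
        LinearMap.smul_apply, LinearMap.id_apply, smul_eq_mul]
      constructor
      · rintro ⟨hx, y, rfl⟩
        exact ⟨y, (hIJ y).1 hx, rfl⟩
      · rintro ⟨y, hy, rfl⟩
        exact ⟨(hIJ y).2 hy, y, rfl⟩
    rw [this]
    exact Submodule.FG.map _ hJ
  rw [isNoetherianRing_iff_ideal_fg]
  intro I
  -- The chain `C n = (I : π ^ n)`. Its union `J` is saturated (`π z ∈ J` implies `z ∈ J`), so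
  -- generators modulo `π` generate `J` by completeness. The chain then stops at some `C N = J`, and
  -- `step` descends from `C N` to `C 0 = I`.
  let C : ℕ → Ideal R := fun n => Submodule.comap (LinearMap.mulLeft R (π ^ n)) I
  have hC : ∀ n x, x ∈ C n ↔ π ^ n * x ∈ I := fun n x => Iff.rfl
  have hmono : Monotone C := monotone_nat_of_le_succ fun n x hx => by
    rw [hC, pow_succ', mul_assoc]; exact I.mul_mem_left _ hx
  have hJmem : ∀ x, x ∈ (⨆ n, C n : Ideal R) ↔ ∃ n, x ∈ C n := fun x =>
    Submodule.mem_iSup_of_directed C hmono.directed_le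
  have hJ : (⨆ n, C n : Ideal R).FG := by
    generalize hJdef : (⨆ n, C n : Ideal R) = J at hJmem
    obtain ⟨t', ht', htJ⟩ := Submodule.fg_span_iff_fg_span_finset_subset _ |>.1 (key J)
    obtain ⟨t, htJ', rfl⟩ := Finset.subset_set_image_iff.1 ht'
    have : Module.Finite R J := by
      refine Module.Finite.of_finite_mod_of_isPrecomplete (π := π) ?_
        (t.attach.image fun x : {x // x ∈ t} => ⟨x, htJ' x.2⟩) ?_
      · intro m hm
        refine Subtype.ext (dvd_pow_imp_eq_zero (π := π) fun n => ?_)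
        obtain ⟨m', hm'⟩ := hm n
        exact ⟨m', congrArg Subtype.val hm'⟩
      · rintro ⟨m, hm⟩
        have h1 : Ideal.Quotient.mk (Ideal.span {π}) m ∈
            (Ideal.span (t : Set R)).map (Ideal.Quotient.mk (Ideal.span {π})) := by
          rw [Ideal.map_span, ← Finset.coe_image]
          exact htJ.le (Ideal.mem_map_of_mem _ hm)
        obtain ⟨y, hy, hym⟩ :=
          (Ideal.mem_map_iff_of_surjective _ Ideal.Quotient.mk_surjective).1 h1
        rw [eq_comm, Ideal.Quotient.eq, Ideal.mem_span_singleton] at hym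
        obtain ⟨z, hz⟩ := hym
        have hyJ : y ∈ J := Ideal.span_le.2 htJ' hy
        have hzJ : z ∈ J := by
          have h2 : π * z ∈ J := hz ▸ J.sub_mem hm hyJ
          obtain ⟨n, hn⟩ := (hJmem _).1 h2
          exact (hJmem _).2 ⟨n + 1, by rw [hC, pow_succ, mul_assoc]; exact hn⟩
        refine ⟨⟨y, hyJ⟩, ?_, ⟨z, hzJ⟩, Subtype.ext ?_⟩
        · have h3 : (Submodule.span R ((t.attach.image fun x : {x // x ∈ t} => (⟨x, htJ' x.2⟩ : J) :
              Finset J) : Set J)).map J.subtype = Ideal.span (t : Set R) := by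
            rw [Submodule.map_span, Ideal.span]
            congr 1
            ext a
            simpa using fun h => htJ' h
          rw [← h3] at hy
          obtain ⟨y', hy', rfl⟩ := hy
          exact hy'
        · change m = y + π * z
          rw [← hz]; ring
    exact Module.Finite.iff_fg.1 this
  obtain ⟨N, hN⟩ : ∃ N, (⨆ n, C n : Ideal R) = C N := by
    obtain ⟨t, ht⟩ := hJ
    have h1 : ∀ x, ∃ n, x ∈ t → x ∈ C n := fun x => by
      by_cases hx : x ∈ t
      · obtain ⟨n, hn⟩ := (hJmem x).1 (ht ▸ Submodule.subset_span hx)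
        exact ⟨n, fun _ => hn⟩
      · exact ⟨0, fun h => absurd h hx⟩
    choose n hn using h1
    refine ⟨t.sup n, le_antisymm (ht ▸ Submodule.span_le.2 fun x hx => ?_) (le_iSup C _)⟩
    exact hmono (Finset.le_sup hx) (hn x hx)
  have hall : ∀ k, (C (N - k)).FG := by
    intro k
    induction k with
    | zero => rw [Nat.sub_zero, ← hN]; exact hJ
    | succ k ih =>
      rcases Nat.lt_or_ge k N with hk | hk
      · refine step _ _ (fun x => ?_) ih
        rw [hC, hC, show N - k = N - (k + 1) + 1 by omega, pow_succ, mul_assoc]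
      · rwa [show N - (k + 1) = N - k by omega]
  have := hall N
  rw [Nat.sub_self] at this
  convert this
  ext x
  simp [hC]

/-- In a noetherian normal domain, divisibility can be tested on almost all powers. -/
theorem dvd_of_forall_pow_dvd_mul_pow {N : Type*} [CommRing N] [IsDomain N] [IsNoetherianRing N]
    [IsIntegrallyClosed N] {g h r : N} (hg : g ≠ 0) (hr : r ≠ 0)
    (H : ∀ n : ℕ, g ^ n ∣ r * h ^ n) : g ∣ h := by
  let K := FractionRing N
  have hgK : algebraMap N K g ≠ 0 := by simpa using hg
  have h1 : IsAlmostIntegral N (algebraMap N K h / algebraMap N K g) := by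
    refine ⟨r, mem_nonZeroDivisors_of_ne_zero hr, fun n => ?_⟩
    obtain ⟨d, hd⟩ := H n
    refine ⟨d, ?_⟩
    rw [Algebra.smul_def, div_pow, ← map_pow, ← map_pow, mul_div_assoc', ← map_mul, hd, map_mul,
      mul_div_cancel_left₀]
    rw [map_pow]; exact pow_ne_zero _ hgK
  obtain ⟨y, hy⟩ := IsIntegrallyClosed.isIntegral_iff.1 h1.isIntegral
  refine ⟨y, IsFractionRing.injective N K ?_⟩
  rw [map_mul, hy, mul_div_cancel₀ _ hgK]

theorem exists_eq_pow_mul_of_ne_zero [IsAdicComplete (Ideal.span {π}) R] {x : R} (hx : x ≠ 0) :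
    ∃ (n : ℕ) (y : R), x = π ^ n * y ∧ ¬ π ∣ y := by
  classical
  have h : ∃ n, ¬ π ^ n ∣ x := by
    by_contra! h; exact hx (dvd_pow_imp_eq_zero h)
  have hn := Nat.find_spec h
  obtain ⟨m, hm⟩ : ∃ m, Nat.find h = m + 1 :=
    Nat.exists_eq_succ_of_ne_zero fun h0 => by rw [h0] at hn; simp at hn
  have h2 : π ^ m ∣ x := not_not.1 (Nat.find_min h (by omega))
  obtain ⟨y, rfl⟩ := h2
  refine ⟨m, y, rfl, fun hy => hn ?_⟩
  rw [hm, pow_succ]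
  exact mul_dvd_mul_left _ hy

/-- Every nonzero element is a power of `π` times an element outside the prime ideal `(π)`, and a
product of two such factors stays outside it. -/
theorem IsDomain.of_quotient_of_isAdicComplete [IsAdicComplete (Ideal.span {π}) R]
    [IsDomain (R ⧸ Ideal.span {π})] (hπ : π ∈ nonZeroDivisors R) : IsDomain R := by
  have hp := (Ideal.Quotient.isDomain_iff_prime _).1
    (inferInstance : IsDomain (R ⧸ Ideal.span {π}))
  have : Nontrivial R := (Ideal.Quotient.mk (Ideal.span {π})).domain_nontrivial
  have : NoZeroDivisors R := ⟨by
    intro x y hxy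
    by_contra! h
    obtain ⟨m, x', rfl, hx'⟩ := exists_eq_pow_mul_of_ne_zero (π := π) h.1
    obtain ⟨n, y', rfl, hy'⟩ := exists_eq_pow_mul_of_ne_zero (π := π) h.2
    have h1 : π ^ (m + n) * (x' * y') = 0 := by rw [← hxy]; ring
    rw [mul_left_mem_nonZeroDivisors_eq_zero_iff (pow_mem hπ _)] at h1
    exact (hp.mem_or_mem (I := Ideal.span {π}) (h1 ▸ zero_mem _)).elim
      (fun h => hx' (Ideal.mem_span_singleton.1 h)) fun h => hy' (Ideal.mem_span_singleton.1 h)⟩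
  exact NoZeroDivisors.to_isDomain R

/-- A fraction `f / g` integral over `R` is almost integral: `g ^ n ∣ r * f ^ n` for all `n`. One
shows `g ∣ f` modulo every power of `π` by successive approximation, each correction being a
division in the normal domain `R / π`, and concludes because principal ideals of `R` are closed. -/
theorem IsIntegrallyClosed.of_quotient_of_isAdicComplete [IsAdicComplete (Ideal.span {π}) R]
    [IsDomain R] [IsNoetherianRing R] [IsDomain (R ⧸ Ideal.span {π})]
    [IsIntegrallyClosed (R ⧸ Ideal.span {π})] (hπ : π ≠ 0) : IsIntegrallyClosed R := by
  have hp : Prime π := (Ideal.span_singleton_prime hπ).1 ((Ideal.Quotient.isDomain_iff_prime _).1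
    (inferInstance : IsDomain (R ⧸ Ideal.span {π})))
  have hmk : ∀ x : R, Ideal.Quotient.mk (Ideal.span {π}) x = 0 ↔ π ∣ x := fun x => by
    rw [Ideal.Quotient.eq_zero_iff_mem, Ideal.mem_span_singleton]
  have main : ∀ f g r : R, g ≠ 0 → r ≠ 0 → (∀ n : ℕ, g ^ n ∣ r * f ^ n) → g ∣ f := by
    intro f g r hg hr H
    obtain ⟨b, g, rfl, hg0⟩ := exists_eq_pow_mul_of_ne_zero (π := π) hg
    obtain ⟨c, r, rfl, hr0⟩ := exists_eq_pow_mul_of_ne_zero (π := π) hr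
    have h1 : ∀ k : ℕ, ∃ a h, f = π ^ b * g * a + π ^ k * h := by
      intro k
      induction k with
      | zero => exact ⟨0, f, by simp⟩
      | succ k ih =>
        obtain ⟨a, h, hf⟩ := ih
        by_cases hh : π ∣ h
        · obtain ⟨h', rfl⟩ := hh
          exact ⟨a, h', by rw [hf]; ring⟩
        -- The remainder differs from `f` by a multiple of the denominator, so by the binomial
        -- formula it satisfies the same divisibilities as `f`.
        have H' : ∀ n : ℕ, (π ^ b * g) ^ n ∣ π ^ c * r * (π ^ k * h) ^ n := by
          intro n
          have : π ^ k * h = f + -(π ^ b * g * a) := by rw [hf]; ring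
          rw [this, add_pow, Finset.mul_sum]
          refine Finset.dvd_sum fun i hi => ?_
          obtain ⟨d, hd⟩ := H i
          have hi' : i ≤ n := Nat.lt_succ_iff.1 (Finset.mem_range.1 hi)
          refine ⟨d * (-a) ^ (n - i) * (n.choose i : R), ?_⟩
          calc _ = π ^ c * r * f ^ i * ((π ^ b * g) ^ (n - i) * (-a) ^ (n - i)) *
                (n.choose i : R) := by rw [← mul_pow]; ring
            _ = (π ^ b * g) ^ i * (π ^ b * g) ^ (n - i) * (d * (-a) ^ (n - i) * (n.choose i : R)) := by
                rw [hd]; ring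
            _ = _ := by rw [← pow_add, Nat.add_sub_cancel' hi']
        have hnd : ∀ n, ¬ π ∣ r * h ^ n := fun n hd =>
          (hp.dvd_or_dvd hd).elim hr0 fun h => hh (hp.dvd_of_dvd_pow h)
        have hval : ∀ n, b * n ≤ c + k * n := by
          intro n
          have h2 : π ^ (b * n) ∣ (r * h ^ n) * π ^ (c + k * n) :=
            (Dvd.intro (g ^ n) (by rw [mul_pow, pow_mul])).trans
              ((H' n).trans (dvd_of_eq (by rw [mul_pow, ← pow_mul]; ring)))
          exact (_root_.pow_dvd_pow_iff hπ hp.not_isUnit).1 (hp.pow_dvd_of_dvd_mul_left _ (hnd n) h2)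
        -- If `b > k`, the valuation inequality `b * n ≤ c + k * n` fails at `n = c + 1`.
        have hbk : b ≤ k := by
          by_contra! hkb
          have := hval (c + 1)
          have h3 := Nat.mul_le_mul_right (c + 1) hkb
          rw [Nat.succ_mul] at h3
          omega
        have h4 : ∀ n, g ^ n ∣ r * h ^ n := by
          intro n
          obtain ⟨d, hd⟩ := H' n
          have h5 : π ^ (c + k * n - b * n) * (r * h ^ n) = g ^ n * d := by
            apply mul_left_cancel₀ (pow_ne_zero (b * n) hπ)
            rw [← mul_assoc, ← pow_add, Nat.add_sub_cancel' (hval n)]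
            rw [mul_pow, mul_pow, ← pow_mul, ← pow_mul] at hd
            linear_combination hd
          have h6 : ¬ π ∣ g ^ n := fun h => hg0 (hp.dvd_of_dvd_pow h)
          obtain ⟨d', rfl⟩ := hp.pow_dvd_of_dvd_mul_left _ h6 (Dvd.intro _ h5)
          refine ⟨d', mul_left_cancel₀ (pow_ne_zero (c + k * n - b * n) hπ) ?_⟩
          rw [h5]; ring
        have h7 : Ideal.Quotient.mk (Ideal.span {π}) g ∣ Ideal.Quotient.mk (Ideal.span {π}) h :=
          dvd_of_forall_pow_dvd_mul_pow (r := Ideal.Quotient.mk (Ideal.span {π}) r)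
            (by rwa [Ne, hmk]) (by rwa [Ne, hmk]) fun n => by
              simpa using map_dvd (Ideal.Quotient.mk (Ideal.span {π})) (h4 n)
        obtain ⟨a', ha'⟩ := h7
        obtain ⟨a', rfl⟩ := Ideal.Quotient.mk_surjective a'
        rw [← map_mul, Ideal.Quotient.eq, Ideal.mem_span_singleton] at ha'
        obtain ⟨h', hh'⟩ := ha'
        refine ⟨a + π ^ (k - b) * a', h', ?_⟩
        rw [hf, show h = g * a' + π * h' by rw [← hh']; ring]
        have : π ^ k = π ^ b * π ^ (k - b) := by rw [← pow_add, Nat.add_sub_cancel' hbk]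
        rw [pow_succ, this]; ring
    -- Krull's intersection theorem: `R` is noetherian and `π` lies in its Jacobson radical, so the
    -- ideal of the denominator is `π`-adically closed.
    have h2 : IsHausdorff (Ideal.span {π}) (R ⧸ Ideal.span {π ^ b * g}) :=
      IsHausdorff.of_le_jacobson _ _ (IsAdicComplete.le_jacobson_bot _)
    rw [← Ideal.mem_span_singleton, ← Ideal.Quotient.eq_zero_iff_mem]
    refine h2.haus _ fun n => ?_
    obtain ⟨a, h, hf⟩ := h1 n
    rw [SModEq.zero, hf, map_add, Ideal.Quotient.eq_zero_iff_mem.2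
      (Ideal.mul_mem_right _ _ (Ideal.mem_span_singleton_self _)), zero_add]
    have : Ideal.Quotient.mk (Ideal.span {π ^ b * g}) (π ^ n * h) =
      π ^ n • (Ideal.Quotient.mk (Ideal.span {π ^ b * g}) h) := by
      rw [map_mul, Algebra.smul_def]; rfl
    rw [this]
    exact Submodule.smul_mem_smul (Ideal.pow_mem_pow (Ideal.mem_span_singleton_self _) _) trivial
  rw [isIntegrallyClosed_iff (FractionRing R)]
  intro x hx
  obtain ⟨r, hr, hx'⟩ := hx.isAlmostIntegral
  obtain ⟨f, g, hg, rfl⟩ := IsFractionRing.div_surjective (A := R) x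
  have hgK : algebraMap R (FractionRing R) g ≠ 0 := by
    simpa using nonZeroDivisors.ne_zero hg
  obtain ⟨a, rfl⟩ := main f g r (nonZeroDivisors.ne_zero hg) (nonZeroDivisors.ne_zero hr) (by
    intro n
    obtain ⟨d, hd⟩ := hx' n
    refine ⟨d, IsFractionRing.injective R (FractionRing R) ?_⟩
    rw [map_mul, map_mul, hd, map_pow, map_pow, Algebra.smul_def, div_pow]
    field_simp)
  exact ⟨a, by rw [map_mul, mul_div_cancel_left₀ _ hgK]⟩

end PrincipalComplete

/-! ### Completions at an integer prime and Noether normalization -/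

section AdicCompletionNat

variable {R : Type*} [CommRing R] (p : ℕ)

instance AdicCompletion.isAdicComplete_span_natCast :
    IsAdicComplete (Ideal.span {(p : AdicCompletion (Ideal.span {(p : R)}) R)})
      (AdicCompletion (Ideal.span {(p : R)}) R) := by
  have h : (Ideal.span {(p : R)}).map
      (algebraMap R (AdicCompletion (Ideal.span {(p : R)}) R)) = Ideal.span {↑p} := by
    rw [Ideal.map_span, Set.image_singleton, map_natCast]
  rw [← h, IsAdicComplete.map_algebraMap_iff]
  exact AdicCompletion.isAdicComplete ⟨{(p : R)}, by simp⟩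

theorem AdicCompletion.natCast_mem_nonZeroDivisors (hp : (p : R) ∈ nonZeroDivisors R) :
    (p : AdicCompletion (Ideal.span {(p : R)}) R) ∈
      nonZeroDivisors (AdicCompletion (Ideal.span {(p : R)}) R) := by
  rw [mem_nonZeroDivisors_iff_right]
  intro x hx
  induction x using AdicCompletion.induction_on with
  | _ x =>
  refine AdicCompletion.ext_evalₐ fun n => ?_
  -- Cancelling `p` costs one power of `p`, so level `n` is read off from level `n + 1`.
  have h1 := congrArg (AdicCompletion.evalₐ (Ideal.span {(p : R)}) (n + 1)) hx
  rw [map_mul, map_natCast, _root_.map_zero, AdicCompletion.evalₐ_mk, ← map_natCast (Ideal.Quotient.mk _),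
    ← map_mul, Ideal.Quotient.eq_zero_iff_mem, Ideal.span_singleton_pow,
    Ideal.mem_span_singleton] at h1
  obtain ⟨y, hy⟩ := h1
  have h2 : x (n + 1) = p ^ n * y := by
    rw [← sub_eq_zero]
    refine (mem_nonZeroDivisors_iff_right.1 hp) _ ?_
    rw [sub_mul, hy]; ring
  have h3 := AdicCompletion.Ideal.mk_eq_mk (I := Ideal.span {(p : R)}) (Nat.le_succ n) x
  rw [_root_.map_zero, AdicCompletion.evalₐ_mk, ← h3, Ideal.Quotient.eq_zero_iff_mem,
    Ideal.span_singleton_pow, Ideal.mem_span_singleton]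
  exact ⟨y, h2⟩

/-- The reduction of the completion. -/
noncomputable def AdicCompletion.quotientSpanNatCastEquiv :
    (AdicCompletion (Ideal.span {(p : R)}) R ⧸
      Ideal.span {(p : AdicCompletion (Ideal.span {(p : R)}) R)}) ≃+* R ⧸ Ideal.span {(p : R)} :=
  (Ideal.quotEquivOfEq (by
    have h := AdicCompletion.ker_evalOneₐ_eq_map (I := Ideal.span {(p : R)}) ⟨{(p : R)}, by simp⟩
    rw [Ideal.map_span, Set.image_singleton, map_natCast] at h
    exact h.symm)).trans
    (RingHom.quotientKerEquivOfSurjective (f := (AdicCompletion.evalOneₐ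
      (Ideal.span {(p : R)})).toRingHom) (AdicCompletion.evalOneₐ_surjective _))

theorem AdicCompletion.quotientSpanNatCastEquiv_algebraMap (x : R) :
    AdicCompletion.quotientSpanNatCastEquiv p (Ideal.Quotient.mk _
      (algebraMap R (AdicCompletion (Ideal.span {(p : R)}) R) x)) = Ideal.Quotient.mk _ x := rfl

end AdicCompletionNat

section AdicExtend

variable {Λ : Type u} {P : Type v} {V : Type w} [CommRing Λ] [CommRing P] [CommRing V]
  [Algebra Λ P] [Algebra Λ V] (f : P →ₐ[Λ] V) (J : Ideal P) (I : Ideal V) [IsAdicComplete I V]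

theorem mk_adicExtend (h : J ≤ I.comap f) (n : ℕ) (x : AdicCompletion.AdicCauchySequence J P) :
    Ideal.Quotient.mk (I ^ n) (adicExtend f J I h (AdicCompletion.mk J P x)) =
      Ideal.Quotient.mk (I ^ n) (f (x n)) := by
  rw [adicExtend, IsAdicComplete.mk_liftAlgHom, adicExtendModPow_mk]

theorem adicExtend_algebraMap (h : J ≤ I.comap f) (x : P) :
    adicExtend f J I h (algebraMap P _ x) = f x := by
  refine (IsHausdorff.eq_iff_smodEq (I := I)).2 fun n => ?_
  rw [SModEq.sub_mem, smul_eq_mul, Ideal.mul_top, ← Ideal.Quotient.eq]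
  exact mk_adicExtend f J I h n (AdicCompletion.AdicCauchySequence.mk J P (fun _ => x) (fun _ => rfl))

end AdicExtend

section PolyCompletion

variable (p : ℕ) [Fact p.Prime] (n : ℕ)

/-- The `p`-adic completion of a polynomial ring over `ℤ`. -/
abbrev PolyCompletion : Type :=
  AdicCompletion (Ideal.span {(p : MvPolynomial (Fin n) ℤ)}) (MvPolynomial (Fin n) ℤ)

/-- The reduction modulo `p` of polynomials over `ℤ`. -/
noncomputable def MvPolynomial.quotientSpanNatCastEquiv :
    (MvPolynomial (Fin n) ℤ ⧸ Ideal.span {(p : MvPolynomial (Fin n) ℤ)}) ≃+*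
      MvPolynomial (Fin n) (ZMod p) :=
  (Ideal.quotEquivOfEq (by
    rw [MvPolynomial.ker_map, ZMod.ker_intCastRingHom, Ideal.map_span, Set.image_singleton]
    simp)).trans
    (RingHom.quotientKerEquivOfSurjective
      (MvPolynomial.map_surjective (Int.castRingHom (ZMod p)) (ZMod.ringHom_surjective _)))

/-- The reduction modulo `p` of the completed polynomial ring. -/
noncomputable def PolyCompletion.quotientEquiv :
    (PolyCompletion p n ⧸ Ideal.span {(p : PolyCompletion p n)}) ≃+*
      MvPolynomial (Fin n) (ZMod p) :=
  (AdicCompletion.quotientSpanNatCastEquiv p).trans (MvPolynomial.quotientSpanNatCastEquiv p n)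

instance : IsDomain (PolyCompletion p n ⧸ Ideal.span {(p : PolyCompletion p n)}) :=
  (PolyCompletion.quotientEquiv p n).toMulEquiv.isDomain _

instance : IsNoetherianRing (PolyCompletion p n ⧸ Ideal.span {(p : PolyCompletion p n)}) :=
  isNoetherianRing_of_ringEquiv _ (PolyCompletion.quotientEquiv p n).symm

instance : IsIntegrallyClosed (PolyCompletion p n ⧸ Ideal.span {(p : PolyCompletion p n)}) :=
  .of_equiv (PolyCompletion.quotientEquiv p n).symm

/-- This and the instances that follow make the completed polynomial ring a noetherian normal domain
of characteristic zero, the base for Noether normalization. Noetherianity, integrality and normality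
are lifted from the reduction `𝔽_p[T₁, …, Tₙ]`. -/
instance : IsNoetherianRing (PolyCompletion p n) :=
  .of_quotient_of_isAdicComplete (π := (p : PolyCompletion p n))

theorem PolyCompletion.natCast_mem_nonZeroDivisors :
    (p : PolyCompletion p n) ∈ nonZeroDivisors (PolyCompletion p n) :=
  AdicCompletion.natCast_mem_nonZeroDivisors p
    (mem_nonZeroDivisors_of_ne_zero (Nat.cast_ne_zero.2 (Fact.out : p.Prime).ne_zero))

instance : IsDomain (PolyCompletion p n) :=
  .of_quotient_of_isAdicComplete (PolyCompletion.natCast_mem_nonZeroDivisors p n)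

instance : IsIntegrallyClosed (PolyCompletion p n) :=
  .of_quotient_of_isAdicComplete
    (nonZeroDivisors.ne_zero (PolyCompletion.natCast_mem_nonZeroDivisors p n))

/-- A prime characteristic would vanish in `𝔽_p[T]`, hence equal `p`, which is nonzero here.
Characteristic zero supplies separability in `Module.Finite.integralClosure_fractionRing`. -/
instance : CharZero (PolyCompletion p n) := by
  have hp0 := nonZeroDivisors.ne_zero (PolyCompletion.natCast_mem_nonZeroDivisors p n)
  obtain ⟨q, hq⟩ := CharP.exists (PolyCompletion p n)
  rcases CharP.char_is_prime_or_zero (PolyCompletion p n) q with h | rfl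
  · have h1 : (q : MvPolynomial (Fin n) (ZMod p)) = 0 := by
      have h0 : PolyCompletion.quotientEquiv p n (Ideal.Quotient.mk _ (q : PolyCompletion p n)) =
          0 := by
        have h1 : (q : PolyCompletion p n) = 0 := CharP.cast_eq_zero _ _
        rw [h1, map_zero, map_zero]
      rwa [map_natCast, map_natCast] at h0
    rw [CharP.cast_eq_zero_iff _ p, Nat.prime_dvd_prime_iff_eq Fact.out h] at h1
    exact absurd (h1 ▸ CharP.cast_eq_zero (PolyCompletion p n) q) hp0
  · exact CharP.charP_to_charZero _

variable {n} {A : Type*} [CommRing A] [IsAdicComplete (Ideal.span {(p : A)}) A]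

/-- Evaluation of completed polynomials in a `p`-adically complete ring. -/
noncomputable def PolyCompletion.eval (x : Fin n → A) : PolyCompletion p n →+* A :=
  (adicExtend (MvPolynomial.aeval x : MvPolynomial (Fin n) ℤ →ₐ[ℤ] A) _ (Ideal.span {(p : A)}) (by
    rw [Ideal.span_le, Set.singleton_subset_iff]
    change MvPolynomial.aeval x _ ∈ Ideal.span _
    rw [map_natCast]
    exact Ideal.mem_span_singleton_self _)).toRingHom

theorem PolyCompletion.eval_algebraMap (x : Fin n → A) (q : MvPolynomial (Fin n) ℤ) :
    PolyCompletion.eval p x (algebraMap _ _ q) = MvPolynomial.aeval x q :=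
  adicExtend_algebraMap _ _ _ _ _

theorem PolyCompletion.exists_algebraMap_add (t : PolyCompletion p n) :
    ∃ (q : MvPolynomial (Fin n) ℤ) (z : PolyCompletion p n),
      t = algebraMap (MvPolynomial (Fin n) ℤ) (PolyCompletion p n) q + p * z := by
  obtain ⟨q, hq⟩ := Ideal.Quotient.mk_surjective
    (AdicCompletion.quotientSpanNatCastEquiv p (Ideal.Quotient.mk _ t))
  rw [← AdicCompletion.quotientSpanNatCastEquiv_algebraMap, EmbeddingLike.apply_eq_iff_eq,
    eq_comm, Ideal.Quotient.eq, Ideal.mem_span_singleton] at hq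
  obtain ⟨z, hz⟩ := hq
  exact ⟨q, z, by rw [← hz]; ring⟩

theorem PolyCompletion.exists_eval_surjective [Algebra.FiniteType ℤ (A ⧸ Ideal.span {(p : A)})] :
    ∃ (n : ℕ) (x : Fin n → A), Function.Surjective (PolyCompletion.eval p x) := by
  obtain ⟨n, f, hf⟩ := Algebra.FiniteType.iff_quotient_mvPolynomial''.1
    (inferInstance : Algebra.FiniteType ℤ (A ⧸ Ideal.span {(p : A)}))
  choose x hx using fun i => Ideal.Quotient.mk_surjective (f (MvPolynomial.X i))
  refine ⟨n, x, ?_⟩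
  have hmap : (Ideal.span {(p : PolyCompletion p n)}).map (PolyCompletion.eval p x) =
      Ideal.span {(p : A)} := by
    rw [Ideal.map_span, Set.image_singleton, map_natCast]
  have : IsHausdorff ((Ideal.span {(p : PolyCompletion p n)}).map (PolyCompletion.eval p x)) A := by
    rw [hmap]; infer_instance
  refine surjective_of_mk_map_comp_surjective _ (I := Ideal.span {(p : PolyCompletion p n)}) ?_
  rw [hmap]
  intro a
  obtain ⟨q, rfl⟩ := hf a
  refine ⟨algebraMap _ _ q, ?_⟩
  rw [RingHom.comp_apply, PolyCompletion.eval_algebraMap]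
  have : ((Ideal.Quotient.mk (Ideal.span {(p : A)})).comp
      (MvPolynomial.aeval x : MvPolynomial (Fin n) ℤ →ₐ[ℤ] A).toRingHom) = f.toRingHom :=
    MvPolynomial.ringHom_ext (by simp) (by simp [hx])
  exact RingHom.congr_fun this q

/-- A `p`-adically complete ring topologically of finite type is noetherian. -/
theorem IsNoetherianRing.of_finiteType_quotient [Algebra.FiniteType ℤ (A ⧸ Ideal.span {(p : A)})] :
    IsNoetherianRing A := by
  obtain ⟨n, x, hx⟩ := PolyCompletion.exists_eval_surjective p (A := A)
  exact isNoetherianRing_of_surjective _ _ _ hx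

/-- **Noether normalization** for `p`-adically complete rings topologically of finite type. -/
theorem PolyCompletion.exists_eval_injective_finite
    [Algebra.FiniteType ℤ (A ⧸ Ideal.span {(p : A)})] (hp : (p : A) ∈ nonZeroDivisors A)
    (hpu : ¬ IsUnit (p : A)) :
    ∃ (n : ℕ) (x : Fin n → A), Function.Injective (PolyCompletion.eval p x) ∧
      (PolyCompletion.eval p x).Finite := by
  have : Fact (¬ IsUnit (p : A)) := ⟨hpu⟩
  let k := A ⧸ Ideal.span {(p : A)}
  have : Nontrivial k := inferInstanceAs (Nontrivial (ModP A p))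
  have : CharP k p := inferInstanceAs (CharP (ModP A p) p)
  let _ : Algebra (ZMod p) k := ZMod.algebra _ p
  have : Algebra.FiniteType (ZMod p) k := .of_restrictScalars_finiteType ℤ _ _
  -- Noether normalization over `𝔽_p` for the reduction; the images of the variables are lifted to
  -- `A`, and `key` says that `eval` at the lifts reduces to `g`.
  obtain ⟨n, g, hg, hgf⟩ := exists_finite_inj_algHom_of_fg (ZMod p) k
  choose x hx using fun i => Ideal.Quotient.mk_surjective (g (MvPolynomial.X i))
  have key : (Ideal.Quotient.mk (Ideal.span {(p : A)})).comp (PolyCompletion.eval p x) =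
      (g.toRingHom.comp (PolyCompletion.quotientEquiv p n).toRingHom).comp
        (Ideal.Quotient.mk _) := by
    ext t
    obtain ⟨q, z, rfl⟩ := PolyCompletion.exists_algebraMap_add p t
    have h0 : ∀ b : k, (p : k) * b = 0 := fun b => by
      have h1 : (p : k) = 0 := CharP.cast_eq_zero _ _
      rw [h1, zero_mul]
    have h2 : ((Ideal.Quotient.mk (Ideal.span {(p : A)})).comp
      (MvPolynomial.aeval x : MvPolynomial (Fin n) ℤ →ₐ[ℤ] A).toRingHom) =
      g.toRingHom.comp (MvPolynomial.map (Int.castRingHom (ZMod p))) :=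
        MvPolynomial.ringHom_ext (by simp) (by simp [hx])
    have h3 : PolyCompletion.quotientEquiv p n (Ideal.Quotient.mk _ (algebraMap _ _ q)) =
      MvPolynomial.map (Int.castRingHom (ZMod p)) q := rfl
    have h4 := RingHom.congr_fun h2 q
    simp only [RingHom.comp_apply, map_add, map_mul, map_natCast, PolyCompletion.eval_algebraMap]
    exact congrArg₂ (· + ·) (h4.trans (congrArg g h3.symm)) ((h0 _).trans (h0 _).symm)
  have hinj : ∀ t, (p : A) ∣ PolyCompletion.eval p x t → (p : PolyCompletion p n) ∣ t := by
    intro t ht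
    have h1 := RingHom.congr_fun key t
    rw [RingHom.comp_apply, Ideal.Quotient.eq_zero_iff_mem.2 (Ideal.mem_span_singleton.2 ht)] at h1
    have h2 : (PolyCompletion.quotientEquiv p n (Ideal.Quotient.mk _ t)) = 0 := hg (by
      rw [map_zero]; exact h1.symm)
    rwa [map_eq_zero_iff _ (RingEquiv.injective _), Ideal.Quotient.eq_zero_iff_mem,
      Ideal.mem_span_singleton] at h2
  refine ⟨n, x, ?_, ?_⟩
  -- Divide a nonzero element of the kernel by the largest power of `p`: the quotient is again in
  -- the kernel, as `p` is regular in `A`, and its nonzero reduction contradicts injectivity of `g`.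
  · rw [injective_iff_map_eq_zero]
    intro t ht
    by_contra h0
    obtain ⟨m, y, rfl, hy⟩ := exists_eq_pow_mul_of_ne_zero (π := (p : PolyCompletion p n)) h0
    rw [map_mul, map_pow, map_natCast,
      mul_left_mem_nonZeroDivisors_eq_zero_iff (pow_mem hp _)] at ht
    exact hy (hinj y (ht ▸ dvd_zero _))
  · let _ : Algebra (PolyCompletion p n) A := (PolyCompletion.eval p x).toAlgebra
    have hfin : ((Ideal.Quotient.mk (Ideal.span {(p : A)})).comp (PolyCompletion.eval p x)).Finite := by
      rw [key]
      refine (RingHom.Finite.comp hgf ?_).comp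
        (RingHom.Finite.of_surjective _ Ideal.Quotient.mk_surjective)
      exact RingHom.Finite.of_surjective _ (RingEquiv.surjective _)
    have hfin' : Module.Finite (PolyCompletion p n) k := hfin
    obtain ⟨t, ht⟩ := hfin'
    choose r hr using Ideal.Quotient.mk_surjective (I := Ideal.span {(p : A)})
    classical
    refine Module.Finite.of_finite_mod_of_isPrecomplete (π := (p : PolyCompletion p n)) ?_
      (t.image r) fun m => ?_
    · intro m hm
      refine dvd_pow_imp_eq_zero (π := (p : A)) fun n => ?_
      obtain ⟨m', rfl⟩ := hm n
      exact ⟨m', by rw [Algebra.smul_def, map_pow, map_natCast]⟩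
    · have h1 : (Ideal.Quotient.mk (Ideal.span {(p : A)}) m : k) ∈
          Submodule.span (PolyCompletion p n) (t : Set k) := ht ▸ trivial
      have h2 : Submodule.span (PolyCompletion p n) (t : Set k) =
          (Submodule.span (PolyCompletion p n) ((t.image r : Finset A) : Set A)).map
            (IsScalarTower.toAlgHom (PolyCompletion p n) A k).toLinearMap := by
        rw [Submodule.map_span, Finset.coe_image, Set.image_image]
        congr 1
        ext a
        simp only [Set.mem_image]
        exact ⟨fun h => ⟨a, h, hr a⟩, by
          rintro ⟨b, hb, rfl⟩
          change Ideal.Quotient.mk _ (r b) ∈ _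
          rwa [hr b]⟩
      rw [h2] at h1
      obtain ⟨y, hy, hym⟩ := h1
      have h3 : Ideal.Quotient.mk (Ideal.span {(p : A)}) m = Ideal.Quotient.mk _ y := hym.symm
      rw [Ideal.Quotient.eq, Ideal.mem_span_singleton] at h3
      obtain ⟨z, hz⟩ := h3
      refine ⟨y, hy, z, ?_⟩
      rw [Algebra.smul_def, map_natCast, ← hz]; ring

/-- The integral closure of a `p`-adically complete domain topologically of finite type is
finite. -/
theorem Module.Finite.integralClosure_fractionRing [IsDomain A]
    [Algebra.FiniteType ℤ (A ⧸ Ideal.span {(p : A)})] (hp : (p : A) ≠ 0) (hpu : ¬ IsUnit (p : A)) :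
    Module.Finite A (integralClosure A (FractionRing A)) := by
  obtain ⟨n, x, hinj, hfin⟩ := PolyCompletion.exists_eval_injective_finite p
    (mem_nonZeroDivisors_of_ne_zero hp) hpu
  let T := PolyCompletion p n
  let _ : Algebra T A := (PolyCompletion.eval p x).toAlgebra
  have : Module.Finite T A := hfin
  have : FaithfulSMul T A := (faithfulSMul_iff_algebraMap_injective _ _).2 hinj
  have : FaithfulSMul T (FractionRing A) := .trans T A _
  let _ : Algebra (FractionRing T) (FractionRing A) := FractionRing.liftAlgebra T (FractionRing A)
  have : IsScalarTower T (FractionRing T) (FractionRing A) :=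
    FractionRing.isScalarTower_liftAlgebra _ _
  have : FiniteDimensional (FractionRing T) (FractionRing A) := by
    have : Algebra.EssFiniteType A (FractionRing A) := .of_isLocalization _ (nonZeroDivisors A)
    have : Algebra.EssFiniteType T (FractionRing A) := .comp T A _
    have : Algebra.EssFiniteType (FractionRing T) (FractionRing A) := .of_comp T _ _
    have : Algebra.IsAlgebraic A (FractionRing A) := IsLocalization.isAlgebraic _ (nonZeroDivisors A)
    have : Algebra.IsAlgebraic T (FractionRing A) := Algebra.IsAlgebraic.trans T A _
    have : Algebra.IsAlgebraic (FractionRing T) (FractionRing A) :=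
      (IsFractionRing.comap_isAlgebraic_iff (A := T)).1 this
    exact Algebra.finite_of_essFiniteType_of_isAlgebraic
  have : CharZero (FractionRing T) := charZero_of_injective_algebraMap (IsFractionRing.injective T _)
  -- Since `A` is integral over `T`, its integral closure is also that of `T`, a noetherian normal
  -- domain, in a finite separable extension of `Frac T`; such a closure is finite.
  have : IsIntegralClosure (integralClosure A (FractionRing A)) T (FractionRing A) :=
    { algebraMap_injective := Subtype.val_injective
      isIntegral_iff := by
        intro x
        constructor
        · intro h
          exact ⟨⟨x, h.tower_top⟩, rfl⟩
        · rintro ⟨y, rfl⟩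
          exact isIntegral_trans _ y.2 }
  have := IsIntegralClosure.finite T (FractionRing T) (FractionRing A)
    (integralClosure A (FractionRing A))
  exact Module.Finite.of_restrictScalars_finite T A _

/-- A reduced, `p`-torsion free, `p`-adically complete ring `A` topologically of finite type has
finite integral closure in `A[1/p]`. -/
theorem Module.Finite.integralClosure_away [IsReduced A]
    [Algebra.FiniteType ℤ (A ⧸ Ideal.span {(p : A)})] (hp : (p : A) ∈ nonZeroDivisors A)
    (S : Type*) [CommRing S] [Algebra A S] [IsLocalization.Away (p : A) S] :
    Module.Finite A (integralClosure A S) := by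
  have : IsNoetherianRing A := .of_finiteType_quotient p
  -- Minimal primes consist of zero divisors. Hence `A[1/p]` maps to the fraction field of each `A /
  -- P`.
  have hpmem : ∀ P : minimalPrimes A, (p : A) ∉ P.1 := fun P h =>
    Set.disjoint_left.1 (Ideal.disjoint_nonZeroDivisors_of_mem_minimalPrimes P.2) h hp
  have hprime : ∀ P : minimalPrimes A, P.1.IsPrime := fun P => P.2.1.1
  have hfin : ∀ P : minimalPrimes A, Module.Finite A
      (integralClosure (A ⧸ P.1) (FractionRing (A ⧸ P.1))) := by
    intro P
    have hpP := hpmem P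
    have := hprime P
    generalize P.1 = P at *
    have hpu : ¬ IsUnit (p : A ⧸ P) := by
      intro h
      obtain ⟨y, hy⟩ := h.exists_right_inv
      obtain ⟨y, rfl⟩ := Ideal.Quotient.mk_surjective y
      rw [← map_natCast (Ideal.Quotient.mk P), ← map_mul, ← map_one (Ideal.Quotient.mk P), eq_comm,
        Ideal.Quotient.eq] at hy
      have h1 : IsUnit (1 - p * y) := by
        have := IsAdicComplete.le_jacobson_bot (Ideal.span {(p : A)}) (Ideal.mem_span_singleton_self _)
        have := Ideal.mem_jacobson_bot.1 this (-y)
        rwa [mul_neg, neg_add_eq_sub] at this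
      exact this.ne_top (Ideal.eq_top_of_isUnit_mem _ hy h1)
    have hp0 : (p : A ⧸ P) ≠ 0 := by
      rwa [← map_natCast (Ideal.Quotient.mk P), Ne, Ideal.Quotient.eq_zero_iff_mem]
    -- Separatedness is Krull's intersection theorem in a noetherian domain; convergence of series
    -- is inherited from `A`.
    have : IsAdicComplete (Ideal.span {(p : A ⧸ P)}) (A ⧸ P) := by
      have h1 : IsHausdorff (Ideal.span {(p : A ⧸ P)}) (A ⧸ P) :=
        IsHausdorff.of_isDomain _ (by rwa [Ne, Ideal.span_singleton_eq_top])
      refine isAdicComplete_span_singleton_iff.2 ⟨isHausdorff_span_singleton_iff.1 h1, fun u => ?_⟩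
      choose u' hu' using fun i => Ideal.Quotient.mk_surjective (u i)
      obtain ⟨s, hs⟩ := (isAdicComplete_span_singleton_iff.1
        (inferInstance : IsAdicComplete (Ideal.span {(p : A)}) A)).2 u'
      exact ⟨Ideal.Quotient.mk P s, fun n => by
        simpa [hu'] using map_dvd (Ideal.Quotient.mk P) (hs n)⟩
    have : Algebra.FiniteType ℤ ((A ⧸ P) ⧸ Ideal.span {(p : A ⧸ P)}) := by
      have hle : Ideal.span {(p : A)} ≤
          (Ideal.span {(p : A ⧸ P)}).comap (Ideal.Quotient.mk P) := by
        rw [Ideal.span_le, Set.singleton_subset_iff]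
        change Ideal.Quotient.mk P p ∈ Ideal.span _
        rw [map_natCast]
        exact Ideal.mem_span_singleton_self _
      exact Algebra.FiniteType.of_surjective (R := ℤ) (A := A ⧸ Ideal.span {(p : A)})
        (Ideal.quotientMap (Ideal.span {(p : A ⧸ P)}) (Ideal.Quotient.mk P) hle).toIntAlgHom
        (Ideal.quotientMap_surjective (H := hle) Ideal.Quotient.mk_surjective)
    have := @Module.Finite.integralClosure_fractionRing p _ (A ⧸ P) _ _ _ this hp0 hpu
    exact Module.Finite.trans (A ⧸ P) _
  have : Finite (minimalPrimes A) := (minimalPrimes.finite_of_isNoetherianRing A).to_subtype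
  let f : ∀ P : minimalPrimes A, S →ₐ[A] FractionRing (A ⧸ P.1) := fun P =>
    IsLocalization.liftAlgHom (M := Submonoid.powers (p : A)) (f := Algebra.ofId _ _) (by
      rintro ⟨_, n, rfl⟩
      have := hprime P
      refine isUnit_iff_ne_zero.2 ?_
      change algebraMap A (FractionRing (A ⧸ P.1)) (p ^ n) ≠ 0
      rw [map_pow]
      refine pow_ne_zero _ ?_
      rw [IsScalarTower.algebraMap_apply A (A ⧸ P.1), Ne, FaithfulSMul.algebraMap_eq_zero_iff]
      exact fun h => hpmem P (Ideal.Quotient.eq_zero_iff_mem.1 h))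
  -- The integral closure embeds in a finite product of finite modules: an element killed by all `f
  -- P` has its numerator in every minimal prime, hence is zero as `A` is reduced. Submodules of
  -- finite modules over the noetherian ring `A` are finite.
  let F : integralClosure A S →ₗ[A] (∀ P : minimalPrimes A,
      integralClosure (A ⧸ P.1) (FractionRing (A ⧸ P.1))) :=
    { toFun := fun x P => ⟨f P x, (x.2.map (f P)).tower_top⟩
      map_add' := fun x y => funext fun P => Subtype.ext (by simp)
      map_smul' := fun a x => funext fun P => Subtype.ext (by simp [Algebra.smul_def]) }
  refine Module.Finite.of_injective F ?_
  rw [injective_iff_map_eq_zero]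
  rintro ⟨x, hx⟩ hF
  have h0 : ∀ P, f P x = 0 := fun P => congrArg Subtype.val (congrFun hF P)
  obtain ⟨⟨a, m⟩, hm⟩ := IsLocalization.surj (Submonoid.powers (p : A)) x
  have ha : ∀ P : minimalPrimes A, a ∈ P.1 := by
    intro P
    have := hprime P
    have h1 := congrArg (f P) hm
    rw [map_mul, h0, zero_mul, AlgHom.commutes, IsScalarTower.algebraMap_apply A (A ⧸ P.1), eq_comm,
      FaithfulSMul.algebraMap_eq_zero_iff] at h1
    exact Ideal.Quotient.eq_zero_iff_mem.1 h1
  have ha0 : a = 0 := by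
    refine IsNilpotent.eq_zero (mem_nilradical.1 ?_)
    rw [nilradical, ← Ideal.sInf_minimalPrimes, Ideal.mem_sInf]
    exact fun {P} hP => ha ⟨P, hP⟩
  rw [ha0, map_zero] at hm
  exact Subtype.ext ((IsLocalization.map_units S m).mul_left_eq_zero.1 hm)

end PolyCompletion

/-! ### An open mapping theorem for complete lattices -/

section SeriesComplete

variable (p : ℕ) {X : Type*} {Y : Type*} [AddCommGroup X] [AddCommGroup Y]

/-- Every series `∑ pⁱ uᵢ` with terms in `M` converges `p`-adically in `M`. -/
def IsSeriesComplete (M : AddSubgroup X) : Prop :=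
  ∀ u : ℕ → X, (∀ n, u n ∈ M) →
    ∃ s ∈ M, ∀ n, ∃ m ∈ M, s = ∑ i ∈ Finset.range n, p ^ i • u i + p ^ n • m

variable {p}

/-- A Baire category argument: if countably many subgroups cover a `p`-adically complete group,
the closure of one of them is open. -/
theorem IsSeriesComplete.exists_forall_mem_add {N : AddSubgroup Y} (hN : IsSeriesComplete p N)
    (H : ℕ → AddSubgroup Y) (hH : ∀ y ∈ N, ∃ n, y ∈ H n) :
    ∃ n r, ∀ y ∈ N, ∀ k, ∃ h ∈ H n, ∃ z ∈ N, p ^ r • y = h + p ^ k • z := by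
  by_contra! hcon
  -- Inside the ball `x + p ^ e N` there is a smaller ball missing `H n`. Either a ball around `x`
  -- works, or it meets `H n`; then the ball around `x + p ^ e y` works, since a second point of `H
  -- n` would make the difference approximate `p ^ e y`, against the choice of `y`.
  have hstep : ∀ (n : ℕ) (x : Y) (e : ℕ), ∃ w ∈ N, ∃ e', e < e' ∧
      ∀ z ∈ N, x + p ^ e • w + p ^ e' • z ∉ H n := by
    intro n x e
    obtain ⟨y, hy, k, hk⟩ := hcon n e
    by_cases h0 : ∀ z ∈ N, x + p ^ e • (0 : Y) + p ^ (max k (e + 1)) • z ∉ H n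
    · exact ⟨0, N.zero_mem, max k (e + 1), by omega, h0⟩
    push Not at h0
    obtain ⟨z, hz, hzH⟩ := h0
    refine ⟨y, hy, max k (e + 1), by omega, fun z' hz' hzH' => ?_⟩
    obtain ⟨d, hd⟩ := Nat.exists_eq_add_of_le (le_max_left k (e + 1))
    refine hk _ ((H n).sub_mem hzH' hzH) (p ^ d • (z - z'))
      (N.nsmul_mem (N.sub_mem hz hz') _) ?_
    rw [hd, pow_add, mul_smul, mul_smul, smul_zero, smul_sub, smul_sub]
    abel
  choose! w hwN e' he' hw using hstep
  -- Centres and exponents of nested balls, the `n`-th step avoiding `H n`. The limit of the centres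
  -- lies in none of the `H n`.
  let q : ℕ → Y × ℕ := fun n =>
    Nat.rec (0, 0) (fun k q => (q.1 + p ^ q.2 • w k q.1 q.2, e' k q.1 q.2)) n
  have hq1 : ∀ n, (q (n + 1)).1 = (q n).1 + p ^ (q n).2 • w n (q n).1 (q n).2 := fun _ => rfl
  have hq2 : ∀ n, (q (n + 1)).2 = e' n (q n).1 (q n).2 := fun _ => rfl
  have hmono : StrictMono fun n => (q n).2 := strictMono_nat_of_lt_succ fun n => he' _ _ _
  have hle : ∀ n, n ≤ (q n).2 := fun n => hmono.id_le n
  obtain ⟨s, hs, hsum⟩ := hN (fun n => p ^ ((q n).2 - n) • w n (q n).1 (q n).2)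
    fun n => N.nsmul_mem (hwN _ _ _) _
  have hpart : ∀ n, ∑ i ∈ Finset.range n, p ^ i • p ^ ((q i).2 - i) • w i (q i).1 (q i).2 =
      (q n).1 := by
    intro n
    induction n with
    | zero => rfl
    | succ n ih =>
      rw [Finset.sum_range_succ, ih, hq1, ← mul_smul, ← pow_add, Nat.add_sub_cancel' (hle n)]
  have hdiff : ∀ n k, ∃ z ∈ N, (q (n + k)).1 = (q n).1 + p ^ (q n).2 • z := by
    intro n k
    induction k with
    | zero => exact ⟨0, N.zero_mem, by simp⟩
    | succ k ih =>
      obtain ⟨z, hz, h⟩ := ih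
      obtain ⟨d, hd⟩ := Nat.exists_eq_add_of_le (hmono.monotone (Nat.le_add_right n k))
      refine ⟨z + p ^ d • w (n + k) (q (n + k)).1 (q (n + k)).2,
        N.add_mem hz (N.nsmul_mem (hwN _ _ _) _), ?_⟩
      rw [← add_assoc, hq1, h, smul_add, ← mul_smul, ← pow_add]
      replace hd : (q (n + k)).2 = (q n).2 + d := hd
      rw [hd, add_assoc, ← h]
  obtain ⟨n, hn⟩ := hH s hs
  set E := (q (n + 1)).2 with hE
  obtain ⟨m, hm, hsm⟩ := hsum (n + 1 + E)
  obtain ⟨z, hz, hz'⟩ := hdiff (n + 1) E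
  rw [hpart, hz', ← hE, add_comm (n + 1) E, pow_add, mul_smul, add_assoc, ← smul_add] at hsm
  refine hw n (q n).1 (q n).2 _ (N.add_mem hz (N.nsmul_mem hm (p ^ (n + 1)))) ?_
  rw [← hq1, ← hq2, ← hE, ← hsm]
  exact hn

/-- **Open mapping theorem** for `p`-adically complete lattices. -/
theorem IsSeriesComplete.exists_lift {M : AddSubgroup X} {N : AddSubgroup Y}
    (hM : IsSeriesComplete p M) (hN : IsSeriesComplete p N)
    (hsep : ∀ y : Y, (∀ n, ∃ m ∈ N, y = p ^ n • m) → y = 0) (htf : ∀ y : Y, p • y = 0 → y = 0)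
    (f : X →+ Y) (habs : ∀ x, ∃ n : ℕ, p ^ n • x ∈ M) (hsurj : ∀ y ∈ N, ∃ x, f x = y)
    {c : ℕ} (hc : ∀ m ∈ M, p ^ c • f m ∈ N) :
    ∃ n, ∀ y ∈ N, ∃ x ∈ M, f x = p ^ n • y := by
  have htf' : ∀ (n : ℕ) (y : Y), p ^ n • y = 0 → y = 0 := by
    intro n
    induction n with
    | zero => intro y hy; simpa using hy
    | succ n ih => intro y hy; rw [pow_succ, mul_smul] at hy; exact htf _ (ih _ hy)
  let H : ℕ → AddSubgroup Y := fun n => (M.map f).comap (nsmulAddMonoidHom (p ^ n))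
  have hH : ∀ n y, y ∈ H n ↔ ∃ x ∈ M, f x = p ^ n • y := fun n y => Iff.rfl
  obtain ⟨n, r, hnr⟩ := hN.exists_forall_mem_add H fun y hy => by
    obtain ⟨x, rfl⟩ := hsurj y hy
    obtain ⟨n, hn⟩ := habs x
    exact ⟨n, _, hn, map_nsmul _ _ _⟩
  -- Baire gives approximation to any precision; precision `r + 1` leaves an error `p` times an
  -- element of the original shape `p ^ (n + r) • z`, so the approximation can be iterated.
  have hstep : ∀ y, y ∈ N → ∃ m ∈ M, ∃ z ∈ N, p ^ (n + r) • y = f m + p ^ (n + r + 1) • z := by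
    intro y hy
    obtain ⟨h, ⟨m, hm, hmh⟩, z, hz, hyz⟩ := hnr y hy (r + 1)
    refine ⟨m, hm, z, hz, ?_⟩
    have : f m = p ^ n • h := hmh
    rw [pow_add, mul_smul, hyz, smul_add, this, ← mul_smul, ← pow_add, add_assoc]
  choose! m hmM z hzN hyz using hstep
  refine ⟨n + r, fun y hy => ?_⟩
  have hzi : ∀ i, z^[i] y ∈ N := fun i => by
    induction i with
    | zero => exact hy
    | succ i ih => rw [Function.iterate_succ_apply']; exact hzN _ ih
  obtain ⟨s, hs, hsum⟩ := hM (fun i => m (z^[i] y)) fun i => hmM _ (hzi i)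
  refine ⟨s, hs, ?_⟩
  have hy' : ∀ k, p ^ (n + r) • y =
      ∑ i ∈ Finset.range k, p ^ i • f (m (z^[i] y)) + p ^ k • p ^ (n + r) • z^[k] y := by
    intro k
    induction k with
    | zero => simp
    | succ k ih =>
      rw [Finset.sum_range_succ, ih, hyz _ (hzi k), smul_add, Function.iterate_succ_apply',
        ← mul_smul, ← mul_smul, ← pow_add, ← pow_add, ← add_assoc]
      congr 3
      omega
  -- The factor `p ^ c` brings the images of the tails into `N`, where separatedness applies; it is
  -- removed because `Y` has no `p`-torsion.
  refine sub_eq_zero.1 (htf' c _ (hsep _ fun k => ?_))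
  obtain ⟨x, hx, hsx⟩ := hsum k
  refine ⟨p ^ c • f x - p ^ c • p ^ (n + r) • z^[k] y, N.sub_mem (hc x hx)
    (N.nsmul_mem (N.nsmul_mem (hzi k) _) _), ?_⟩
  rw [hy' k, hsx, map_add, map_sum, map_nsmul]
  simp only [map_nsmul, add_sub_add_left_eq_sub]
  rw [← smul_sub, ← smul_sub, smul_comm]

end SeriesComplete

/-! ### Unit balls of `p`-adic Banach spaces. -/

section UnitBall

variable (p : ℕ) [Fact p.Prime] (E : Type*) [NormedAddCommGroup E] [NormedSpace ℚ_[p] E]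
  [IsUltrametricDist E]

/-- The closed unit ball, as a subgroup. -/
def unitBall : AddSubgroup E where
  carrier := {x | ‖x‖ ≤ 1}
  zero_mem' := by simp
  add_mem' := fun {a b} ha hb => (IsUltrametricDist.norm_add_le_max a b).trans (max_le ha hb)
  neg_mem' := fun {a} ha => by simpa using ha

variable {E}

theorem mem_unitBall {x : E} : x ∈ unitBall E ↔ ‖x‖ ≤ 1 := Iff.rfl

theorem norm_pow_nsmul (n : ℕ) (x : E) : ‖p ^ n • x‖ = (p : ℝ)⁻¹ ^ n * ‖x‖ := by
  rw [← Nat.cast_smul_eq_nsmul ℚ_[p], norm_smul]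
  simp

theorem exists_pow_nsmul_mem_unitBall (x : E) : ∃ n : ℕ, p ^ n • x ∈ unitBall E := by
  have h1 : Filter.Tendsto (fun n : ℕ => ((p : ℝ)⁻¹) ^ n * ‖x‖) Filter.atTop
      (nhds (0 * ‖x‖)) :=
    (tendsto_pow_atTop_nhds_zero_of_lt_one (by positivity)
      (inv_lt_one_of_one_lt₀ (by exact_mod_cast (Fact.out : p.Prime).one_lt))).mul_const _
  rw [zero_mul] at h1
  obtain ⟨n, hn⟩ := (h1.eventually (gt_mem_nhds one_pos)).exists
  exact ⟨n, by rw [mem_unitBall, norm_pow_nsmul]; exact hn.le⟩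

theorem isSeriesComplete_unitBall [CompleteSpace E] : IsSeriesComplete p (unitBall E) := by
  intro u hu
  have hp1 : (p : ℝ)⁻¹ < 1 := inv_lt_one_of_one_lt₀ (by exact_mod_cast (Fact.out : p.Prime).one_lt)
  have hsum : ∀ n, Summable fun i => p ^ i • u (n + i) := fun n => by
    refine Summable.of_norm_bounded (summable_geometric_of_lt_one (by positivity) hp1) fun i => ?_
    rw [norm_pow_nsmul]
    exact mul_le_of_le_one_right (by positivity) (hu _)
  have hmem : ∀ n, (∑' i, p ^ i • u (n + i)) ∈ unitBall E := fun n =>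
    IsUltrametricDist.norm_tsum_le_of_forall_le fun i => by
      rw [norm_pow_nsmul]
      exact mul_le_one₀ (pow_le_one₀ (by positivity) hp1.le) (norm_nonneg _) (hu _)
  refine ⟨_, hmem 0, fun n => ⟨_, hmem n, ?_⟩⟩
  rw [← (hsum 0).sum_add_tsum_nat_add n, ← (hsum n).tsum_const_smul]
  congr 1
  · simp
  · refine tsum_congr fun i => ?_
    rw [← mul_smul, ← pow_add, zero_add, add_comm]

theorem eq_zero_of_forall_eq_pow_nsmul {C : ℝ} {x : E}
    (h : ∀ n, ∃ m : E, ‖m‖ ≤ C ∧ x = p ^ n • m) : x = 0 := by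
  have hp1 : (p : ℝ)⁻¹ < 1 := inv_lt_one_of_one_lt₀ (by exact_mod_cast (Fact.out : p.Prime).one_lt)
  have h1 : Filter.Tendsto (fun n : ℕ => ((p : ℝ)⁻¹) ^ n * C) Filter.atTop (nhds (0 * C)) :=
    (tendsto_pow_atTop_nhds_zero_of_lt_one (by positivity) hp1).mul_const _
  rw [zero_mul] at h1
  refine norm_le_zero_iff.1 (ge_of_tendsto' h1 fun n => ?_)
  obtain ⟨m, hm, rfl⟩ := h n
  rw [norm_pow_nsmul]
  gcongr

theorem nsmul_prime_eq_zero {x : E} (h : p • x = 0) : x = 0 := by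
  rw [← Nat.cast_smul_eq_nsmul ℚ_[p]] at h
  exact (smul_eq_zero.1 h).resolve_left (Nat.cast_ne_zero.2 (Fact.out : p.Prime).ne_zero)

end UnitBall

/-! ### Reduced affinoid algebras -/

section TateIntegers

variable (p : ℕ) [Fact p.Prime] (n : ℕ)

/-- The unit ball `ℤ_p⟨T₁, …, Tₙ⟩` of the Tate algebra. -/
def tateIntegers : Subring (TateAlgebra p n) where
  carrier := {f | ∀ t, MvPowerSeries.coeff t (f : MvPowerSeries (Fin n) ℚ_[p]) ∈ PadicInt.subring p}
  zero_mem' := fun t => by simp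
  one_mem' := fun t => by
    classical
    change MvPowerSeries.coeff t (1 : MvPowerSeries (Fin n) ℚ_[p]) ∈ _
    rw [MvPowerSeries.coeff_one]
    split_ifs
    exacts [(PadicInt.subring p).one_mem, (PadicInt.subring p).zero_mem]
  add_mem' := fun ha hb t => (PadicInt.subring p).add_mem (ha t) (hb t)
  neg_mem' := fun ha t => (PadicInt.subring p).neg_mem (ha t)
  mul_mem' := fun {a b} ha hb t => by
    classical
    change MvPowerSeries.coeff t ((a : MvPowerSeries (Fin n) ℚ_[p]) * (b : MvPowerSeries (Fin n) ℚ_[p])) ∈ _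
    rw [MvPowerSeries.coeff_mul]
    exact sum_mem fun i _ => (PadicInt.subring p).mul_mem (ha _) (hb _)

variable {p n}

theorem mem_tateAlgebra {f : MvPowerSeries (Fin n) ℚ_[p]} : f ∈ TateAlgebra p n ↔
    Filter.Tendsto (fun t => ‖MvPowerSeries.coeff t f‖) Filter.cofinite (nhds 0) := by
  change MvPowerSeries.IsRestricted (fun _ => 1) f ↔ _
  simp [MvPowerSeries.IsRestricted, Finsupp.prod]

theorem TateAlgebra.finite_norm_coeff_ge (f : TateAlgebra p n) {ε : ℝ} (hε : 0 < ε) :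
    {t | ε ≤ ‖MvPowerSeries.coeff t (f : MvPowerSeries (Fin n) ℚ_[p])‖}.Finite := by
  have h := (mem_tateAlgebra.1 f.2).eventually (gt_mem_nhds hε)
  rw [Filter.eventually_cofinite] at h
  simpa using h

theorem exists_pow_nsmul_mem_tateIntegers (f : TateAlgebra p n) :
    ∃ k : ℕ, p ^ k • f ∈ tateIntegers p n := by
  obtain ⟨C, hC⟩ : ∃ C : ℝ, ∀ t,
      ‖MvPowerSeries.coeff t (f : MvPowerSeries (Fin n) ℚ_[p])‖ ≤ C := by
    obtain ⟨C, hC⟩ := ((TateAlgebra.finite_norm_coeff_ge f one_pos).image fun t =>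
      ‖MvPowerSeries.coeff t (f : MvPowerSeries (Fin n) ℚ_[p])‖).bddAbove
    refine ⟨max C 1, fun t => ?_⟩
    by_cases ht : 1 ≤ ‖MvPowerSeries.coeff t (f : MvPowerSeries (Fin n) ℚ_[p])‖
    · exact le_max_of_le_left (hC ⟨t, ht, rfl⟩)
    · exact le_max_of_le_right (not_le.1 ht).le
  obtain ⟨k, hk⟩ := pow_unbounded_of_one_lt C
    (show (1 : ℝ) < p by exact_mod_cast (Fact.out : p.Prime).one_lt)
  refine ⟨k, fun t => ?_⟩
  have hp : (0 : ℝ) < p := by exact_mod_cast (Fact.out : p.Prime).pos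
  change ‖MvPowerSeries.coeff t (p ^ k • (f : MvPowerSeries (Fin n) ℚ_[p]))‖ ≤ 1
  rw [map_nsmul, norm_pow_nsmul, inv_pow, inv_mul_le_iff₀ (by positivity), mul_one]
  exact (hC t).trans hk.le

theorem exists_padicInt_series (u : ℕ → ℚ_[p]) (hu : ∀ i, ‖u i‖ ≤ 1) :
    ∃ s : ℚ_[p], ∀ k, ∃ m : ℚ_[p], ‖m‖ ≤ 1 ∧
      s = ∑ i ∈ Finset.range k, p ^ i • u i + p ^ k • m := by
  obtain ⟨s, -, hs⟩ := isSeriesComplete_unitBall p (E := ℚ_[p]) u hu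
  exact ⟨s, hs⟩

/-- Sum coefficientwise in `ℤ_p`. The sum differs from each partial sum by coefficients of norm at
most `p ^ (-k)` uniformly in the index, so its coefficients still tend to zero. -/
theorem isSeriesComplete_tateIntegers :
    IsSeriesComplete p (tateIntegers p n).toAddSubgroup := by
  intro u hu
  let c : (Fin n →₀ ℕ) → ℕ → ℚ_[p] := fun t i =>
    MvPowerSeries.coeff t (u i : MvPowerSeries (Fin n) ℚ_[p])
  have h1 := fun t => exists_padicInt_series (c t) fun i => hu i t
  choose s' m' hm hs using h1
  let s : MvPowerSeries (Fin n) ℚ_[p] := s'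
  let m : ℕ → MvPowerSeries (Fin n) ℚ_[p] := fun k t => m' t k
  have hsum : ∀ k, s =
      ((∑ i ∈ Finset.range k, p ^ i • u i : TateAlgebra p n) : MvPowerSeries (Fin n) ℚ_[p]) +
        p ^ k • m k := by
    intro k
    ext t
    rw [map_add, map_nsmul]
    change s' t = _ + p ^ k • m' t k
    rw [hs t k]
    congr 1
    rw [AddSubmonoidClass.coe_finsetSum, map_sum]
    rfl
  have hsT : s ∈ TateAlgebra p n := by
    have hp1 : (p : ℝ)⁻¹ < 1 :=
      inv_lt_one_of_one_lt₀ (by exact_mod_cast (Fact.out : p.Prime).one_lt)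
    rw [mem_tateAlgebra, Metric.tendsto_nhds]
    intro ε hε
    obtain ⟨k, hk⟩ := exists_pow_lt_of_lt_one hε hp1
    have h2 := (mem_tateAlgebra.1 (∑ i ∈ Finset.range k, p ^ i • u i : TateAlgebra p n).2).eventually
      (gt_mem_nhds hε)
    filter_upwards [h2] with t ht
    rw [dist_zero_right, norm_norm, hsum k, map_add, map_nsmul]
    refine (IsUltrametricDist.norm_add_le_max _ _).trans_lt (max_lt ht ?_)
    rw [norm_pow_nsmul]
    exact (mul_le_of_le_one_right (by positivity) (hm t k)).trans_lt hk
  have hmT : ∀ k, m k ∈ TateAlgebra p n := by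
    intro k
    have hpk : (p : ℚ_[p]) ^ k ≠ 0 :=
      pow_ne_zero _ (Nat.cast_ne_zero.2 (Fact.out : p.Prime).ne_zero)
    have : m k = ((p : ℚ_[p]) ^ k)⁻¹ •
        (s -
          ((∑ i ∈ Finset.range k, p ^ i • u i : TateAlgebra p n) : MvPowerSeries (Fin n) ℚ_[p])) := by
      rw [eq_inv_smul_iff₀ hpk, hsum k, add_sub_cancel_left, ← Nat.cast_pow,
        Nat.cast_smul_eq_nsmul]
    rw [this]
    exact (TateAlgebra p n).smul_mem ((TateAlgebra p n).sub_mem hsT (SetLike.coe_mem _)) _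
  refine ⟨⟨s, hsT⟩, fun t => ?_, fun k => ⟨⟨_, hmT k⟩, fun t => hm t k, Subtype.ext (hsum k)⟩⟩
  have := hs t 0
  simp only [Finset.range_zero, Finset.sum_empty, zero_add, pow_zero, one_smul] at this
  change ‖s' t‖ ≤ 1
  rw [this]
  exact hm t 0

/-- The coordinates of the Tate algebra. -/
noncomputable def TateAlgebra.X (i : Fin n) : TateAlgebra p n :=
  ⟨MvPowerSeries.X i, MvPowerSeries.isRestricted_monomial _ _ _⟩

/-- Only finitely many coefficients have norm one; replacing these by congruent integers gives a
polynomial. Thus the reduction of the unit ball modulo `p` is generated by the coordinates. -/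
theorem exists_aeval_add_of_mem_tateIntegers {f : TateAlgebra p n} (hf : f ∈ tateIntegers p n) :
    ∃ (q : MvPolynomial (Fin n) ℤ) (g : TateAlgebra p n), g ∈ tateIntegers p n ∧
      f = MvPolynomial.aeval TateAlgebra.X q + p • g := by
  classical
  have h1 : ∀ x : ℚ_[p], ∃ a : ℤ, ‖x‖ ≤ 1 → ‖x - a‖ < 1 := by
    intro x
    by_cases hx : ‖x‖ ≤ 1
    · let y : ℤ_[p] := ⟨x, hx⟩
      obtain ⟨a, -, ha⟩ := PadicInt.exists_mem_range y
      rw [PadicInt.maximalIdeal_eq_span_p, Ideal.mem_span_singleton,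
        ← PadicInt.norm_lt_one_iff_dvd] at ha
      exact ⟨a, fun _ => by
        rw [PadicInt.norm_def, PadicInt.coe_sub, PadicInt.coe_natCast] at ha
        rwa [Int.cast_natCast]⟩
    · exact ⟨0, fun h => absurd h hx⟩
  choose a ha using h1
  let F := (TateAlgebra.finite_norm_coeff_ge f one_pos).toFinset
  let q : MvPolynomial (Fin n) ℤ := ∑ t ∈ F, MvPolynomial.monomial t
    (a (MvPowerSeries.coeff t (f : MvPowerSeries (Fin n) ℚ_[p])))
  have hq : ∀ t, MvPowerSeries.coeff t ((MvPolynomial.aeval TateAlgebra.X q : TateAlgebra p n) :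
      MvPowerSeries (Fin n) ℚ_[p]) = (MvPolynomial.coeff t q : ℤ) := by
    intro t
    have h2 : ∀ q : MvPolynomial (Fin n) ℤ, ((MvPolynomial.aeval TateAlgebra.X q : TateAlgebra p n) :
        MvPowerSeries (Fin n) ℚ_[p]) =
          ((MvPolynomial.map (Int.castRingHom ℚ_[p]) q : MvPolynomial (Fin n) ℚ_[p]) :
            MvPowerSeries (Fin n) ℚ_[p]) := by
      intro q
      have h3 : (TateAlgebra p n).val.toRingHom.comp
          (MvPolynomial.aeval (R := ℤ) (TateAlgebra.X (p := p) (n := n))).toRingHom =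
          (MvPolynomial.coeToMvPowerSeries.ringHom).comp
            (MvPolynomial.map (Int.castRingHom ℚ_[p])) :=
        MvPolynomial.ringHom_ext (by simp) (by
          intro i
          simp [TateAlgebra.X])
      exact RingHom.congr_fun h3 q
    rw [h2, MvPolynomial.coeff_coe, MvPolynomial.coeff_map]
    rfl
  have hcoeff : ∀ t, ‖MvPowerSeries.coeff t (f : MvPowerSeries (Fin n) ℚ_[p]) -
      (MvPolynomial.coeff t q : ℤ)‖ < 1 := by
    intro t
    simp only [q, MvPolynomial.coeff_sum, MvPolynomial.coeff_monomial, Finset.sum_ite_eq']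
    split_ifs with ht
    · exact ha _ (hf t)
    · simpa [F] using ht
  have hp0 : (p : ℚ_[p]) ≠ 0 := Nat.cast_ne_zero.2 (Fact.out : p.Prime).ne_zero
  refine ⟨q, (p : ℚ_[p])⁻¹ • (f - MvPolynomial.aeval TateAlgebra.X q), fun t => ?_, ?_⟩
  · change ‖MvPowerSeries.coeff t ((p : ℚ_[p])⁻¹ • ((f : MvPowerSeries (Fin n) ℚ_[p]) -
      ((MvPolynomial.aeval TateAlgebra.X q : TateAlgebra p n) : MvPowerSeries (Fin n) ℚ_[p])))‖ ≤ 1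
    rw [map_smul, map_sub, hq, norm_smul, norm_inv, Padic.norm_p, inv_inv]
    -- The value group is discrete: norm below one already means norm at most `p⁻¹`.
    have h4 := (Padic.norm_le_pow_iff_norm_lt_pow_add_one (p := p)
      (MvPowerSeries.coeff t (f : MvPowerSeries (Fin n) ℚ_[p]) - (MvPolynomial.coeff t q : ℤ))
      (-1)).2 (by simpa using hcoeff t)
    rw [zpow_neg_one] at h4
    have hp : (0 : ℝ) < p := by exact_mod_cast (Fact.out : p.Prime).pos
    calc _ ≤ (p : ℝ) * (p : ℝ)⁻¹ := by gcongr
      _ = 1 := mul_inv_cancel₀ hp.ne'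
  · rw [← Nat.cast_smul_eq_nsmul ℚ_[p], smul_inv_smul₀ hp0]
    abel

end TateIntegers

/-! ### Rings of definition and spectral integers of affinoid algebras. -/

section Affinoid

variable {p : ℕ} [Fact p.Prime]
variable {S : Type u} [NormedCommRing S] [NormOneClass S] [IsUltrametricDist S]
  [NormedAlgebra ℚ_[p] S]

theorem natCast_dvd_iff_nsmul {R : Type*} [CommRing R] {A : Subring R} {k : ℕ} {x : A} :
    (p : A) ^ k ∣ x ↔ ∃ m ∈ A, (x : R) = p ^ k • m := by
  constructor
  · rintro ⟨m, rfl⟩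
    exact ⟨m, m.2, by simp⟩
  · rintro ⟨m, hm, h⟩
    exact ⟨⟨m, hm⟩, Subtype.ext (by simp [h])⟩

omit [NormOneClass S] in
theorem isAdicComplete_of_isSeriesComplete {A : Subring S} {C : ℝ} (hC : ∀ a ∈ A, ‖a‖ ≤ C)
    (hA : IsSeriesComplete p A.toAddSubgroup) : IsAdicComplete (Ideal.span {(p : A)}) A := by
  refine isAdicComplete_span_singleton_iff.2 ⟨fun x hx => Subtype.ext ?_, fun u => ?_⟩
  · refine eq_zero_of_forall_eq_pow_nsmul p (C := C) fun n => ?_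
    obtain ⟨m, hm, h⟩ := natCast_dvd_iff_nsmul.1 (hx n)
    exact ⟨m, hC m hm, h⟩
  · obtain ⟨s, hs, h⟩ := hA (fun n => u n) fun n => (u n).2
    refine ⟨⟨s, hs⟩, fun n => natCast_dvd_iff_nsmul.2 ?_⟩
    obtain ⟨m, hm, h⟩ := h n
    refine ⟨m, hm, ?_⟩
    simp [h]

/-- A ring of definition of an affinoid algebra. -/
theorem IsAffinoid.exists_subring [CompleteSpace S] (hS : IsAffinoid p S) :
    ∃ A : Subring S, (∃ C : ℝ, ∀ a ∈ A, ‖a‖ ≤ C) ∧ IsAdicComplete (Ideal.span {(p : A)}) A ∧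
      Algebra.FiniteType ℤ (A ⧸ Ideal.span {(p : A)}) ∧ ∃ n : ℕ, ∀ x : S, ‖x‖ ≤ 1 → p ^ n • x ∈ A := by
  obtain ⟨n, φ, hφ, C, hC⟩ := hS
  -- The ring of definition is the image of the integral Tate algebra; the open mapping theorem
  -- below shows that it contains a multiple of the unit ball.
  let A := (tateIntegers p n).map φ.toRingHom
  have hAC : ∀ a ∈ A, ‖a‖ ≤ C := by
    rintro _ ⟨f, hf, rfl⟩
    exact hC f hf
  have hA : IsSeriesComplete p A.toAddSubgroup := by
    intro u hu
    choose f hf hfu using hu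
    obtain ⟨s, hs, hsum⟩ := isSeriesComplete_tateIntegers f hf
    refine ⟨φ s, ⟨s, hs, rfl⟩, fun k => ?_⟩
    obtain ⟨m, hm, rfl⟩ := hsum k
    refine ⟨φ m, ⟨m, hm, rfl⟩, ?_⟩
    rw [map_add, map_sum, map_nsmul]
    simp only [map_nsmul]
    congr 1
    exact Finset.sum_congr rfl fun i _ => congrArg _ (hfu i)
  refine ⟨A, ⟨C, hAC⟩, isAdicComplete_of_isSeriesComplete hAC hA, ?_, ?_⟩
  · have hX : ∀ i, (TateAlgebra.X i : TateAlgebra p n) ∈ tateIntegers p n := fun i t => by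
      classical
      change MvPowerSeries.coeff t (MvPowerSeries.X i) ∈ PadicInt.subring p
      rw [MvPowerSeries.coeff_X]
      split_ifs
      exacts [(PadicInt.subring p).one_mem, (PadicInt.subring p).zero_mem]
    let x : Fin n → A := fun i => ⟨φ (TateAlgebra.X i), _, hX i, rfl⟩
    refine Algebra.FiniteType.of_surjective (R := ℤ) (A := MvPolynomial (Fin n) ℤ)
      (((Ideal.Quotient.mk (Ideal.span {(p : A)})).comp
        (MvPolynomial.aeval (R := ℤ) x).toRingHom).toIntAlgHom) ?_
    intro y
    obtain ⟨⟨y, f, hf, rfl⟩, rfl⟩ := Ideal.Quotient.mk_surjective y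
    obtain ⟨q, g, hg, rfl⟩ := exists_aeval_add_of_mem_tateIntegers hf
    refine ⟨q, ?_⟩
    change Ideal.Quotient.mk (Ideal.span {(p : A)}) (MvPolynomial.aeval (R := ℤ) x q) = _
    rw [eq_comm, Ideal.Quotient.eq, Ideal.mem_span_singleton]
    refine ⟨⟨φ g, g, hg, rfl⟩, Subtype.ext ?_⟩
    have h1 : ((MvPolynomial.aeval (R := ℤ) x q : A) : S) =
        φ (MvPolynomial.aeval (R := ℤ) TateAlgebra.X q) := by
      have h2 : A.subtype.comp (MvPolynomial.aeval (R := ℤ) x).toRingHom =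
        φ.toRingHom.comp (MvPolynomial.aeval (R := ℤ) TateAlgebra.X).toRingHom :=
          MvPolynomial.ringHom_ext (by simp) (by intro i; simp [x])
      exact RingHom.congr_fun h2 q
    change φ (MvPolynomial.aeval (R := ℤ) TateAlgebra.X q + p • g) -
      ((MvPolynomial.aeval (R := ℤ) x q : A) : S) = ((p : A) : S) * φ g
    rw [h1, map_add, map_nsmul]
    simp
  · obtain ⟨c, hc⟩ : ∃ c : ℕ, C ≤ (p : ℝ) ^ c := by
      obtain ⟨c, hc⟩ := pow_unbounded_of_one_lt C
        (show (1 : ℝ) < p by exact_mod_cast (Fact.out : p.Prime).one_lt)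
      exact ⟨c, hc.le⟩
    have hp : (0 : ℝ) < p := by exact_mod_cast (Fact.out : p.Prime).pos
    obtain ⟨k, hk⟩ := isSeriesComplete_tateIntegers.exists_lift (isSeriesComplete_unitBall p)
      (fun y hy => eq_zero_of_forall_eq_pow_nsmul p (C := 1) hy) (fun y hy => nsmul_prime_eq_zero p hy)
      φ.toRingHom.toAddMonoidHom exists_pow_nsmul_mem_tateIntegers (fun y _ => hφ y) (c := c) (by
        intro m hm
        rw [mem_unitBall, norm_pow_nsmul, inv_pow, inv_mul_le_iff₀ (by positivity), mul_one]
        exact (hC m hm).trans hc)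
    exact ⟨k, fun x hx => hk x hx⟩

variable [IsReduced S] [CompleteSpace S]

/-- The integers of a reduced affinoid algebra are finite over a ring of definition. -/
theorem IsAffinoid.exists_subring_finite (hS : IsAffinoid p S) :
    ∃ A : Subring S, (∃ C : ℝ, ∀ a ∈ A, ‖a‖ ≤ C) ∧ IsAdicComplete (Ideal.span {(p : A)}) A ∧
      Algebra.FiniteType ℤ (A ⧸ Ideal.span {(p : A)}) ∧ IsNoetherianRing A ∧
      A ≤ spectralIntegers S ∧ ∃ n : ℕ, ∀ x ∈ spectralIntegers S, p ^ n • x ∈ A := by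
  obtain ⟨A, ⟨C, hC⟩, hA, hft, n, hn⟩ := hS.exists_subring
  have hpA : (p : A) ∈ nonZeroDivisors A := by
    rw [mem_nonZeroDivisors_iff_right]
    intro x hx
    refine Subtype.ext (nsmul_prime_eq_zero p ?_)
    have := congrArg Subtype.val hx
    simpa [mul_comm] using this
  have hnoeth : IsNoetherianRing A := .of_finiteType_quotient p
  have habs : ∀ x : S, ∃ k : ℕ, p ^ k • x ∈ A := fun x => by
    obtain ⟨k, hk⟩ := exists_pow_nsmul_mem_unitBall p x
    exact ⟨n + k, by rw [pow_add, mul_smul]; exact hn _ hk⟩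
  have hloc : IsLocalization.Away (p : A) S :=
    { map_units := by
        rintro ⟨_, k, rfl⟩
        simpa using (natCast_isUnit_of_padic p (R := S)).pow k
      surj := by
        intro z
        obtain ⟨k, hk⟩ := habs z
        refine ⟨(⟨_, hk⟩, ⟨(p : A) ^ k, k, rfl⟩), ?_⟩
        change z * (((p : A) ^ k : A) : S) = p ^ k • z
        simp [mul_comm]
      exists_of_eq := by
        intro x y h
        exact ⟨1, by simpa using Subtype.ext h⟩ }
  have : IsReduced A := isReduced_of_injective A.subtype Subtype.val_injective
  have hfin := Module.Finite.integralClosure_away p hpA S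
  refine ⟨A, ⟨C, hC⟩, hA, hft, hnoeth, ?_, ?_⟩
  -- `A` is a bounded ring, so the powers of `a` are bounded, while a spectral seminorm above one is
  -- power-multiplicative and would force them to grow.
  · intro a ha
    have hpow : IsPowMul (spectralSeminorm S) :=
      isPowMul_smoothingFun (normRingSeminorm S) (norm_one (α := S)).le
    by_contra h
    rw [mem_spectralIntegers, not_le] at h
    obtain ⟨m, hm⟩ := pow_unbounded_of_one_lt C h
    have h1 := hpow a (Nat.le_add_left 1 m)
    have h2 := (spectralSeminorm_le_norm S (a ^ (m + 1))).trans (hC _ (pow_mem ha _))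
    have h3 := pow_lt_pow_right₀ h (Nat.lt_succ_self m)
    rw [Nat.succ_eq_add_one, ← h1] at h3
    linarith
  -- Finiteness of the integral closure gives one denominator `p ^ K` for all its elements.
  · obtain ⟨K, hK⟩ : ∃ K : ℕ, ∀ x ∈ integralClosure A S, p ^ K • x ∈ A := by
      obtain ⟨t, ht⟩ := hfin
      choose k hk using fun x : S => habs x
      let K := t.sup fun x => k x
      let W : Submodule A (integralClosure A S) :=
        { carrier := {x | p ^ K • (x : S) ∈ A}
          zero_mem' := by simp
          add_mem' := fun {x y} hx hy => by
            change p ^ K • ((x : S) + y) ∈ A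
            rw [smul_add]; exact A.add_mem hx hy
          smul_mem' := fun a x hx => by
            change p ^ K • ((a : S) * x) ∈ A
            rw [← mul_smul_comm]; exact A.mul_mem a.2 hx }
      have hW : Submodule.span A (t : Set (integralClosure A S)) ≤ W := by
        refine Submodule.span_le.2 fun x hx => ?_
        obtain ⟨d, hd⟩ := Nat.exists_eq_add_of_le (Finset.le_sup (f := fun x => k x.1) hx)
        change p ^ K • (x : S) ∈ A
        rw [show K = k x + d from hd, add_comm, pow_add, mul_smul]
        exact A.nsmul_mem (hk x) _
      exact ⟨K, fun x hx => hW (ht ▸ Submodule.mem_top : (⟨x, hx⟩ : integralClosure A S) ∈ _)⟩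
    refine ⟨K + 1, fun x hx => ?_⟩
    rw [pow_add, mul_smul, pow_one]
    refine hK _ ?_
    -- Any bound strictly between `1` and `2 ≤ p` serves. With `3 / 2`, eventually `‖x ^ m‖ ≤ (3 /
    -- 2) ^ m`, so `(p • x) ^ m` has norm at most `(3 / 4) ^ m` and finally falls into `A`. Thus `p
    -- • x` is integral over `A`, which explains the exponent `K + 1`.
    obtain ⟨m, hm, hxm⟩ : ∃ m : ℕ, 0 < m ∧ (p • x) ^ m ∈ A := by
      have hp2 : (2 : ℝ) ≤ p := by exact_mod_cast (Fact.out : p.Prime).two_le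
      have h1 := (tendsto_smoothingFun_of_map_one_le_one (normRingSeminorm S)
        (norm_one (α := S)).le x).eventually
          (gt_mem_nhds (lt_of_le_of_lt hx (by norm_num : (1 : ℝ) < 3 / 2)))
      obtain ⟨k, hk⟩ := exists_pow_lt_of_lt_one
        (show (0 : ℝ) < (p : ℝ)⁻¹ ^ n by positivity) (show (3 / 4 : ℝ) < 1 by norm_num)
      obtain ⟨m, hm, hmk⟩ := (h1.and (Filter.eventually_ge_atTop (k + 1))).exists
      refine ⟨m, by omega, ?_⟩
      have hm0 : (0 : ℝ) < m := by exact_mod_cast (by omega : 0 < m)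
      have h2 : ‖x ^ m‖ ≤ (3 / 2) ^ m := by
        have h3 : (‖x ^ m‖ ^ (1 / (m : ℝ))) ^ (m : ℝ) ≤ (3 / 2 : ℝ) ^ (m : ℝ) :=
          Real.rpow_le_rpow (by positivity) hm.le hm0.le
        rwa [← Real.rpow_mul (norm_nonneg _), one_div, inv_mul_cancel₀ hm0.ne', Real.rpow_one,
          Real.rpow_natCast] at h3
      have h4 : ‖(p • x) ^ m‖ ≤ (p : ℝ)⁻¹ ^ n := by
        rw [smul_pow, norm_pow_nsmul]
        calc (p : ℝ)⁻¹ ^ m * ‖x ^ m‖ ≤ (2 : ℝ)⁻¹ ^ m * (3 / 2) ^ m := by gcongr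
          _ = (3 / 4 : ℝ) ^ m := by rw [← mul_pow]; norm_num
          _ ≤ (3 / 4 : ℝ) ^ k := pow_le_pow_of_le_one (by norm_num) (by norm_num) (by omega)
          _ ≤ _ := hk.le
      have hp0 : (p : ℚ_[p]) ^ n ≠ 0 :=
        pow_ne_zero _ (Nat.cast_ne_zero.2 (Fact.out : p.Prime).ne_zero)
      have h5 : (p • x) ^ m = p ^ n • (((p : ℚ_[p]) ^ n)⁻¹ • (p • x) ^ m) := by
        rw [← Nat.cast_smul_eq_nsmul ℚ_[p] (p ^ n), Nat.cast_pow, smul_inv_smul₀ hp0]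
      rw [h5]
      refine hn _ ?_
      rw [norm_smul, norm_inv, norm_pow, Padic.norm_p, inv_mul_le_iff₀ (by positivity), mul_one]
      exact h4
    exact IsIntegral.of_pow hm (isIntegral_algebraMap (R := A) (x := ⟨_, hxm⟩))

theorem IsAffinoid.exists_norm_le (hS : IsAffinoid p S) :
    ∃ C : ℝ, ∀ x ∈ spectralIntegers S, ‖x‖ ≤ C := by
  obtain ⟨A, ⟨C, hC⟩, -, -, -, -, n, hn⟩ := hS.exists_subring_finite
  refine ⟨(p : ℝ) ^ n * C, fun x hx => ?_⟩
  have hp : (0 : ℝ) < p := by exact_mod_cast (Fact.out : p.Prime).pos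
  have := hC _ (hn x hx)
  rwa [norm_pow_nsmul, inv_pow, inv_mul_le_iff₀ (by positivity)] at this

/-- Multiplication by `p ^ n` embeds `O_S` as an `A`-module into the noetherian ring `A`. -/
theorem IsAffinoid.spectralIntegers_finite (hS : IsAffinoid p S) :
    ∃ (A : Type u) (_ : CommRing A) (_ : IsAdicComplete (Ideal.span {(p : A)}) A)
      (_ : Algebra A (spectralIntegers S)), Module.Finite A (spectralIntegers S) ∧
      Algebra.FiniteType ℤ (A ⧸ Ideal.span {(p : A)}) := by
  obtain ⟨A, -, hA, hft, hnoeth, hle, n, hn⟩ := hS.exists_subring_finite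
  let _ : Algebra A (spectralIntegers S) := (Subring.inclusion hle).toAlgebra
  refine ⟨A, inferInstance, hA, inferInstance, ?_, hft⟩
  let f : spectralIntegers S →ₗ[A] A :=
    { toFun := fun x => ⟨p ^ n • (x : S), hn x x.2⟩
      map_add' := fun x y => Subtype.ext (by simp)
      map_smul' := fun a x => Subtype.ext (by
        change p ^ n • ((a : S) * x) = a * p ^ n • (x : S)
        rw [mul_smul_comm]) }
  refine Module.Finite.of_injective f fun x y hxy => Subtype.ext ?_
  have h1 : p ^ n • (x : S) = p ^ n • (y : S) := congrArg Subtype.val hxy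
  have hp0 : (p : ℚ_[p]) ^ n ≠ 0 :=
    pow_ne_zero _ (Nat.cast_ne_zero.2 (Fact.out : p.Prime).ne_zero)
  rw [← Nat.cast_smul_eq_nsmul ℚ_[p], ← Nat.cast_smul_eq_nsmul ℚ_[p], Nat.cast_pow] at h1
  exact smul_right_injective S hp0 h1

theorem IsAffinoid.finiteType_quotient (hS : IsAffinoid p S) :
    Algebra.FiniteType ℤ (spectralIntegers S ⧸ Ideal.span {(p : spectralIntegers S)}) := by
  obtain ⟨A, _, _, _, hfin, hft⟩ := hS.spectralIntegers_finite
  have hle : Ideal.span {(p : A)} ≤ (Ideal.span {(p : spectralIntegers S)}).comap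
      (algebraMap A (spectralIntegers S)) := by
    rw [Ideal.span_le, Set.singleton_subset_iff]
    change algebraMap A (spectralIntegers S) p ∈ Ideal.span _
    rw [map_natCast]
    exact Ideal.mem_span_singleton_self _
  let g := Ideal.quotientMap (Ideal.span {(p : spectralIntegers S)})
    (algebraMap A (spectralIntegers S)) hle
  have hg : g.Finite := by
    have h1 : ((Ideal.Quotient.mk (Ideal.span {(p : spectralIntegers S)})).comp
        (algebraMap A (spectralIntegers S))).Finite :=
      (RingHom.Finite.of_surjective _ Ideal.Quotient.mk_surjective).comp
        (RingHom.finite_algebraMap.2 hfin)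
    refine RingHom.Finite.of_comp_finite (f := Ideal.Quotient.mk (Ideal.span {(p : A)})) ?_
    rwa [Ideal.quotientMap_comp_mk]
  have h2 := (RingHom.FiniteType.of_finite hg).comp (RingHom.finiteType_algebraMap.2 hft)
  rw [← RingHom.finiteType_algebraMap]
  convert h2
  exact Subsingleton.elim _ _

/-- By integrality a maximal ideal contracts to a maximal ideal of the `p`-adically complete ring
`A`, whose Jacobson radical contains `p`. -/
theorem IsAffinoid.natCast_mem_of_isMaximal (hS : IsAffinoid p S)
    (m : Ideal (spectralIntegers S)) [m.IsMaximal] : (p : spectralIntegers S) ∈ m := by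
  obtain ⟨A, _, _, _, hfin, -⟩ := hS.spectralIntegers_finite
  have : Algebra.IsIntegral A (spectralIntegers S) := inferInstance
  have h1 := Ideal.isMaximal_comap_of_isIntegral_of_isMaximal (R := A) m
  have h2 : (p : A) ∈ m.comap (algebraMap A _) := by
    have h3 := IsAdicComplete.le_jacobson_bot (Ideal.span {(p : A)})
      (Ideal.mem_span_singleton_self _)
    exact Ideal.mem_sInf.1 h3 ⟨bot_le, h1⟩
  simpa using h2

end Affinoid

/-! ### Roots of units in the maximal étale extension. -/

section PthRoots

variable {p : ℕ} [Fact p.Prime]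

open Polynomial in
-- As `p` and `u` are invertible, `X ^ p - u` is separable and defines a finite étale cover. A
-- section sends the adjoined root to a `p`-th root of `u`.
theorem IsMaximalEtaleExtension.exists_pow_eq (S : Type u) {Sbar : Type v} [CommRing S]
    [CommRing Sbar] [Algebra S Sbar] [IsMaximalEtaleExtension S Sbar] (hp : IsUnit (p : Sbar))
    {u : Sbar} (hu : IsUnit u) : ∃ z : Sbar, z ^ p = u := by
  have hp0 : p ≠ 0 := (Fact.out : p.Prime).ne_zero
  obtain ⟨u, rfl⟩ := hu
  obtain ⟨q, hq⟩ := hp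
  have hmonic : (X ^ p - C (u : Sbar)).Monic := monic_X_pow_sub_C _ hp0
  let P : StandardEtalePair Sbar :=
    { f := X ^ p - C (u : Sbar)
      monic_f := hmonic
      g := 1
      cond := by
        -- The Bézout relation `(X / (p u)) f' - u⁻¹ f = 1` for `f = X ^ p - u`.
        refine ⟨C ((q⁻¹ : Sbarˣ) * (u⁻¹ : Sbarˣ) : Sbar) * X, - C ((u⁻¹ : Sbarˣ) : Sbar), 1, ?_⟩
        have h1 : (X : Sbar[X]) ^ (p - 1) * X = X ^ p := pow_sub_one_mul hp0 _
        have h2 : C ((q⁻¹ : Sbarˣ) : Sbar) * C (p : Sbar) = 1 := by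
          rw [← C_mul, ← hq, Units.inv_mul, C_1]
        have h3 : C ((u⁻¹ : Sbarˣ) : Sbar) * C (u : Sbar) = 1 := by
          rw [← C_mul, Units.inv_mul, C_1]
        simp only [derivative_sub, derivative_X_pow, derivative_C, sub_zero, C_mul, pow_one]
        calc _ = (C ((q⁻¹ : Sbarˣ) : Sbar) * C (p : Sbar)) * C ((u⁻¹ : Sbarˣ) : Sbar) *
              (X ^ (p - 1) * X) - C ((u⁻¹ : Sbarˣ) : Sbar) * X ^ p +
                C ((u⁻¹ : Sbarˣ) : Sbar) * C (u : Sbar) := by ring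
          _ = 1 := by rw [h1, h2, h3]; ring }
  have hfin : Module.Finite Sbar (AdjoinRoot P.f) := hmonic.finite_adjoinRoot
  have hfree : Module.Free Sbar (AdjoinRoot P.f) := hmonic.free_adjoinRoot
  have h1 : IsUnit (AdjoinRoot.mk P.f P.g) := by
    rw [show P.g = 1 from rfl, map_one]; exact isUnit_one
  let e : AdjoinRoot P.f ≃ₐ[Sbar] P.Ring :=
    ((IsLocalization.atUnit (AdjoinRoot P.f) (Localization.Away (AdjoinRoot.mk P.f P.g))
      (AdjoinRoot.mk P.f P.g) h1).restrictScalars Sbar).trans P.equivAwayAdjoinRoot.symm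
  have : Algebra.Etale Sbar (AdjoinRoot P.f) := Algebra.Etale.of_equiv e.symm
  obtain ⟨s⟩ := IsMaximalEtaleExtension.exists_section (S := S) (AdjoinRoot P.f) hfin this
    ((injective_iff_map_eq_zero _).2 fun a ha => by
      nontriviality Sbar
      have h2 : P.f ∣ C a := AdjoinRoot.mk_eq_zero.1 ha
      rw [← modByMonic_eq_zero_iff_dvd P.monic_f, (modByMonic_eq_self_iff P.monic_f).2, C_eq_zero]
        at h2
      · exact h2
      · change _ < (X ^ p - C (u : Sbar)).degree
        rw [degree_X_pow_sub_C (Nat.pos_of_ne_zero hp0)]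
        exact degree_C_le.trans_lt (by exact_mod_cast Nat.pos_of_ne_zero hp0))
  refine ⟨s (AdjoinRoot.root P.f), ?_⟩
  have h3 : (AdjoinRoot.root P.f) ^ p - algebraMap Sbar _ (u : Sbar) = 0 := by
    have := AdjoinRoot.eval₂_root P.f
    rw [show P.f = X ^ p - C (u : Sbar) from rfl] at this
    simpa [eval₂_sub, eval₂_pow] using this
  have h4 := congrArg s h3
  rw [map_sub, map_pow, map_zero, AlgHom.commutes, sub_eq_zero] at h4
  exact h4

end PthRoots

/-! ### Frobenius modulo `p` and the kernel of the projection from the tilt. -/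

section FrobeniusSurjective

variable {p : ℕ} [Fact p.Prime] {Λ : Type u} {T : Type v} [CommRing Λ] [CommRing T] [Algebra Λ T]

/-- A compatible system of `p`-power roots of `p`. -/
theorem exists_pth_root_system (hp : IsUnit (p : T)) (hroot : ∀ u : T, IsUnit u → ∃ z, z ^ p = u) :
    ∃ ϖ : ℕ → integralClosure Λ T, ϖ 0 = p ∧ (∀ n, ϖ (n + 1) ^ p = ϖ n) := by
  have hp0 : p ≠ 0 := (Fact.out : p.Prime).ne_zero
  have h1 : ∀ u : {x : integralClosure Λ T // IsUnit (x : T)},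
      ∃ z : {x : integralClosure Λ T // IsUnit (x : T)}, z.1 ^ p = u.1 := by
    rintro ⟨⟨u, hu⟩, hu'⟩
    obtain ⟨z, rfl⟩ := hroot u hu'
    exact ⟨⟨⟨z, IsIntegral.of_pow (Nat.pos_of_ne_zero hp0) hu⟩, (isUnit_pow_iff hp0).1 hu'⟩, rfl⟩
  choose f hf using h1
  let g : ℕ → {x : integralClosure Λ T // IsUnit (x : T)} := fun n =>
    Nat.rec ⟨(p : integralClosure Λ T), by simpa using hp⟩ (fun _ z => f z) n
  exact ⟨fun n => (g n).1, rfl, fun n => hf (g n)⟩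

theorem natCast_mem_jacobson_integralClosure
    (hjac : ∀ m : Ideal Λ, m.IsMaximal → (p : Λ) ∈ m) :
    (p : integralClosure Λ T) ∈ (⊥ : Ideal (integralClosure Λ T)).jacobson := by
  refine Ideal.mem_sInf.2 fun {m} hm => ?_
  have := hm.2
  have h1 := hjac _ (Ideal.isMaximal_comap_of_isIntegral_of_isMaximal (R := Λ) m)
  simpa using h1

/-- The quotient `b / a` exists in `T`, and its `n`-th power is integral, hence so is it. -/
theorem pow_dvd_pow_of_integralClosure {n : ℕ} (hn : 0 < n) {a b : integralClosure Λ T}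
    (ha : IsUnit (a : T)) (h : a ^ n ∣ b ^ n) : a ∣ b := by
  obtain ⟨c, hc⟩ := h
  obtain ⟨u, hu⟩ := ha
  have h1 : (((u⁻¹ : Tˣ) : T) * b) ^ n = c := by
    have h2 : (b : T) ^ n = (a : T) ^ n * c := by exact_mod_cast congrArg Subtype.val hc
    rw [mul_pow, h2, ← hu, ← mul_assoc, ← mul_pow, Units.inv_mul, one_pow, one_mul]
  refine ⟨⟨((u⁻¹ : Tˣ) : T) * b, IsIntegral.of_pow hn (h1 ▸ c.2)⟩, Subtype.ext ?_⟩
  change (b : T) = a * (((u⁻¹ : Tˣ) : T) * b)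
  rw [← hu, Units.mul_inv_cancel_left]

/-- Put `π = p ^ (1/p²)`. Then `1 + π ^ p x` is a unit because `p` is in the Jacobson radical; if
`(1 + w) ^ p` equals it, then `w ^ p ≡ π ^ p x` modulo `p`, so `t = w / π` is integral and `t ^ p ≡
x` modulo `π ^ p`. Repeating this on the remainder `p` times reaches the modulus `(π ^ p) ^ p = p`.
-/
theorem exists_eq_pow_add_mul (hp : IsUnit (p : T))
    (hroot : ∀ u : T, IsUnit u → ∃ z, z ^ p = u)
    (hjac : ∀ m : Ideal Λ, m.IsMaximal → (p : Λ) ∈ m) (x : integralClosure Λ T) :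
    ∃ t b : integralClosure Λ T, x = t ^ p + p * b := by
  have hpr : p.Prime := Fact.out
  obtain ⟨ϖ, h0, hϖ⟩ := exists_pth_root_system (Λ := Λ) hp hroot
  let π := ϖ 2
  have hπ : (π ^ p) ^ p = p := by rw [hϖ 1, hϖ 0, h0]
  have hπu : IsUnit (π : T) := by
    have h1 : ((π : T) ^ p) ^ p = p := by exact_mod_cast congrArg Subtype.val hπ
    rw [← h1, isUnit_pow_iff hpr.ne_zero, isUnit_pow_iff hpr.ne_zero] at hp
    exact hp
  have step : ∀ x : integralClosure Λ T, ∃ t a, x = t ^ p + π ^ p * a := by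
    intro x
    have h1 : IsUnit (1 + π ^ p * x) := by
      have h2 : π ^ p * x ∈ (⊥ : Ideal (integralClosure Λ T)).jacobson := by
        refine Ideal.mem_sInf.2 fun {m} hm => ?_
        have hm' := hm.2
        refine hm'.isPrime.mem_of_pow_mem p ?_
        rw [mul_pow, hπ]
        exact m.mul_mem_right _ (Ideal.mem_sInf.1 (natCast_mem_jacobson_integralClosure hjac) hm)
      have h3 := (Ideal.mem_jacobson_bot.1 h2) 1
      rwa [mul_one, add_comm] at h3
    obtain ⟨z, hz⟩ := hroot _ (h1.map (integralClosure Λ T).val)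
    have hzi : z ∈ integralClosure Λ T :=
      IsIntegral.of_pow hpr.pos (hz ▸ (1 + π ^ p * x).2)
    let w : integralClosure Λ T := ⟨z, hzi⟩ - 1
    have hw : (w + 1) ^ p = 1 + π ^ p * x := by
      rw [sub_add_cancel]
      exact Subtype.ext hz
    obtain ⟨r, hr⟩ := exists_add_pow_prime_eq hpr w (1 : integralClosure Λ T)
    rw [hw, one_pow, mul_one] at hr
    have hpow : (p : integralClosure Λ T) = π ^ p * π ^ (p * (p - 1)) := by
      rw [← hπ, ← pow_mul, ← pow_add]
      congr 1
      obtain ⟨k, hk⟩ := Nat.exists_eq_add_of_le' hpr.one_le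
      rw [hk, Nat.add_sub_cancel]; ring
    have h5 : w ^ p = π ^ p * (x - π ^ (p * (p - 1)) * w * r) := by
      have : π ^ p * x = w ^ p + p * w * r := by linear_combination hr
      rw [mul_sub, this, hpow]; ring
    obtain ⟨t, ht⟩ := pow_dvd_pow_of_integralClosure hpr.pos hπu ⟨_, h5⟩
    have hcancel : ∀ a b : integralClosure Λ T, π ^ p * a = π ^ p * b → a = b := by
      intro a b h
      have h6 : ((π : T) ^ p) * a = (π : T) ^ p * b := by
        exact_mod_cast congrArg Subtype.val h
      exact Subtype.ext ((hπu.pow p).mul_left_cancel h6)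
    have h7 : t ^ p = x - π ^ (p * (p - 1)) * w * r := by
      apply hcancel
      rw [← h5, ht, mul_pow]
    obtain ⟨k, hk⟩ := Nat.exists_eq_add_of_le hpr.two_le
    refine ⟨t, π ^ (p * (p - 2)) * w * r, ?_⟩
    rw [h7]
    have : π ^ (p * (p - 1)) = π ^ p * π ^ (p * (p - 2)) := by
      rw [← pow_add]
      congr 1
      rw [hk, show 2 + k - 1 = k + 1 by omega, show 2 + k - 2 = k by omega]; ring
    rw [this]; ring
  have key : ∀ m : ℕ, ∃ t a b, x = t ^ p + (π ^ m) ^ p * a + p * b := by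
    intro m
    induction m with
    | zero => exact ⟨0, x, 0, by simp [hpr.ne_zero]⟩
    | succ m ih =>
      obtain ⟨t, a, b, h⟩ := ih
      obtain ⟨s, a', h'⟩ := step a
      obtain ⟨r, hr⟩ := exists_add_pow_prime_eq hpr t (π ^ m * s)
      refine ⟨t + π ^ m * s, a', b - t * (π ^ m * s) * r, ?_⟩
      rw [hr, h, h']
      ring
  obtain ⟨t, a, b, h⟩ := key p
  refine ⟨t, a + b, ?_⟩
  rw [h, hπ]; ring

/-- The kernel of the projection from the perfection of `O / p` to `O / p` is principal. -/
theorem exists_perfection_dvd (hp : IsUnit (p : T))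
    (hroot : ∀ u : T, IsUnit u → ∃ z, z ^ p = u) {R : Type w} [CommRing R] [CharP R p]
    (g : integralClosure Λ T →+* R) (hg : Function.Surjective g)
    (hker : ∀ x, g x = 0 ↔ (p : integralClosure Λ T) ∣ x) :
    ∃ y : Perfection R p, Perfection.coeff R p 0 y = 0 ∧
      ∀ x, Perfection.coeff R p 0 x = 0 → y ∣ x := by
  have hpr : p.Prime := Fact.out
  obtain ⟨ϖ, h0, hϖ⟩ := exists_pth_root_system (Λ := Λ) hp hroot
  have hϖp : ∀ n, ϖ n ^ p ^ n = p := by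
    intro n
    induction n with
    | zero => rw [pow_zero, pow_one, h0]
    | succ n ih => rw [pow_succ', pow_mul, hϖ, ih]
  have hϖu : ∀ n, IsUnit (ϖ n : T) := by
    intro n
    have h1 : (ϖ n : T) ^ p ^ n = p := by exact_mod_cast congrArg Subtype.val (hϖp n)
    rw [← h1, isUnit_pow_iff (pow_ne_zero _ hpr.ne_zero)] at hp
    exact hp
  have hcancel : ∀ n, ∀ {a b : integralClosure Λ T}, ϖ n * a = ϖ n * b → a = b := by
    intro n a b h
    have h6 : (ϖ n : T) * a = (ϖ n : T) * b := by exact_mod_cast congrArg Subtype.val h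
    exact Subtype.ext ((hϖu n).mul_left_cancel h6)
  have hgp : g p = 0 := (hker _).2 dvd_rfl
  -- The generator is `p♭`, given by the compatible roots `p ^ (1/pⁿ)`.
  let y : Perfection R p := ⟨fun n => g (ϖ n), fun n => by
    change g (ϖ (n + 1)) ^ p = g (ϖ n)
    rw [← map_pow, hϖ]⟩
  refine ⟨y, ?_, fun x hx => ?_⟩
  · change g (ϖ 0) = 0
    rw [h0, hgp]
  choose X hX using fun n => hg (Perfection.coeff R p n x)
  have hXp : ∀ n, ∃ e, X (n + 1) ^ p = X n + p * e := by
    intro n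
    have h1 : g (X (n + 1) ^ p - X n) = 0 := by
      rw [map_sub, map_pow, hX, hX, Perfection.coeff_pow_p', sub_self]
    obtain ⟨e, he⟩ := (hker _).1 h1
    exact ⟨e, by linear_combination he⟩
  -- The `p ^ n`-th power of `X n` vanishes modulo `p = ϖ n ^ p ^ n`, because the zeroth component
  -- of `x` is zero.
  have hY : ∀ n, ϖ n ∣ X n := by
    intro n
    refine pow_dvd_pow_of_integralClosure (pow_pos hpr.pos n) (hϖu n) ?_
    rw [hϖp, ← hker, map_pow, hX]
    have h1 : ∀ n, Perfection.coeff R p n x ^ p ^ n = 0 := by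
      intro n
      induction n with
      | zero => rw [pow_zero, pow_one, hx]
      | succ n ih => rw [pow_succ', pow_mul, Perfection.coeff_pow_p', ih]
    exact h1 n
  choose Y hY using hY
  have hq : ∀ n, ∃ q, (p : integralClosure Λ T) = ϖ n * q := fun n => by
    obtain ⟨k, hk⟩ := Nat.exists_eq_add_of_le' (Nat.one_le_pow n p hpr.pos)
    exact ⟨ϖ n ^ k, by rw [← hϖp n, hk, pow_succ']⟩
  choose q hq using hq
  choose e he using hXp
  have hYp : ∀ n, Y (n + 1) ^ p = Y n + q n * e n := by
    intro n
    apply hcancel n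
    have := he n
    rw [hY, hY, mul_pow, hϖ] at this
    rw [this]
    linear_combination (e n) * hq n
  have hqp : ∀ n, g (q (n + 1) ^ p) = 0 := by
    intro n
    rw [hker]
    obtain ⟨k, hk⟩ := Nat.exists_eq_add_of_le' hpr.two_le
    refine ⟨p ^ k * q n, ?_⟩
    apply hcancel n
    have h1 : (p : integralClosure Λ T) ^ p = ϖ n * q (n + 1) ^ p := by
      conv_lhs => rw [hq (n + 1), mul_pow, hϖ]
    rw [← h1]
    calc (p : integralClosure Λ T) ^ p = p * p ^ k * p := by
          rw [mul_right_comm, ← sq, ← pow_add, add_comm 2, ← hk]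
      _ = p * p ^ k * (ϖ n * q n) := by rw [← hq n]
      _ = _ := by ring
  -- The quotients `Y n` are compatible only up to multiples of `q n = p / ϖ n`. Shifting by one and
  -- taking `p`-th powers repairs this, since `p` divides `q (n + 1) ^ p`; the product with `y` is
  -- unaffected because `ϖ n * q n = p`.
  let z : Perfection R p := ⟨fun n => g (Y (n + 1) ^ p), fun n => by
    change g (Y (n + 2) ^ p) ^ p = g (Y (n + 1) ^ p)
    rw [hYp (n + 1), map_add, add_pow_char, map_mul, mul_pow, ← map_pow g (q (n + 1)), hqp,
      zero_mul, add_zero, map_pow]⟩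
  refine ⟨z, Perfection.ext fun n => ?_⟩
  rw [map_mul, ← hX]
  change g (X n) = g (ϖ n) * g (Y (n + 1) ^ p)
  rw [← map_mul, hYp, hY, mul_add, ← mul_assoc, ← hq, map_add, map_mul g (p : integralClosure Λ T),
    hgp, zero_mul, add_zero]

end FrobeniusSurjective

/-- Elements of `Λ` congruent modulo `I` to elements of `A` form a subring containing `pΛ` and lifts
of generators of `Λ / p`, hence all of `Λ`. This reduces questions on `Λ ⊗ A` modulo `I` to `A`. -/
theorem exists_tmul_sub_mem {Λ : Type u} {A : Type v} [CommRing Λ] [CommRing A] {p : ℕ}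
    {s : Set (Λ ⧸ Ideal.span {(p : Λ)})} (hs : Algebra.adjoin ℤ s = ⊤) (I : Ideal (Λ ⊗[ℤ] A))
    (hp : (p : Λ ⊗[ℤ] A) ∈ I)
    (hI : ∀ g ∈ s, ∃ x : Λ, Ideal.Quotient.mk _ x = g ∧ ∃ a : A, x ⊗ₜ 1 - 1 ⊗ₜ a ∈ I)
    (z : Λ ⊗[ℤ] A) : ∃ a : A, z - 1 ⊗ₜ a ∈ I := by
  have hmul : ∀ {x y : Λ ⊗[ℤ] A}, (∃ a : A, x - 1 ⊗ₜ a ∈ I) → (∃ a : A, y - 1 ⊗ₜ a ∈ I) →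
      ∃ a : A, x * y - 1 ⊗ₜ a ∈ I := by
    rintro x y ⟨a, ha⟩ ⟨b, hb⟩
    refine ⟨a * b, ?_⟩
    have h1 : (1 : Λ) ⊗ₜ[ℤ] (a * b) = (1 ⊗ₜ a) * (1 ⊗ₜ b) := by
      rw [Algebra.TensorProduct.tmul_mul_tmul, one_mul]
    have h2 : x * y - (1 ⊗ₜ a) * (1 ⊗ₜ b) = (x - 1 ⊗ₜ a) * y + 1 ⊗ₜ a * (y - 1 ⊗ₜ b) := by ring
    rw [h1, h2]
    exact I.add_mem (I.mul_mem_right _ ha) (I.mul_mem_left _ hb)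
  have hadd : ∀ {x y : Λ ⊗[ℤ] A}, (∃ a : A, x - 1 ⊗ₜ a ∈ I) → (∃ a : A, y - 1 ⊗ₜ a ∈ I) →
      ∃ a : A, x + y - 1 ⊗ₜ a ∈ I := by
    rintro x y ⟨a, ha⟩ ⟨b, hb⟩
    refine ⟨a + b, ?_⟩
    rw [TensorProduct.tmul_add, add_sub_add_comm]
    exact I.add_mem ha hb
  let D : Subring Λ :=
    { carrier := {x | ∃ a : A, x ⊗ₜ 1 - 1 ⊗ₜ a ∈ I}
      zero_mem' := ⟨0, by simp⟩
      one_mem' := ⟨1, by simp⟩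
      add_mem' := fun {x y} hx hy => by
        have := hadd hx hy
        rwa [← TensorProduct.add_tmul] at this
      neg_mem' := by
        rintro x ⟨a, ha⟩
        refine ⟨-a, ?_⟩
        rw [TensorProduct.tmul_neg, TensorProduct.neg_tmul, ← neg_sub', neg_mem_iff]
        exact ha
      mul_mem' := fun {x y} hx hy => by
        have := hmul hx hy
        rwa [Algebra.TensorProduct.tmul_mul_tmul, one_mul] at this }
  have hpD : ∀ c : Λ, ∃ a : A, ((p : Λ) * c) ⊗ₜ[ℤ] 1 - 1 ⊗ₜ a ∈ I := fun c => by
    refine ⟨0, ?_⟩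
    rw [TensorProduct.tmul_zero, sub_zero, ← nsmul_eq_mul, ← TensorProduct.smul_tmul', nsmul_eq_mul]
    exact I.mul_mem_right _ hp
  have hD : ∀ x : Λ, x ∈ D := by
    intro x
    obtain ⟨y, hy, hxy⟩ : ∃ y ∈ D, Ideal.Quotient.mk (Ideal.span {(p : Λ)}) y =
        Ideal.Quotient.mk _ x := by
      have hx : Ideal.Quotient.mk _ x ∈ Algebra.adjoin ℤ s := by rw [hs]; trivial
      generalize Ideal.Quotient.mk (Ideal.span {(p : Λ)}) x = g at hx ⊢
      induction hx using Algebra.adjoin_induction with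
      | mem g hg =>
        obtain ⟨y, hy, h⟩ := hI g hg
        exact ⟨y, h, hy⟩
      | algebraMap n => exact ⟨n, intCast_mem D n, by simp⟩
      | add _ _ _ _ h₁ h₂ =>
        obtain ⟨y₁, hy₁, rfl⟩ := h₁
        obtain ⟨y₂, hy₂, rfl⟩ := h₂
        exact ⟨y₁ + y₂, D.add_mem hy₁ hy₂, map_add _ _ _⟩
      | mul _ _ _ _ h₁ h₂ =>
        obtain ⟨y₁, hy₁, rfl⟩ := h₁
        obtain ⟨y₂, hy₂, rfl⟩ := h₂
        exact ⟨y₁ * y₂, D.mul_mem hy₁ hy₂, map_mul _ _ _⟩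
    obtain ⟨c, hc⟩ := Ideal.mem_span_singleton.1 (Ideal.Quotient.eq.1 hxy.symm)
    rw [← sub_add_cancel x y, hc]
    exact D.add_mem (hpD c) hy
  induction z using TensorProduct.induction_on with
  | zero => exact ⟨0, by simp⟩
  | tmul x b =>
    have : x ⊗ₜ[ℤ] b = (x ⊗ₜ 1) * (1 ⊗ₜ b) := by
      rw [Algebra.TensorProduct.tmul_mul_tmul, one_mul, mul_one]
    rw [this]
    exact hmul (hD x) ⟨b, by simp⟩
  | add z₁ z₂ h₁ h₂ => exact hadd h₁ h₂

/-! ### Finite generation of `θ⁻¹(pV)`. -/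

section ThetaIdeal

variable (p : ℕ) [Fact p.Prime] (Λ : Type u) [CommRing Λ] (V : Type v) [CommRing V] [Algebra Λ V]
  [Fact (¬ IsUnit (p : V))] [IsAdicComplete (Ideal.span {(p : V)}) V]

theorem thetaTensor_tmul (x : Λ) (a : WittVector p (PreTilt V p)) :
    thetaTensor p Λ V (x ⊗ₜ a) = algebraMap Λ V x * WittVector.fontaineTheta V p a := by
  simp [thetaTensor, Algebra.ofId_apply]

/-- Generators are `p`, the Teichmüller lift `[y]`, and `g ⊗ 1 - 1 ⊗ a g` with `θ (a g) = g`, for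
lifts `g` of generators of `Λ / p`. The last ones reduce an element to some `1 ⊗ b`; then `θ b ∈ pV`
says that `y` divides the zeroth Witt component of `b`, so `b ∈ ([y], p)`. -/
theorem thetaIdeal_fg [hft : Algebra.FiniteType ℤ (Λ ⧸ Ideal.span {(p : Λ)})]
    (hF : Function.Surjective (frobenius (ModP V p) p))
    (hker : ∃ y : PreTilt V p, PreTilt.coeff 0 y = 0 ∧ ∀ x, PreTilt.coeff 0 x = 0 → y ∣ x) :
    (thetaIdeal p Λ V).FG := by
  classical
  obtain ⟨y, hy0, hy⟩ := hker
  obtain ⟨s, hs⟩ := hft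
  choose a ha using fun g : Λ => surjective_fontaineTheta hF (algebraMap Λ V g)
  choose l hl using Ideal.Quotient.mk_surjective (I := Ideal.span {(p : Λ)})
  let d : Λ → Λ ⊗[ℤ] WittVector p (PreTilt V p) := fun g => g ⊗ₜ 1 - 1 ⊗ₜ a g
  let G : Finset (Λ ⊗[ℤ] WittVector p (PreTilt V p)) :=
    {(p : Λ ⊗[ℤ] WittVector p (PreTilt V p)), 1 ⊗ₜ WittVector.teichmuller p y} ∪
      s.image fun g => d (l g)
  have hGp : (p : Λ ⊗[ℤ] WittVector p (PreTilt V p)) ∈ Ideal.span (G : Set _) :=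
    Ideal.subset_span (by simp [G])
  have hGy : 1 ⊗ₜ WittVector.teichmuller p y ∈ Ideal.span
      (G : Set (Λ ⊗[ℤ] WittVector p (PreTilt V p))) := Ideal.subset_span (by simp [G])
  have hGd : ∀ g ∈ s, d (l g) ∈ Ideal.span (G : Set (Λ ⊗[ℤ] WittVector p (PreTilt V p))) :=
    fun g hg => Ideal.subset_span (by
      refine Finset.mem_coe.2 (Finset.mem_union_right _ (Finset.mem_image_of_mem _ hg)))
  have hle : Ideal.span (G : Set (Λ ⊗[ℤ] WittVector p (PreTilt V p))) ≤ thetaIdeal p Λ V := by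
    rw [Ideal.span_le]
    intro z hz
    change thetaTensor p Λ V z ∈ Ideal.span {(p : V)}
    simp only [G, Finset.coe_union, Finset.coe_insert, Finset.coe_singleton, Finset.coe_image,
      Set.mem_union, Set.mem_insert_iff, Set.mem_singleton_iff, Set.mem_image] at hz
    rcases hz with (rfl | rfl) | ⟨g, -, rfl⟩
    · rw [map_natCast]; exact Ideal.mem_span_singleton_self _
    · rw [thetaTensor_tmul, map_one, one_mul, WittVector.fontaineTheta_teichmuller,
        ← Ideal.Quotient.eq_zero_iff_mem, PreTilt.mk_untilt_eq_coeff_zero]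
      exact hy0
    · simp only [d, map_sub, thetaTensor_tmul, map_one, one_mul, mul_one, ha, sub_self,
        Submodule.zero_mem]
  refine ⟨G, le_antisymm hle fun z hz => ?_⟩
  obtain ⟨b, hzb⟩ := exists_tmul_sub_mem hs _ hGp (fun g hg => ⟨l g, hl g, a (l g), hGd g hg⟩) z
  have hb2 : (1 : Λ) ⊗ₜ[ℤ] b ∈ thetaIdeal p Λ V := by
    have := (thetaIdeal p Λ V).sub_mem hz (hle hzb)
    rwa [sub_sub_cancel] at this
  have hb3 : PreTilt.coeff 0 (b.coeff 0) = 0 := by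
    have h1 : thetaTensor p Λ V (1 ⊗ₜ b) ∈ Ideal.span {(p : V)} := hb2
    rw [thetaTensor_tmul, map_one, one_mul, ← Ideal.Quotient.eq_zero_iff_mem,
      WittVector.mk_fontaineTheta] at h1
    exact h1
  obtain ⟨c, hc⟩ := hy _ hb3
  have h2 : b - WittVector.teichmuller p y * WittVector.teichmuller p c ∈
      Ideal.span {(p : WittVector p (PreTilt V p))} := by
    rw [WittVector.mem_span_p_iff_coeff_zero_eq_zero, ← WittVector.constantCoeff_apply, map_sub,
      map_mul]
    simp only [WittVector.constantCoeff_apply, WittVector.teichmuller_coeff_zero]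
    rw [hc, sub_self]
  obtain ⟨e, he⟩ := Ideal.mem_span_singleton.1 h2
  have h3 : z = (z - 1 ⊗ₜ b) + (1 ⊗ₜ WittVector.teichmuller p y) * (1 ⊗ₜ WittVector.teichmuller p c)
      + (p : Λ ⊗[ℤ] WittVector p (PreTilt V p)) * (1 ⊗ₜ e) := by
    have h4 : (p : Λ ⊗[ℤ] WittVector p (PreTilt V p)) * (1 ⊗ₜ e) = 1 ⊗ₜ (p * e) := by
      rw [← nsmul_eq_mul, ← nsmul_eq_mul, TensorProduct.tmul_smul]
    rw [h4, ← he, Algebra.TensorProduct.tmul_mul_tmul, one_mul, TensorProduct.tmul_sub]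
    abel
  rw [h3]
  exact Ideal.add_mem _ (Ideal.add_mem _ hzb (Ideal.mul_mem_right _ _ hGy))
    (Ideal.mul_mem_right _ _ hGp)

end ThetaIdeal

/-! ### Perfectoid properties of `Ô`. -/

section OHat

variable (p : ℕ) [Fact p.Prime]
variable (S : Type u) [NormedCommRing S] [NormOneClass S] [IsUltrametricDist S]
  [NormedAlgebra ℚ_[p] S]
variable (Sbar : Type v) [CommRing Sbar] [Algebra S Sbar] [IsMaximalEtaleExtension S Sbar]

theorem isUnit_natCast_of_algebra (p : ℕ) [Fact p.Prime] (S : Type u) [NormedCommRing S]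
    [NormedAlgebra ℚ_[p] S] (Sbar : Type v) [CommRing Sbar] [Algebra S Sbar] :
    IsUnit (p : Sbar) := by
  simpa using (natCast_isUnit_of_padic p (R := S)).map (algebraMap S Sbar)

/-- The reduction `O_Sbar → Ô / p`. -/
noncomputable def etaleIntegersModP : etaleIntegers S Sbar →+* ModP (OHat p S Sbar) p :=
  (Ideal.Quotient.mk (Ideal.span {(p : OHat p S Sbar)})).comp
    (algebraMap (etaleIntegers S Sbar) (OHat p S Sbar))

omit [NormedAlgebra ℚ_[p] S] [IsMaximalEtaleExtension S Sbar] in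
theorem etaleIntegersModP_surjective : Function.Surjective (etaleIntegersModP p S Sbar) := by
  intro x
  let e := AdicCompletion.quotientSpanNatCastEquiv (R := etaleIntegers S Sbar) p
  obtain ⟨y, hy⟩ := Ideal.Quotient.mk_surjective (e x)
  refine ⟨y, e.injective ?_⟩
  rw [← hy]
  exact AdicCompletion.quotientSpanNatCastEquiv_algebraMap ..

omit [NormedAlgebra ℚ_[p] S] [IsMaximalEtaleExtension S Sbar] in
theorem etaleIntegersModP_eq_zero_iff (x : etaleIntegers S Sbar) :
    etaleIntegersModP p S Sbar x = 0 ↔ (p : etaleIntegers S Sbar) ∣ x := by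
  let e := AdicCompletion.quotientSpanNatCastEquiv (R := etaleIntegers S Sbar) p
  rw [← Ideal.mem_span_singleton, ← Ideal.Quotient.eq_zero_iff_mem, ← e.map_eq_zero_iff]
  exact Iff.of_eq (congrArg (· = 0) (AdicCompletion.quotientSpanNatCastEquiv_algebraMap ..))

variable {p S} [IsReduced S] [CompleteSpace S]

theorem IsAffinoid.frobenius_surjective (hS : IsAffinoid p S) :
    Function.Surjective (frobenius (ModP (OHat p S Sbar) p) p) := by
  intro x
  obtain ⟨x, rfl⟩ := etaleIntegersModP_surjective p S Sbar x
  obtain ⟨t, b, rfl⟩ := exists_eq_pow_add_mul (isUnit_natCast_of_algebra p S Sbar)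
    (fun u hu => IsMaximalEtaleExtension.exists_pow_eq S (isUnit_natCast_of_algebra p S Sbar) hu)
    (fun m hm => hS.natCast_mem_of_isMaximal m) x
  refine ⟨etaleIntegersModP p S Sbar t, ?_⟩
  rw [map_add, (etaleIntegersModP_eq_zero_iff p S Sbar _).2 (dvd_mul_right _ b), add_zero,
    frobenius_def, map_pow]

theorem IsAffinoid.thetaIdeal_fg (hS : IsAffinoid p S) :
    (thetaIdeal p (spectralIntegers S) (OHat p S Sbar)).FG := by
  have := hS.finiteType_quotient
  refine _root_.thetaIdeal_fg p _ _ (hS.frobenius_surjective Sbar) ?_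
  exact exists_perfection_dvd (isUnit_natCast_of_algebra p S Sbar)
    (fun u hu => IsMaximalEtaleExtension.exists_pow_eq S (isUnit_natCast_of_algebra p S Sbar) hu)
    (etaleIntegersModP p S Sbar) (etaleIntegersModP_surjective p S Sbar)
    (etaleIntegersModP_eq_zero_iff p S Sbar)

end OHat

/-! ### Comparison of adic topologies and `p`-power congruences. -/

section AdicTopologies

variable {R : Type*} [CommRing R] {I J : Ideal R}

theorem IsAdicComplete.of_le_of_pow_le [h : IsAdicComplete I R] {c : ℕ} (hc : 0 < c) (hIJ : I ≤ J)
    (hJI : J ^ c ≤ I) : IsAdicComplete J R := by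
  have h1 : ∀ n, I ^ n ≤ J ^ n := fun n => Ideal.pow_right_mono hIJ n
  have h2 : ∀ n, J ^ (c * n) ≤ I ^ n := fun n => by
    rw [pow_mul]; exact Ideal.pow_right_mono hJI n
  have h3 : ∀ n, n ≤ c * n := fun n => Nat.le_mul_of_pos_left n hc
  refine { haus' := fun x hx => IsHausdorff.haus h.toIsHausdorff x fun n => ?_
           prec' := fun f hf => ?_ }
  · have := hx (c * n)
    rw [SModEq.zero, smul_eq_mul, Ideal.mul_top] at this ⊢
    exact h2 n this
  · obtain ⟨L, hL⟩ := h.toIsPrecomplete.prec (f := fun n => f (c * n)) fun {m n} hmn => by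
      have := hf (Nat.mul_le_mul_left c hmn)
      rw [SModEq.sub_mem, smul_eq_mul, Ideal.mul_top] at this ⊢
      exact h2 m this
    refine ⟨L, fun n => ?_⟩
    have h4 := hf (h3 n)
    have h5 := hL n
    rw [SModEq.sub_mem, smul_eq_mul, Ideal.mul_top] at h4 h5 ⊢
    rw [← sub_add_sub_cancel _ (f (c * n))]
    exact Ideal.add_mem _ h4 (h1 n h5)

/-- In the binomial expansion of `(b + (a - b)) ^ p`, each term other than `b ^ p` either carries a
factor `p (a - b)` or is `(a - b) ^ p`; both gain a power of `I`. -/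
theorem Ideal.pow_prime_sub_pow_prime_mem {p : ℕ} [hp : Fact p.Prime] (hpI : (p : R) ∈ I) {a b : R}
    {j : ℕ} (h : a - b ∈ I ^ (j + 1)) : a ^ p - b ^ p ∈ I ^ (j + 2) := by
  obtain ⟨r, hr⟩ := exists_add_pow_prime_eq hp.out b (a - b)
  rw [add_sub_cancel] at hr
  have h1 : a ^ p - b ^ p = (a - b) ^ p + (a - b) * p * (b * r) := by rw [hr]; ring
  rw [h1]
  refine add_mem ?_ (mul_mem_right _ _ ?_)
  · have h2 := Ideal.pow_mem_pow h p
    rw [← pow_mul] at h2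
    refine Ideal.pow_le_pow_right ?_ h2
    nlinarith [hp.out.two_le, Nat.mul_le_mul_left (j + 1) hp.out.two_le]
  · rw [pow_succ I (j + 1)]
    exact Ideal.mul_mem_mul h hpI

theorem Ideal.pow_pow_sub_pow_pow_mem {p : ℕ} [hp : Fact p.Prime] (hpI : (p : R) ∈ I) {a b : R}
    (h : a - b ∈ I) (j : ℕ) : a ^ p ^ j - b ^ p ^ j ∈ I ^ (j + 1) := by
  induction j with
  | zero => simpa using h
  | succ j ih =>
    rw [_root_.pow_succ p j, pow_mul, pow_mul]
    exact pow_prime_sub_pow_prime_mem hpI ih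

theorem Ideal.eq_of_forall_sub_mem_pow [IsHausdorff I R] {a b : R}
    (h : ∀ n, a - b ∈ I ^ n) : a = b := by
  refine (IsHausdorff.eq_iff_smodEq (I := I)).2 fun n => ?_
  rw [SModEq.sub_mem, smul_eq_mul, Ideal.mul_top]
  exact h n

end AdicTopologies

/-! ### Rigidity of maps out of Witt vectors. -/

section WittVector

variable {p : ℕ} [Fact p.Prime] {k : Type u} [CommRing k] [CharP k p] [PerfectRing k p]
  {E : Type w} [CommRing E]

/-- Homomorphisms from the Witt vectors of a perfect ring are determined modulo `p`. -/
theorem WittVector.ringHom_ext_of_sub_mem (I : Ideal E) [IsHausdorff I E] (hp : (p : E) ∈ I)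
    {f g : WittVector p k →+* E} (h : ∀ a, f a - g a ∈ I) : f = g := by
  have h1 : ∀ x, f (teichmuller p x) = g (teichmuller p x) := fun x =>
    Ideal.eq_of_forall_sub_mem_pow (I := I) fun n => by
      -- Write `x` as a `p ^ n`-th power: a congruence modulo `I` at `[y]` becomes one modulo `I ^
      -- (n + 1)` at `[x]`.
      let y := ((_root_.frobeniusEquiv k p).symm^[n]) x
      have hy : y ^ p ^ n = x := by simp [y]
      rw [← hy, map_pow, map_pow, map_pow]
      exact Ideal.pow_le_pow_right n.le_succ (Ideal.pow_pow_sub_pow_pow_mem hp (h _) n)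
  refine RingHom.ext fun a => Ideal.eq_of_forall_sub_mem_pow (I := I) fun n => ?_
  rw [← Ideal.Quotient.eq]
  refine RingHom.congr_fun (eq_of_apply_teichmuller_eq ((Ideal.Quotient.mk (I ^ n)).comp f)
    ((Ideal.Quotient.mk (I ^ n)).comp g) ⟨n, ?_⟩ fun x => ?_) a
  · rw [← map_natCast (Ideal.Quotient.mk (I ^ n)), ← map_pow, Ideal.Quotient.eq_zero_iff_mem]
    exact Ideal.pow_mem_pow hp n
  · exact congrArg _ (h1 x)

end WittVector

/-! ### Lifting `θ` to `p`-adically complete nilpotent thickenings. -/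

section Thickening

variable (p : ℕ) [Fact p.Prime] (Λ : Type u) [CommRing Λ] (V : Type v) [CommRing V] [Algebra Λ V]
  [Fact (¬ IsUnit (p : V))] [IsAdicComplete (Ideal.span {(p : V)}) V]
  {D : Type w} [CommRing D] [Algebra Λ D] [Fact (¬ IsUnit (p : D))]
  [IsAdicComplete (Ideal.span {(p : D)}) D]
  (q : D →ₐ[Λ] V) {k : ℕ}

variable {Λ V} in
theorem exists_mem_ker_add_mul (hq : Function.Surjective q) {d : D}
    (hd : q d ∈ Ideal.span {(p : V)}) : ∃ e ∈ RingHom.ker q, ∃ c, d = e + p * c := by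
  obtain ⟨v, hv⟩ := Ideal.mem_span_singleton.1 hd
  obtain ⟨c, rfl⟩ := hq v
  refine ⟨d - p * c, ?_, c, by ring⟩
  rw [RingHom.mem_ker, map_sub, map_mul, map_natCast, hv, sub_self]

variable {Λ V} in
-- The preimage of `(p)` is `ker q + (p)`, and `ker q ^ (k + 1) = 0`. So this ideal and `(p)` define
-- the same topology on `D`.
theorem comap_pow_le (hq : Function.Surjective q) (hnil : RingHom.ker q ^ (k + 1) = ⊥) :
    ((Ideal.span {(p : V)}).comap q) ^ (k + 2) ≤ Ideal.span {(p : D)} := by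
  have h1 : (Ideal.span {(p : V)}).comap q ≤ RingHom.ker q ⊔ Ideal.span {(p : D)} := by
    intro d hd
    obtain ⟨e, he, c, rfl⟩ := exists_mem_ker_add_mul p q hq hd
    exact Submodule.add_mem_sup he (Ideal.mul_mem_right _ _ (Ideal.mem_span_singleton_self _))
  refine (Ideal.pow_right_mono h1 _).trans ?_
  have h2 := Ideal.sup_pow_add_le_pow_sup_pow (I := RingHom.ker q) (J := Ideal.span {(p : D)})
    (n := k + 1) (m := 1)
  rwa [hnil, bot_sup_eq, pow_one] at h2

variable {Λ V} in
theorem isAdicComplete_comap (hq : Function.Surjective q) (hnil : RingHom.ker q ^ (k + 1) = ⊥) :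
    IsAdicComplete ((Ideal.span {(p : V)}).comap q) D := by
  refine IsAdicComplete.of_le_of_pow_le (I := Ideal.span {(p : D)}) (k + 1).succ_pos ?_
    (comap_pow_le p q hq hnil)
  rw [Ideal.span_le, Set.singleton_subset_iff]
  change q p ∈ Ideal.span {(p : V)}
  rw [map_natCast]
  exact Ideal.mem_span_singleton_self _

variable {Λ V} in
/-- The reduction of `q` modulo `p`. -/
noncomputable def modPMap : ModP D p →+* ModP V p :=
  Ideal.quotientMap (Ideal.span {(p : V)}) (q : D →+* V) (by
    rw [Ideal.span_le, Set.singleton_subset_iff]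
    change q p ∈ Ideal.span {(p : V)}
    rw [map_natCast]
    exact Ideal.mem_span_singleton_self _)

omit [Fact (Nat.Prime p)] [Fact (¬ IsUnit (p : V))] [IsAdicComplete (Ideal.span {(p : V)}) V]
  [Fact (¬ IsUnit (p : D))] [IsAdicComplete (Ideal.span {(p : D)}) D] in
variable {Λ V} in
theorem modPMap_mk (d : D) : modPMap p q (Ideal.Quotient.mk _ d) = Ideal.Quotient.mk _ (q d) := rfl

/-- The tilt of a nilpotent thickening has a section. -/
theorem exists_preTilt_section (hq : Function.Surjective q)
    (hnil : RingHom.ker q ^ (k + 1) = ⊥) : ∃ s : PreTilt V p →+* PreTilt D p,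
      ∀ x n, modPMap p q (PreTilt.coeff n (s x)) = PreTilt.coeff n x := by
  have hπ : Function.Surjective (modPMap p q) := Ideal.quotientMap_surjective hq
  let F : ModP D p →+* ModP D p := iterateFrobenius (ModP D p) p (k + 2)
  -- A lift of a kernel element lies in `q⁻¹(pV)`, whose `(k + 2)`-th power is in `(p)`, and `k + 2
  -- ≤ p ^ (k + 2)`.
  have hF : RingHom.ker (modPMap p q) ≤ RingHom.ker F := by
    intro x hx
    obtain ⟨d, rfl⟩ := Ideal.Quotient.mk_surjective x
    rw [RingHom.mem_ker, modPMap_mk, Ideal.Quotient.eq_zero_iff_mem] at hx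
    rw [RingHom.mem_ker]
    change iterateFrobenius (ModP D p) p (k + 2) _ = 0
    rw [iterateFrobenius_def, ← map_pow, Ideal.Quotient.eq_zero_iff_mem]
    refine comap_pow_le p q hq hnil ?_
    exact Ideal.pow_le_pow_right (Nat.lt_pow_self (Fact.out : p.Prime).one_lt).le
      (Ideal.pow_mem_pow (I := (Ideal.span {(p : V)}).comap q) hx _)
  let ψ : ModP V p →+* ModP D p := (modPMap p q).liftOfSurjective hπ ⟨F, hF⟩
  have hψ : ∀ x, ψ (modPMap p q x) = x ^ p ^ (k + 2) := fun x => by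
    rw [RingHom.liftOfRightInverse_comp_apply]
    exact iterateFrobenius_def ..
  have hψ2 : ∀ x, modPMap p q (ψ x) = x ^ p ^ (k + 2) := fun x => by
    obtain ⟨y, rfl⟩ := hπ x
    rw [hψ, map_pow]
  let φ : PreTilt V p →+* PreTilt D p := Perfection.map p ψ
  have hφ : ∀ x n, PreTilt.coeff n (φ x) = ψ (PreTilt.coeff n x) := fun x n =>
    Perfection.coeff_map p ψ x n
  -- The map `φ` lifts the `(k + 2)`-fold Frobenius rather than the identity, which is corrected by
  -- the inverse Frobenius of the perfect ring `V♭`.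
  refine ⟨φ.comp ((iterateFrobeniusEquiv (PreTilt V p) p (k + 2)).symm : PreTilt V p →+* _),
    fun x n => ?_⟩
  rw [RingHom.comp_apply, hφ, hψ2, ← map_pow]
  congr 1
  have := (iterateFrobeniusEquiv (PreTilt V p) p (k + 2)).apply_symm_apply x
  rwa [iterateFrobeniusEquiv_def] at this

/-- Compose Fontaine's map for `D` with the Witt vectors of the section of tilts. After applying `q`
it agrees with Fontaine's map for `V` modulo `p`, hence exactly by rigidity. -/
theorem exists_fontaineTheta_lift (hq : Function.Surjective q)
    (hnil : RingHom.ker q ^ (k + 1) = ⊥) : ∃ g : WittVector p (PreTilt V p) →+* D,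
      (q : D →+* V).comp g = WittVector.fontaineTheta V p := by
  obtain ⟨s, hs⟩ := exists_preTilt_section p Λ V q hq hnil
  refine ⟨(WittVector.fontaineTheta D p).comp (WittVector.map s), ?_⟩
  refine WittVector.ringHom_ext_of_sub_mem (Ideal.span {(p : V)})
    (Ideal.mem_span_singleton_self _) fun a => ?_
  rw [← Ideal.Quotient.eq, WittVector.mk_fontaineTheta]
  change modPMap p q (Ideal.Quotient.mk _ (WittVector.fontaineTheta D p (WittVector.map s a))) = _
  rw [WittVector.mk_fontaineTheta, WittVector.map_coeff, hs]

theorem thetaOAinf_algebraMap (x : Λ ⊗[ℤ] WittVector p (PreTilt V p)) :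
    thetaOAinf p Λ V (algebraMap _ _ x) = thetaTensor p Λ V x :=
  adicExtend_algebraMap _ _ _ _ x

/-- Nilpotent thickenings of `V` receive a map from `OA_inf`. -/
theorem exists_OAinf_lift (hq : Function.Surjective q) (hnil : RingHom.ker q ^ (k + 1) = ⊥) :
    ∃ f : OAinf p Λ V →ₐ[Λ] D, q.comp f = thetaOAinf p Λ V := by
  obtain ⟨g, hg⟩ := exists_fontaineTheta_lift p Λ V q hq hnil
  let f₀ : Λ ⊗[ℤ] WittVector p (PreTilt V p) →ₐ[Λ] D :=
    Algebra.TensorProduct.lift (Algebra.ofId Λ D) g.toIntAlgHom (fun _ _ => Commute.all _ _)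
  have hf₀ : ∀ z, q (f₀ z) = thetaTensor p Λ V z := by
    have : q.comp f₀ = thetaTensor p Λ V := by
      refine Algebra.TensorProduct.ext (by ext) ?_
      ext a
      have := RingHom.congr_fun hg a
      simpa [f₀, thetaTensor] using this
    exact fun z => DFunLike.congr_fun this z
  have := isAdicComplete_comap p q hq hnil
  have hle : thetaIdeal p Λ V ≤ ((Ideal.span {(p : V)}).comap q).comap f₀ := fun z hz => by
    change q (f₀ z) ∈ Ideal.span {(p : V)}
    rw [hf₀]; exact hz
  refine ⟨adicExtend f₀ _ _ hle, AlgHom.ext fun x => ?_⟩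
  induction x using AdicCompletion.induction_on with
  | _ x =>
  refine Ideal.eq_of_forall_sub_mem_pow (I := Ideal.span {(p : V)}) fun n => ?_
  have h1 := Ideal.Quotient.eq.1 (mk_adicExtend f₀ _ _ hle n x)
  have h2 := Ideal.Quotient.eq.1 (mk_adicExtend (thetaTensor p Λ V) (thetaIdeal p Λ V)
    (Ideal.span {(p : V)}) le_rfl n x)
  have h3 := Ideal.le_comap_pow (q : D →+* V) n h1
  rw [Ideal.mem_comap] at h3
  have h4 := Ideal.sub_mem _ h3 h2
  rw [RingHom.coe_coe, map_sub, hf₀] at h4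
  rw [show thetaOAinf p Λ V = adicExtend (thetaTensor p Λ V) (thetaIdeal p Λ V)
    (Ideal.span {(p : V)}) le_rfl from rfl, AlgHom.comp_apply]
  convert h4 using 1
  abel

/-- The map from `OA_inf` to a nilpotent thickening is unique. -/
theorem OAinf_lift_unique (hfg : (thetaIdeal p Λ V).FG) (hq : Function.Surjective q)
    (hnil : RingHom.ker q ^ (k + 1) = ⊥) {f g : OAinf p Λ V →ₐ[Λ] D}
    (hf : q.comp f = thetaOAinf p Λ V) (hg : q.comp g = thetaOAinf p Λ V) : f = g := by
  have hK := isAdicComplete_comap p q hq hnil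
  set K := (Ideal.span {(p : V)}).comap q
  have hpK : (p : D) ∈ K := by
    change q p ∈ Ideal.span {(p : V)}
    rw [map_natCast]
    exact Ideal.mem_span_singleton_self _
  have hqf : ∀ x, q (f x) = thetaOAinf p Λ V x := fun x => DFunLike.congr_fun hf x
  have hqg : ∀ x, q (g x) = thetaOAinf p Λ V x := fun x => DFunLike.congr_fun hg x
  let ι : Λ ⊗[ℤ] WittVector p (PreTilt V p) →ₐ[Λ] OAinf p Λ V := IsScalarTower.toAlgHom _ _ _
  have hfgP : f.comp ι = g.comp ι := by
    -- On `Λ` both maps are the structure map; on Witt vectors they agree modulo `K`, as both lift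
    -- `θ`, so rigidity applies.
    refine Algebra.TensorProduct.ext (by ext) ?_
    let j : WittVector p (PreTilt V p) →+* Λ ⊗[ℤ] WittVector p (PreTilt V p) :=
      Algebra.TensorProduct.includeRight.toRingHom
    have h1 : (f.comp ι).toRingHom.comp j = (g.comp ι).toRingHom.comp j := by
      refine WittVector.ringHom_ext_of_sub_mem K hpK fun a => ?_
      change q (f (ι (j a)) - g (ι (j a))) ∈ Ideal.span {(p : V)}
      rw [map_sub, hqf, hqg, sub_self]
      exact Submodule.zero_mem _
    ext a
    exact RingHom.congr_fun h1 a
  have hι : ∀ z ∈ thetaIdeal p Λ V, f (ι z) ∈ K ∧ g (ι z) ∈ K := fun z hz => by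
    have h1 : thetaOAinf p Λ V (ι z) ∈ Ideal.span {(p : V)} := by
      change thetaOAinf p Λ V (algebraMap _ _ z) ∈ _
      rw [thetaOAinf_algebraMap]; exact hz
    constructor
    · change q (f (ι z)) ∈ Ideal.span {(p : V)}
      rwa [hqf]
    · change q (g (ι z)) ∈ Ideal.span {(p : V)}
      rwa [hqg]
  have hpow : ∀ (h : OAinf p Λ V →ₐ[Λ] D), (∀ z ∈ thetaIdeal p Λ V, h (ι z) ∈ K) → ∀ n,
      ∀ x ∈ ((thetaIdeal p Λ V) ^ n • ⊤ : Submodule (Λ ⊗[ℤ] WittVector p (PreTilt V p))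
        (OAinf p Λ V)), h x ∈ K ^ n := by
    intro h hh n x hx
    have hle : thetaIdeal p Λ V ≤ K.comap (h.comp ι) := fun z hz => hh z hz
    induction hx using Submodule.smul_induction_on' with
    | smul z hz y _ =>
      have : z • y = ι z * y := Algebra.smul_def z y
      rw [this, map_mul]
      exact Ideal.mul_mem_right _ _ (pow_le_comap_pow (h.comp ι) _ K hle n hz)
    | add x _ y _ hx hy => rw [map_add]; exact Ideal.add_mem _ hx hy
  refine AlgHom.ext fun x => Ideal.eq_of_forall_sub_mem_pow (I := K) fun n => ?_
  obtain ⟨z, hz⟩ := Submodule.mkQ_surjective _ (AdicCompletion.eval (thetaIdeal p Λ V) _ n x)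
  -- Finite generation of `θ⁻¹(pV)` enters here: it identifies the kernel of the `n`-th projection
  -- of the completion with the multiples of `θ⁻¹(pV) ^ n`, which both maps send into `K ^ n`. No
  -- continuity assumption is needed.
  have hx : x - ι z ∈ ((thetaIdeal p Λ V) ^ n • ⊤ : Submodule
      (Λ ⊗[ℤ] WittVector p (PreTilt V p)) (OAinf p Λ V)) := by
    rw [AdicCompletion.pow_smul_top_eq_ker_eval hfg, LinearMap.mem_ker, map_sub, ← hz, sub_eq_zero]
    exact (AdicCompletion.eval_of _ _ n z).symm
  have h1 := hpow f (fun z hz => (hι z hz).1) n _ hx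
  have h2 := hpow g (fun z hz => (hι z hz).2) n _ hx
  have h3 : f (ι z) = g (ι z) := DFunLike.congr_fun hfgP z
  have h4 := Ideal.sub_mem _ h1 h2
  rw [map_sub, map_sub, h3, sub_sub_sub_cancel_right] at h4
  exact h4

end Thickening

/-! ### Bounded subrings generated modulo a nilpotent ideal. -/

section BoundedSubmodules

variable {B : Type w} [NormedCommRing B] [IsUltrametricDist B]

/-- Boundedness of an additive subgroup of a normed ring. -/
def IsBoundedSubmodule (N : Submodule ℤ B) : Prop := ∃ C : ℝ, ∀ x ∈ N, ‖x‖ ≤ C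

theorem IsBoundedSubmodule.sup {M N : Submodule ℤ B} (hM : IsBoundedSubmodule M)
    (hN : IsBoundedSubmodule N) : IsBoundedSubmodule (M ⊔ N) := by
  obtain ⟨C, hC⟩ := hM
  obtain ⟨C', hC'⟩ := hN
  refine ⟨max C C', fun x hx => ?_⟩
  obtain ⟨y, hy, z, hz, rfl⟩ := Submodule.mem_sup.1 hx
  exact (IsUltrametricDist.norm_add_le_max y z).trans (max_le_max (hC y hy) (hC' z hz))

theorem IsBoundedSubmodule.mul {M N : Submodule ℤ B} (hM : IsBoundedSubmodule M)
    (hN : IsBoundedSubmodule N) : IsBoundedSubmodule (M * N) := by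
  obtain ⟨C, hC⟩ := hM
  obtain ⟨C', hC'⟩ := hN
  refine ⟨C * C', fun x hx => ?_⟩
  induction hx using Submodule.mul_induction_on' with
  | mem_mul_mem m hm n hn =>
    have := (norm_nonneg m).trans (hC m hm)
    exact (norm_mul_le m n).trans (mul_le_mul (hC m hm) (hC' n hn) (norm_nonneg _) this)
  | add x _ y _ hx hy => exact (IsUltrametricDist.norm_add_le_max x y).trans (max_le hx hy)

theorem isBoundedSubmodule_one : IsBoundedSubmodule (1 : Submodule ℤ B) := by
  refine ⟨‖(1 : B)‖, fun x hx => ?_⟩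
  obtain ⟨n, rfl⟩ := Submodule.mem_one.1 hx
  clear hx
  rw [eq_intCast, ← zsmul_one]
  induction n using Int.induction_on with
  | zero => simp
  | succ i hi =>
    rw [add_smul, one_smul]
    exact (IsUltrametricDist.norm_add_le_max _ _).trans (max_le hi le_rfl)
  | pred i hi =>
    rw [sub_smul, one_smul, sub_eq_add_neg]
    exact (IsUltrametricDist.norm_add_le_max _ _).trans (max_le hi (norm_neg _).le)

theorem IsBoundedSubmodule.pow {M : Submodule ℤ B} (hM : IsBoundedSubmodule M) (n : ℕ) :
    IsBoundedSubmodule (M ^ n) := by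
  induction n with
  | zero => rw [pow_zero]; exact isBoundedSubmodule_one
  | succ n ih => rw [pow_succ]; exact ih.mul hM

theorem IsBoundedSubmodule.mono {M N : Submodule ℤ B} (hN : IsBoundedSubmodule N) (h : M ≤ N) :
    IsBoundedSubmodule M := by
  obtain ⟨C, hC⟩ := hN
  exact ⟨C, fun x hx => hC x (h hx)⟩

omit [IsUltrametricDist B] in
-- Once `I ^ (k + 1) = 0`, this makes the powers of `1 ⊔ I` stop growing at exponent `k`, so the
-- subring generated by `I` stays bounded.
theorem Submodule.one_sup_pow_succ_le (I : Submodule ℤ B) (k : ℕ) :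
    (1 ⊔ I) ^ (k + 1) ≤ (1 ⊔ I) ^ k ⊔ I ^ (k + 1) := by
  induction k with
  | zero => simp
  | succ k ih =>
    rw [pow_succ' (1 ⊔ I) (k + 1), Submodule.sup_mul, one_mul]
    refine sup_le le_sup_left ?_
    calc I * (1 ⊔ I) ^ (k + 1) ≤ I * ((1 ⊔ I) ^ k ⊔ I ^ (k + 1)) := mul_le_mul' le_rfl ih
      _ = I * (1 ⊔ I) ^ k ⊔ I ^ (k + 2) := by rw [Submodule.mul_sup, ← pow_succ']
      _ ≤ _ := sup_le_sup_right (by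
        rw [pow_succ']
        exact mul_le_mul' le_sup_right le_rfl) _

/-- A bounded additive subgroup that lifts a subring modulo a nilpotent ideal is contained in a
bounded subring. -/
theorem exists_bounded_subring {C : Type*} [CommRing C] (θ : B →+* C) {k : ℕ}
    (hnil : RingHom.ker θ ^ (k + 1) = ⊥) (V₀ : Subring C) (M : Submodule ℤ B)
    (hM : IsBoundedSubmodule M) (h1 : 1 ∈ M) (hle : ∀ m ∈ M, θ m ∈ V₀)
    (hsurj : ∀ v ∈ V₀, ∃ m ∈ M, θ m = v) :
    ∃ D : Subring B, (∀ m ∈ M, m ∈ D) ∧ (∃ c : ℝ, ∀ d ∈ D, ‖d‖ ≤ c) ∧ ∀ d ∈ D, θ d ∈ V₀ := by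
  -- `I` contains the defects `x * y - z`, where `z ∈ M` has the same image as `x * y`. It is
  -- bounded, and nilpotent because it lies in `ker θ`.
  let I : Submodule ℤ B := (M * M ⊔ M) ⊓ (RingHom.ker θ).restrictScalars ℤ
  have hI : ∀ x ∈ I, θ x = 0 := fun x hx => hx.2
  have hIb : IsBoundedSubmodule I := ((hM.mul hM).sup hM).mono inf_le_left
  have hIpow : I ^ (k + 1) = ⊥ := by
    have h2 : ∀ n, I ^ n ≤ (RingHom.ker θ ^ n).restrictScalars ℤ := by
      intro n
      induction n with
      | zero => intro x _; simp
      | succ n ih =>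
        rw [pow_succ, Submodule.mul_le]
        intro x hx y hy
        rw [Submodule.restrictScalars_mem, pow_succ]
        exact Ideal.mul_mem_mul (ih hx) (hI y hy)
    refine eq_bot_iff.2 fun x hx => ?_
    have := h2 _ hx
    rwa [hnil] at this
  let T : Submodule ℤ B := 1 ⊔ I
  have hT : T ^ (k + 1) ≤ T ^ k := by
    refine (Submodule.one_sup_pow_succ_le I k).trans ?_
    rw [hIpow, sup_bot_eq]
  have hTn : ∀ n, T ^ k * T ^ n ≤ T ^ k := by
    intro n
    induction n with
    | zero => rw [pow_zero, mul_one]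
    | succ n ih =>
      rw [pow_succ, ← mul_assoc]
      refine (mul_le_mul' ih le_rfl).trans ?_
      rwa [← pow_succ]
  have hIT : I * T ^ k ≤ T ^ k := by
    refine le_trans ?_ hT
    rw [pow_succ']
    exact mul_le_mul' le_sup_right le_rfl
  have hone : ∀ n, (1 : Submodule ℤ B) ≤ T ^ n := by
    intro n
    induction n with
    | zero => rw [pow_zero]
    | succ n ih =>
      rw [pow_succ]
      calc (1 : Submodule ℤ B) = 1 * 1 := (one_mul 1).symm
        _ ≤ _ := mul_le_mul' ih le_sup_left
  have h1M : (1 : Submodule ℤ B) ≤ M := Submodule.one_le.2 h1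
  have hMM : M * M ≤ M ⊔ I := by
    rw [Submodule.mul_le]
    intro x hx y hy
    obtain ⟨z, hz, hzxy⟩ := hsurj (θ (x * y)) (by
      rw [map_mul]; exact V₀.mul_mem (hle x hx) (hle y hy))
    refine Submodule.mem_sup.2 ⟨z, hz, x * y - z, ⟨?_, ?_⟩, add_sub_cancel _ _⟩
    · exact Submodule.sub_mem _ (Submodule.mem_sup_left (Submodule.mul_mem_mul hx hy))
        (Submodule.mem_sup_right hz)
    · change θ (x * y - z) = 0
      rw [map_sub, hzxy, sub_self]
  -- Closed under products: `M * M ≤ M ⊔ I`, while `T ^ k` absorbs `T ^ k` and `I`.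
  let E : Submodule ℤ B := M * T ^ k
  have hTE : T ^ k ≤ E := by
    calc T ^ k = 1 * T ^ k := (one_mul _).symm
      _ ≤ _ := mul_le_mul' h1M le_rfl
  have hME : M ≤ E := by
    calc M = M * 1 := (mul_one _).symm
      _ ≤ _ := mul_le_mul' le_rfl (hone k)
  have hEE : E * E ≤ E := by
    calc E * E = (M * M) * (T ^ k * T ^ k) := mul_mul_mul_comm _ _ _ _
      _ ≤ (M ⊔ I) * T ^ k := mul_le_mul' hMM (hTn k)
      _ = M * T ^ k ⊔ I * T ^ k := Submodule.sup_mul _ _ _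
      _ ≤ E := sup_le le_rfl (hIT.trans hTE)
  let N : Submodule ℤ B := AddSubgroup.toIntSubmodule (V₀.comap θ).toAddSubgroup
  have hN : ∀ x, x ∈ N ↔ θ x ∈ V₀ := fun x => Iff.rfl
  have hTN : ∀ n, T ^ n ≤ N := by
    have h2 : (1 : Submodule ℤ B) ≤ N := Submodule.one_le.2 (by
      rw [hN, map_one]; exact V₀.one_mem)
    intro n
    induction n with
    | zero => rwa [pow_zero]
    | succ n ih =>
      rw [pow_succ, Submodule.mul_le]
      intro x hx y hy
      have h3 : y ∈ N := sup_le h2 (fun z hz => by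
        rw [hN, hI z hz]; exact V₀.zero_mem) hy
      rw [hN, map_mul]
      exact V₀.mul_mem (ih hx) h3
  have hEN : E ≤ N := by
    rw [Submodule.mul_le]
    intro x hx y hy
    rw [hN, map_mul]
    exact V₀.mul_mem (hle x hx) (hTN k hy)
  let D : Subring B :=
    { carrier := E
      zero_mem' := E.zero_mem
      one_mem' := hME h1
      add_mem' := E.add_mem
      neg_mem' := E.neg_mem
      mul_mem' := fun hx hy => hEE (Submodule.mul_mem_mul hx hy) }
  refine ⟨D, fun m hm => hME hm, ?_, fun d hd => hEN hd⟩
  exact hM.mul ((isBoundedSubmodule_one.sup hIb).pow k)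

end BoundedSubmodules

/-! ### Rings of definition of Banach thickenings. -/

section BoundedThickening

variable {p : ℕ} [Fact p.Prime] {B : Type w} [NormedCommRing B] [IsUltrametricDist B]
  [NormedAlgebra ℚ_[p] B] [CompleteSpace B]

/-- A bounded open subgroup is `p`-adically complete. -/
theorem isSeriesComplete_of_bounded {M : AddSubgroup B} {C : ℝ} (hC : ∀ x ∈ M, ‖x‖ ≤ C) {c : ℕ}
    (hc : ∀ x ∈ unitBall B, p ^ c • x ∈ M) : IsSeriesComplete p M := by
  intro u hu
  obtain ⟨e, he⟩ : ∃ e : ℕ, C ≤ (p : ℝ) ^ e := by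
    obtain ⟨e, he⟩ := pow_unbounded_of_one_lt C
      (show (1 : ℝ) < p by exact_mod_cast (Fact.out : p.Prime).one_lt)
    exact ⟨e, he.le⟩
  have hp : (0 : ℝ) < p := by exact_mod_cast (Fact.out : p.Prime).pos
  obtain ⟨s, -, hs⟩ := isSeriesComplete_unitBall p (E := B) (fun n => p ^ e • u n) fun n => by
    rw [mem_unitBall, norm_pow_nsmul, inv_pow, inv_mul_le_iff₀ (by positivity), mul_one]
    exact (hC _ (hu n)).trans he
  have hp0 : (p : ℚ_[p]) ^ e ≠ 0 :=
    pow_ne_zero _ (Nat.cast_ne_zero.2 (Fact.out : p.Prime).ne_zero)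
  have hinv : ∀ x : B, p ^ e • ((p : ℚ_[p]) ^ e)⁻¹ • x = x := fun x => by
    rw [← Nat.cast_smul_eq_nsmul ℚ_[p] (p ^ e), Nat.cast_pow, smul_inv_smul₀ hp0]
  have htf : ∀ n : ℕ, ∀ x y : B, p ^ n • x = p ^ n • y → x = y := fun n x y h => by
    have hp0 : (p : ℚ_[p]) ^ n ≠ 0 :=
      pow_ne_zero _ (Nat.cast_ne_zero.2 (Fact.out : p.Prime).ne_zero)
    rw [← Nat.cast_smul_eq_nsmul ℚ_[p], ← Nat.cast_smul_eq_nsmul ℚ_[p], Nat.cast_pow] at h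
    exact smul_right_injective B hp0 h
  choose m hm hsm using hs
  let s' : B := ((p : ℚ_[p]) ^ e)⁻¹ • s
  have hs' : ∀ n, s' = ∑ i ∈ Finset.range n, p ^ i • u i + p ^ n • ((p : ℚ_[p]) ^ e)⁻¹ • m n := by
    intro n
    apply htf e
    rw [hinv, hsm n, smul_add, Finset.smul_sum, smul_comm (p ^ e) (p ^ n), hinv]
    congr 1
    exact Finset.sum_congr rfl fun i _ => smul_comm _ _ _
  -- Expand the remainder by `e + c` further terms, all in `M`; the new remainder carries `p ^ (e +
  -- c)`, of which `p ^ e` cancels the denominator and `p ^ c` moves the unit ball into `M`.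
  have hmem : ∀ n, ((p : ℚ_[p]) ^ e)⁻¹ • m n ∈ M := by
    intro n
    have h1 := hs' (n + (e + c))
    rw [hs' n, Finset.sum_range_add, add_assoc, add_left_cancel_iff] at h1
    have h2 : ((p : ℚ_[p]) ^ e)⁻¹ • m n = ∑ i ∈ Finset.range (e + c), p ^ i • u (n + i) +
        p ^ (e + c) • ((p : ℚ_[p]) ^ e)⁻¹ • m (n + (e + c)) := by
      apply htf n
      rw [h1, smul_add, Finset.smul_sum, ← mul_smul, ← pow_add]
      congr 1
      exact Finset.sum_congr rfl fun i _ => by rw [← mul_smul, ← pow_add]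
    rw [h2]
    refine M.add_mem (M.sum_mem fun i _ => M.nsmul_mem (hu _) _) ?_
    rw [add_comm e c, pow_add, mul_smul, hinv]
    exact hc _ (hm _)
  refine ⟨s', ?_, fun n => ⟨_, hmem n, hs' n⟩⟩
  have := hs' 0
  rw [Finset.sum_range_zero, zero_add, pow_zero, one_smul] at this
  rw [this]
  exact hmem 0

variable {C : Type*} [CommRing C] {V : Type*} [CommRing V] [IsAdicComplete (Ideal.span {(p : V)}) V]

/-- A ring of definition of a nilpotent thickening. -/
theorem exists_subring_of_thickening (hpC : IsUnit (p : C)) {ι : V →+* C}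
    (hι : Function.Injective ι) {θ : B →+* C} (hsurj : Function.Surjective θ) {k : ℕ}
    (hnil : RingHom.ker θ ^ (k + 1) = ⊥) {c : ℕ} (hc : ∀ x ∈ unitBall B, p ^ c • θ x ∈ ι.range)
    {W : Submodule ℤ B} (hW : IsBoundedSubmodule W) (hWι : ∀ x ∈ W, θ x ∈ ι.range)
    (h1 : 1 ∈ W) :
    ∃ D : Subring B, (∀ x ∈ W, x ∈ D) ∧ (∃ c : ℝ, ∀ d ∈ D, ‖d‖ ≤ c) ∧
      (∃ e : ℕ, ∀ x ∈ unitBall B, p ^ e • x ∈ D) ∧ IsAdicComplete (Ideal.span {(p : D)}) D ∧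
      (∀ d ∈ D, θ d ∈ ι.range) ∧ ∀ v, ∃ d ∈ D, θ d = ι v := by
  have hV := (isAdicComplete_span_singleton_iff (π := (p : V))).1 inferInstance
  have hN : IsSeriesComplete p ι.range.toAddSubgroup := by
    intro u hu
    choose v hv using hu
    obtain ⟨s, hs⟩ := hV.2 v
    refine ⟨ι s, ⟨s, rfl⟩, fun n => ?_⟩
    obtain ⟨m, hm⟩ := hs n
    refine ⟨ι m, ⟨m, rfl⟩, ?_⟩
    rw [sub_eq_iff_eq_add'.1 hm, map_add, map_sum]
    simp [hv]
  have htf : ∀ y : C, p • y = 0 → y = 0 := fun y hy => by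
    rw [nsmul_eq_mul] at hy
    exact hpC.mul_left_cancel (by rw [hy, mul_zero])
  have hsep : ∀ y : C, (∀ n, ∃ m ∈ ι.range.toAddSubgroup, y = p ^ n • m) → y = 0 := by
    intro y hy
    obtain ⟨-, ⟨v, rfl⟩, hv⟩ := hy 0
    rw [pow_zero, one_smul] at hv
    rw [hv, hV.1 v fun n => ?_, map_zero]
    obtain ⟨-, ⟨w, rfl⟩, hw⟩ := hy n
    exact ⟨w, hι (by rw [← hv, hw]; simp)⟩
  obtain ⟨n, hn⟩ := (isSeriesComplete_unitBall p (E := B)).exists_lift hN hsep htf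
    θ.toAddMonoidHom (exists_pow_nsmul_mem_unitBall p) (fun y _ => hsurj y) (c := c) hc
  have hp : (0 : ℝ) < p := by exact_mod_cast (Fact.out : p.Prime).pos
  -- By the open mapping theorem `p ^ n V` lies in the image of the unit ball, so the part of `p ^
  -- (-n)` times the ball above `V` is bounded and surjects onto `V`.
  let M₀ : Submodule ℤ B :=
    { carrier := {x | p ^ n • x ∈ unitBall B ∧ θ x ∈ ι.range}
      zero_mem' := ⟨by simp, by simp⟩
      add_mem' := fun {x y} hx hy => ⟨by
        rw [smul_add]; exact (unitBall B).add_mem hx.1 hy.1, by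
        rw [map_add]; exact ι.range.add_mem hx.2 hy.2⟩
      smul_mem' := fun a x hx => ⟨by
        rw [smul_comm]; exact (unitBall B).zsmul_mem hx.1 a, by
        rw [map_zsmul]; exact ι.range.zsmul_mem hx.2 a⟩ }
  have hM₀ : IsBoundedSubmodule M₀ := by
    refine ⟨(p : ℝ) ^ n, fun x hx => ?_⟩
    have := hx.1
    rwa [mem_unitBall, norm_pow_nsmul, inv_pow, inv_mul_le_iff₀ (by positivity), mul_one] at this
  have hsurj₀ : ∀ v ∈ ι.range, ∃ m ∈ M₀, θ m = v := by
    intro v hv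
    obtain ⟨x, hx, hxv⟩ := hn v hv
    have hp0 : (p : ℚ_[p]) ^ n ≠ 0 :=
      pow_ne_zero _ (Nat.cast_ne_zero.2 (Fact.out : p.Prime).ne_zero)
    have hinv : p ^ n • ((p : ℚ_[p]) ^ n)⁻¹ • x = x := by
      rw [← Nat.cast_smul_eq_nsmul ℚ_[p] (p ^ n), Nat.cast_pow, smul_inv_smul₀ hp0]
    have hθ : θ (((p : ℚ_[p]) ^ n)⁻¹ • x) = v := by
      have h2 : p ^ n • θ (((p : ℚ_[p]) ^ n)⁻¹ • x) = p ^ n • v := by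
        rw [← map_nsmul, hinv]; exact hxv
      rw [nsmul_eq_mul, nsmul_eq_mul, Nat.cast_pow] at h2
      exact (hpC.pow n).mul_left_cancel h2
    exact ⟨_, ⟨by rwa [hinv], by rwa [hθ]⟩, hθ⟩
  obtain ⟨D, hD, ⟨b, hb⟩, hDV⟩ := exists_bounded_subring θ hnil ι.range (M₀ ⊔ W) (hM₀.sup hW)
    (Submodule.mem_sup_right h1) (fun m hm => by
      obtain ⟨x, hx, y, hy, rfl⟩ := Submodule.mem_sup.1 hm
      rw [map_add]
      exact ι.range.add_mem hx.2 (hWι y hy)) (fun v hv => by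
      obtain ⟨m, hm, h⟩ := hsurj₀ v hv
      exact ⟨m, Submodule.mem_sup_left hm, h⟩)
  have hball : ∀ x ∈ unitBall B, p ^ c • x ∈ D := fun x hx =>
    hD _ (Submodule.mem_sup_left ⟨(unitBall B).nsmul_mem ((unitBall B).nsmul_mem hx _) _, by
      rw [map_nsmul]; exact hc x hx⟩)
  refine ⟨D, fun x hx => hD x (Submodule.mem_sup_right hx), ⟨b, hb⟩, ⟨c, hball⟩,
    isAdicComplete_of_isSeriesComplete hb (isSeriesComplete_of_bounded hb hball), hDV,
    fun v => ?_⟩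
  obtain ⟨m, hm, h⟩ := hsurj₀ (ι v) ⟨v, rfl⟩
  exact ⟨m, hD m (Submodule.mem_sup_left hm), h⟩

end BoundedThickening

/-! ### Continuity for lattice topologies. -/

section LatticeTopology

variable {p : ℕ} {M : Type*} [CommRing M] {M₀ : AddSubgroup M}

theorem isOpen_latticeTopology : @IsOpen M (latticeTopology p M₀) M₀ := by
  intro x hx
  refine ⟨0, fun y hy => ?_⟩
  rw [pow_zero, one_mul]
  exact M₀.add_mem hx hy

theorem continuous_latticeTopology [Fact p.Prime] {B : Type*} [NormedCommRing B]
    [IsUltrametricDist B] [NormedAlgebra ℚ_[p] B] (f : M →+* B) {C : ℝ} (hC : ∀ y ∈ M₀, ‖f y‖ ≤ C) :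
    @Continuous M B (latticeTopology p M₀) _ f := by
  let _ := latticeTopology p M₀
  refine continuous_def.2 fun U hU x hx => ?_
  obtain ⟨ε, hε, hεU⟩ := Metric.isOpen_iff.1 hU _ hx
  have hp1 : (p : ℝ)⁻¹ < 1 :=
    inv_lt_one_of_one_lt₀ (by exact_mod_cast (Fact.out : p.Prime).one_lt)
  have h1 : Filter.Tendsto (fun n : ℕ => ((p : ℝ)⁻¹) ^ n * C) Filter.atTop (nhds (0 * C)) :=
    (tendsto_pow_atTop_nhds_zero_of_lt_one (by positivity) hp1).mul_const _
  rw [zero_mul] at h1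
  obtain ⟨n, hn⟩ := (h1.eventually (gt_mem_nhds hε)).exists
  refine ⟨n, fun y hy => hεU ?_⟩
  rw [map_add, map_mul, map_pow, map_natCast, Metric.mem_ball, dist_eq_norm, add_sub_cancel_left,
    ← Nat.cast_pow, ← nsmul_eq_mul, norm_pow_nsmul]
  exact (mul_le_mul_of_nonneg_left (hC y hy) (by positivity)).trans_lt hn

end LatticeTopology

/-! ### The ring `Ô[1/p]` and bounds from continuity. -/

section CompletedSbar

variable (p : ℕ) [Fact p.Prime]
variable (S : Type u) [NormedCommRing S] [NormOneClass S] [IsUltrametricDist S]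
  [NormedAlgebra ℚ_[p] S]
variable (Sbar : Type v) [CommRing Sbar] [Algebra S Sbar] [IsMaximalEtaleExtension S Sbar]

theorem CompletedSbar.algebraMap_injective :
    Function.Injective (algebraMap (OHat p S Sbar) (CompletedSbar p S Sbar)) := by
  refine IsLocalization.injective (M := Submonoid.powers (p : OHat p S Sbar)) _ ?_
  rw [Submonoid.powers_le]
  refine AdicCompletion.natCast_mem_nonZeroDivisors _ ?_
  rw [mem_nonZeroDivisors_iff_right]
  intro x hx
  refine Subtype.ext ((isUnit_natCast_of_algebra p S Sbar).mul_right_cancel ?_)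
  have := congrArg Subtype.val hx
  simpa using this

theorem CompletedSbar.isUnit_natCast : IsUnit (p : CompletedSbar p S Sbar) :=
  isUnit_natCast_of_algebra p S _

theorem CompletedSbar.algebraMap_spectralIntegers (x : spectralIntegers S) :
    algebraMap S (CompletedSbar p S Sbar) x =
      algebraMap (OHat p S Sbar) (CompletedSbar p S Sbar) (algebraMap _ (OHat p S Sbar) x) :=
  awayStructure_algebraMap p (spectralIntegers S) S (OHat p S Sbar) x

theorem OAinfInv.algebraMap_spectralIntegers (x : spectralIntegers S) :
    algebraMap S (OAinfInv p S Sbar) x =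
      algebraMap (OAinfBar p S Sbar) (OAinfInv p S Sbar) (algebraMap _ (OAinfBar p S Sbar) x) :=
  awayStructure_algebraMap p (spectralIntegers S) S (OAinfBar p S Sbar) x

variable {p S Sbar}
variable {B : Type w} [NormedCommRing B] [NormedAlgebra ℚ_[p] B]

theorem exists_pow_nsmul_mem_range_of_continuous [IsUltrametricDist B]
    {θ : B →+* CompletedSbar p S Sbar} (hθ : Continuous θ) :
    ∃ c : ℕ, ∀ x ∈ unitBall B, p ^ c • θ x ∈
      (algebraMap (OHat p S Sbar) (CompletedSbar p S Sbar)).range := by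
  have h1 := (isOpen_latticeTopology (p := p)
    (M₀ := (algebraMap (OHat p S Sbar) (CompletedSbar p S Sbar)).toAddMonoidHom.range)).preimage hθ
  obtain ⟨ε, hε, hεU⟩ := Metric.isOpen_iff.1 h1 0 ⟨0, by simp⟩
  have hp1 : (p : ℝ)⁻¹ < 1 :=
    inv_lt_one_of_one_lt₀ (by exact_mod_cast (Fact.out : p.Prime).one_lt)
  obtain ⟨c, hc⟩ := exists_pow_lt_of_lt_one hε hp1
  refine ⟨c, fun x hx => ?_⟩
  have h2 : p ^ c • x ∈ Metric.ball (0 : B) ε := by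
    rw [mem_ball_zero_iff, norm_pow_nsmul]
    exact (mul_le_of_le_one_right (by positivity) hx).trans_lt hc
  have h3 := hεU h2
  rw [Set.mem_preimage, map_nsmul] at h3
  exact h3

theorem exists_norm_algebraMap_le (p : ℕ) [Fact p.Prime] {S : Type u} [NormedCommRing S]
    [NormedAlgebra ℚ_[p] S] {B : Type w} [NormedCommRing B] [NormedAlgebra ℚ_[p] B] [Algebra S B]
    [IsScalarTower ℚ_[p] S B] (hB : Continuous (algebraMap S B)) :
    ∃ C : ℝ, 0 ≤ C ∧ ∀ x : S, ‖algebraMap S B x‖ ≤ C * ‖x‖ := by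
  let f : S →L[ℚ_[p]] B := ⟨(IsScalarTower.toAlgHom ℚ_[p] S B).toLinearMap, hB⟩
  exact ⟨‖f‖, norm_nonneg _, f.le_opNorm⟩

theorem IsAffinoid.exists_norm_algebraMap_le [Algebra S B] [IsScalarTower ℚ_[p] S B]
    [IsReduced S] [CompleteSpace S]
    (hS : IsAffinoid p S) (hB : Continuous (algebraMap S B)) :
    ∃ C : ℝ, ∀ x : spectralIntegers S, ‖algebraMap S B x‖ ≤ C := by
  obtain ⟨C, hC0, hC⟩ := _root_.exists_norm_algebraMap_le p hB
  obtain ⟨C', hC'⟩ := hS.exists_norm_le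
  exact ⟨C * C', fun x => (hC x).trans (mul_le_mul_of_nonneg_left (hC' x x.2) hC0)⟩

end CompletedSbar

/-! ### Integral models of thickenings. -/

section Corestriction

variable {Λ D V C : Type*} [CommRing Λ] [CommRing D] [CommRing V] [CommRing C] [Algebra Λ D]
  [Algebra Λ V]

theorem exists_algHom_of_range_le {ι : V →+* C} (hι : Function.Injective ι) {t : D →+* C}
    (hΛ : ∀ x : Λ, t (algebraMap Λ D x) = ι (algebraMap Λ V x)) (ht : ∀ d, t d ∈ ι.range) :
    ∃ q : D →ₐ[Λ] V, ∀ d, ι (q d) = t d := by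
  choose q hq using ht
  refine ⟨{ toFun := q
            map_one' := hι (by rw [hq, map_one, map_one])
            map_zero' := hι (by rw [hq, map_zero, map_zero])
            map_add' := fun x y => hι (by rw [hq, map_add, map_add, hq, hq])
            map_mul' := fun x y => hι (by rw [hq, map_mul, map_mul, hq, hq])
            commutes' := fun x => hι (by rw [hq, hΛ]) }, hq⟩

variable {p : ℕ} [Fact p.Prime] {B : Type*} [NormedCommRing B] [IsUltrametricDist B]
  [NormedAlgebra ℚ_[p] B] [CompleteSpace B] [IsAdicComplete (Ideal.span {(p : V)}) V]
  [hV : Fact (¬ IsUnit (p : V))]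

/-- Bounded subsets of a nilpotent thickening lie in a `p`-adically complete thickening. -/
theorem exists_algHom_of_thickening (hpC : IsUnit (p : C)) {ι : V →+* C}
    (hι : Function.Injective ι) {θ : B →+* C} (hsurj : Function.Surjective θ) {k : ℕ}
    (hnil : RingHom.ker θ ^ (k + 1) = ⊥) {c : ℕ} (hc : ∀ x ∈ unitBall B, p ^ c • θ x ∈ ι.range)
    {φ : Λ →+* B} (hφ : ∀ x, θ (φ x) = ι (algebraMap Λ V x)) {CΛ : ℝ} (hCΛ : ∀ x, ‖φ x‖ ≤ CΛ)
    {W : Submodule ℤ B} (hW : IsBoundedSubmodule W) (hWθ : ∀ x ∈ W, θ x ∈ ι.range) :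
    ∃ (D : Subring B) (_ : Algebra Λ D) (q : D →ₐ[Λ] V),
      (∀ x ∈ W, x ∈ D) ∧ (∃ c : ℝ, ∀ d ∈ D, ‖d‖ ≤ c) ∧
      IsAdicComplete (Ideal.span {(p : D)}) D ∧ Fact (¬ IsUnit (p : D)) ∧
      (∀ x : Λ, (algebraMap Λ D x : B) = φ x) ∧ (∀ d : D, ι (q d) = θ d) ∧
      Function.Surjective q ∧ RingHom.ker q ^ (k + 1) = ⊥ := by
  -- The bounded image of `Λ` is adjoined to `W` so that `D` becomes a `Λ`-algebra.
  let L : Submodule ℤ B := AddSubgroup.toIntSubmodule φ.range.toAddSubgroup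
  have hL : IsBoundedSubmodule L := ⟨CΛ, by
    rintro _ ⟨x, rfl⟩
    exact hCΛ x⟩
  obtain ⟨D, hWD, hbd, -, hcomp, hDV, hVD⟩ := exists_subring_of_thickening (W := W ⊔ L)
    hpC hι hsurj hnil hc (hW.sup hL)
    (fun x hx => by
      obtain ⟨y, hy, -, ⟨z, rfl⟩, rfl⟩ := Submodule.mem_sup.1 hx
      rw [map_add]
      exact ι.range.add_mem (hWθ y hy) ⟨algebraMap _ _ z, (hφ z).symm⟩)
    (Submodule.mem_sup_right ⟨1, map_one φ⟩)
  let φ' : Λ →+* D := φ.codRestrict D fun x => hWD _ (Submodule.mem_sup_right ⟨x, rfl⟩)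
  let _ : Algebra Λ D := φ'.toAlgebra
  obtain ⟨q, hq⟩ := exists_algHom_of_range_le (Λ := Λ) hι (t := θ.comp D.subtype) hφ
    (fun d => hDV d d.2)
  have hqs : Function.Surjective q := fun v => by
    obtain ⟨d, hd, hdv⟩ := hVD v
    exact ⟨⟨d, hd⟩, hι ((hq _).trans hdv)⟩
  refine ⟨D, inferInstance, q, fun x hx => hWD x (Submodule.mem_sup_left hx), hbd, hcomp,
    ⟨fun h => ?_⟩, fun x => rfl, hq, hqs, ?_⟩
  · have h1 := h.map q
    rw [map_natCast] at h1
    exact hV.out h1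
  · have hle : RingHom.ker q ≤ (RingHom.ker θ).comap D.subtype := fun d hd => by
      change θ d = 0
      have := hq d
      rw [RingHom.mem_ker.1 hd, map_zero] at this
      exact this.symm
    have h1 := (Ideal.pow_right_mono hle (k + 1)).trans (Ideal.le_comap_pow D.subtype (k + 1))
    rw [hnil] at h1
    exact eq_bot_iff.2 fun d hd => Subtype.ext (h1 hd)

end Corestriction

/-! ### Maps from `OA_inf` to Banach thickenings. -/

section Thickening

variable {p : ℕ} [Fact p.Prime]
variable {S : Type u} [NormedCommRing S] [NormOneClass S] [IsUltrametricDist S]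
  [NormedAlgebra ℚ_[p] S] [CompleteSpace S] [IsReduced S]
variable {Sbar : Type v} [CommRing Sbar] [Algebra S Sbar] [IsMaximalEtaleExtension S Sbar]
variable {B : Type w} [NormedCommRing B] [IsUltrametricDist B] [NormedAlgebra ℚ_[p] B]
  [CompleteSpace B] [Algebra S B] [IsScalarTower ℚ_[p] S B]

/-- Bounded sets of an `S`-thickening that map to `Ô` lie in a `p`-adically complete
`O_S`-thickening of `Ô`. -/
theorem exists_integral_thickening (hS : IsAffinoid p S) (hB : Continuous (algebraMap S B))
    (θ : B →ₐ[S] CompletedSbar p S Sbar) (hθ : Continuous θ) (hsurj : Function.Surjective θ)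
    {k : ℕ} (hnil : RingHom.ker θ ^ (k + 1) = ⊥) {W : Submodule ℤ B} (hW : IsBoundedSubmodule W)
    (hWθ : ∀ x ∈ W, θ x ∈ (algebraMap (OHat p S Sbar) (CompletedSbar p S Sbar)).range) :
    ∃ (D : Subring B) (_ : Algebra (spectralIntegers S) D)
      (q : D →ₐ[spectralIntegers S] OHat p S Sbar),
      (∀ x ∈ W, x ∈ D) ∧ (∃ c : ℝ, ∀ d ∈ D, ‖d‖ ≤ c) ∧
      IsAdicComplete (Ideal.span {(p : D)}) D ∧ Fact (¬ IsUnit (p : D)) ∧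
      (∀ x : spectralIntegers S, (algebraMap _ D x : B) = algebraMap S B x) ∧
      (∀ d : D, algebraMap _ (CompletedSbar p S Sbar) (q d) = θ d) ∧
      Function.Surjective q ∧ RingHom.ker q ^ (k + 1) = ⊥ := by
  obtain ⟨c, hc⟩ := exists_pow_nsmul_mem_range_of_continuous
    (θ := (θ : B →+* CompletedSbar p S Sbar)) hθ
  obtain ⟨CΛ, hCΛ⟩ := hS.exists_norm_algebraMap_le hB
  exact exists_algHom_of_thickening (CompletedSbar.isUnit_natCast p S Sbar)
    (CompletedSbar.algebraMap_injective p S Sbar) (θ := (θ : B →+* CompletedSbar p S Sbar)) hsurj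
    hnil hc (φ := (algebraMap S B).comp (spectralIntegers S).subtype)
    (fun x => (θ.commutes (x : S)).trans (CompletedSbar.algebraMap_spectralIntegers p S Sbar x))
    hCΛ hW hWθ

theorem exists_OAinf_hom (hS : IsAffinoid p S) (hB : Continuous (algebraMap S B))
    (θ : B →ₐ[S] CompletedSbar p S Sbar) (hθ : Continuous θ) (hsurj : Function.Surjective θ)
    {k : ℕ} (hnil : RingHom.ker θ ^ (k + 1) = ⊥) :
    ∃ f : OAinfBar p S Sbar →+* B,
      (∀ x : spectralIntegers S, f (algebraMap _ _ x) = algebraMap S B x) ∧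
      (∀ x, θ (f x) = algebraMap _ _ (thetaOAinf p (spectralIntegers S) (OHat p S Sbar) x)) ∧
      ∃ C : ℝ, ∀ x, ‖f x‖ ≤ C := by
  obtain ⟨D, _, q, -, ⟨C, hC⟩, _, _, hΛ, hq, hqs, hqn⟩ := exists_integral_thickening hS hB θ hθ
    hsurj hnil (W := ⊥) ⟨0, by simp⟩ (fun x hx => by
      rw [(Submodule.mem_bot ℤ).1 hx, map_zero]; exact Subring.zero_mem _)
  obtain ⟨f, hf⟩ := exists_OAinf_lift p (spectralIntegers S) (OHat p S Sbar) q hqs hqn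
  refine ⟨D.subtype.comp f, fun x => ?_, fun x => ?_, C, fun x => hC _ (f x).2⟩
  · rw [← hΛ, ← f.commutes]; rfl
  · rw [← hf]; exact (hq _).symm

/-- Boundedness puts both images in one integral thickening `D`, where `OAinf_lift_unique` applies.
-/
theorem OAinf_hom_unique (hS : IsAffinoid p S) (hB : Continuous (algebraMap S B))
    (θ : B →ₐ[S] CompletedSbar p S Sbar) (hθ : Continuous θ) (hsurj : Function.Surjective θ)
    {k : ℕ} (hnil : RingHom.ker θ ^ (k + 1) = ⊥) {f g : OAinfBar p S Sbar →+* B}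
    (hfΛ : ∀ x : spectralIntegers S, f (algebraMap _ _ x) = algebraMap S B x)
    (hgΛ : ∀ x : spectralIntegers S, g (algebraMap _ _ x) = algebraMap S B x)
    (hf : ∀ x, θ (f x) = algebraMap _ _ (thetaOAinf p (spectralIntegers S) (OHat p S Sbar) x))
    (hg : ∀ x, θ (g x) = algebraMap _ _ (thetaOAinf p (spectralIntegers S) (OHat p S Sbar) x))
    (hfb : ∃ C : ℝ, ∀ x, ‖f x‖ ≤ C) (hgb : ∃ C : ℝ, ∀ x, ‖g x‖ ≤ C) : f = g := by
  let R : (OAinfBar p S Sbar →+* B) → Submodule ℤ B := fun h =>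
    AddSubgroup.toIntSubmodule h.range.toAddSubgroup
  have hR : ∀ h : OAinfBar p S Sbar →+* B, (∃ C : ℝ, ∀ x, ‖h x‖ ≤ C) → IsBoundedSubmodule (R h) := by
    rintro h ⟨C, hC⟩
    refine ⟨C, ?_⟩
    rintro _ ⟨x, rfl⟩
    exact hC x
  obtain ⟨D, _, q, hW, -, _, _, hΛ, hq, hqs, hqn⟩ := exists_integral_thickening hS hB θ hθ
    hsurj hnil (W := R f ⊔ R g) ((hR f hfb).sup (hR g hgb)) (fun x hx => by
      obtain ⟨-, ⟨y, rfl⟩, -, ⟨z, rfl⟩, rfl⟩ := Submodule.mem_sup.1 hx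
      rw [map_add, hf, hg, ← map_add]
      exact ⟨_, rfl⟩)
  have key : ∀ h : OAinfBar p S Sbar →+* B, (∀ x, h x ∈ D) →
      (∀ x : spectralIntegers S, h (algebraMap _ _ x) = algebraMap S B x) →
      (∀ x, θ (h x) = algebraMap _ _ (thetaOAinf p (spectralIntegers S) (OHat p S Sbar) x)) →
      ∃ h' : OAinfBar p S Sbar →ₐ[spectralIntegers S] D,
        q.comp h' = thetaOAinf p (spectralIntegers S) (OHat p S Sbar) ∧ ∀ x, (h' x : B) = h x := by
    intro h hD h1 h2
    refine ⟨{ h.codRestrict D hD with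
      commutes' := fun x => Subtype.ext ((h1 x).trans (hΛ x).symm) }, AlgHom.ext fun x => ?_,
      fun x => rfl⟩
    exact CompletedSbar.algebraMap_injective p S Sbar ((hq _).trans (h2 x))
  obtain ⟨f', hf1, hf2⟩ := key f (fun x => hW _ (Submodule.mem_sup_left ⟨x, rfl⟩)) hfΛ hf
  obtain ⟨g', hg1, hg2⟩ := key g (fun x => hW _ (Submodule.mem_sup_right ⟨x, rfl⟩)) hgΛ hg
  have hfg := OAinf_lift_unique p (spectralIntegers S) (OHat p S Sbar) q (hS.thetaIdeal_fg Sbar)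
    hqs hqn hf1 hg1
  refine RingHom.ext fun x => ?_
  rw [← hf2, ← hg2, hfg]

end Thickening

/-! ### Passage to `B_dR^+`. -/

section BdRPlus

variable {p : ℕ} [Fact p.Prime]
variable {S : Type u} [NormedCommRing S] [NormOneClass S] [IsUltrametricDist S]
  [NormedAlgebra ℚ_[p] S]
variable {Sbar : Type v} [CommRing Sbar] [Algebra S Sbar] [IsMaximalEtaleExtension S Sbar]

variable (p S Sbar) in
/-- The completion map `OA_inf[1/p] → B_dR^+`. -/
noncomputable def BdRPlus.of : OAinfInv p S Sbar →ₐ[S] BdRPlus p S Sbar :=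
  (IsScalarTower.toAlgHom S (OAinfInv p S Sbar)
    (AdicCompletion (RingHom.ker (thetaInv p S Sbar)) (OAinfInv p S Sbar)) :)

theorem BdRPlus.proj_of (n : ℕ) (a : OAinfInv p S Sbar) :
    BdRPlus.proj p S Sbar n (BdRPlus.of p S Sbar a) = Ideal.Quotient.mk _ a :=
  (AdicCompletion.evalₐ (RingHom.ker (thetaInv p S Sbar)) n).commutes a

theorem BdRPlus.exists_proj_eq (x : BdRPlus p S Sbar) (n : ℕ) :
    ∃ a, ∀ i ≤ n, BdRPlus.proj p S Sbar i x = Ideal.Quotient.mk _ a := by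
  obtain ⟨c, rfl⟩ := AdicCompletion.mk_surjective (RingHom.ker (thetaInv p S Sbar))
    (OAinfInv p S Sbar) x
  refine ⟨c n, fun i hi => ?_⟩
  refine (AdicCompletion.evalₐ_mk (RingHom.ker (thetaInv p S Sbar)) i c).trans ?_
  exact (AdicCompletion.Ideal.mk_eq_mk _ hi c).symm

theorem thetaBdR_of_proj_eq {x : BdRPlus p S Sbar} {a : OAinfInv p S Sbar}
    (h : BdRPlus.proj p S Sbar 1 x = Ideal.Quotient.mk _ a) :
    thetaBdR p S Sbar x = thetaInv p S Sbar a := by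
  obtain ⟨c, rfl⟩ := AdicCompletion.mk_surjective (RingHom.ker (thetaInv p S Sbar))
    (OAinfInv p S Sbar) x
  have h1 : Ideal.Quotient.mk (RingHom.ker (thetaInv p S Sbar) ^ 1) (c 1) =
    Ideal.Quotient.mk _ a :=
      (AdicCompletion.evalₐ_mk (RingHom.ker (thetaInv p S Sbar)) 1 c).symm.trans h
  rw [Ideal.Quotient.eq, pow_one, RingHom.mem_ker, map_sub, sub_eq_zero] at h1
  rw [← h1]
  rfl

/-- A basis of neighbourhoods in `B_dR^+`. -/
theorem BdRPlus.exists_of_isOpen {U : Set (BdRPlus p S Sbar)} (hU : IsOpen U)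
    {z : BdRPlus p S Sbar} (hz : z ∈ U) : ∃ N m : ℕ, ∀ w,
      (∃ y : OAinfBar p S Sbar, ∀ i ≤ N, BdRPlus.proj p S Sbar i w = BdRPlus.proj p S Sbar i z +
        (p : OAinfInv p S Sbar ⧸ RingHom.ker (thetaInv p S Sbar) ^ i) ^ m *
          Ideal.Quotient.mk _ (algebraMap _ (OAinfInv p S Sbar) y)) → w ∈ U := by
  let T : (n : ℕ) → TopologicalSpace (OAinfInv p S Sbar ⧸ RingHom.ker (thetaInv p S Sbar) ^ n) :=
    fun n => latticeTopology p ((Ideal.Quotient.mk (RingHom.ker (thetaInv p S Sbar) ^ n)).comp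
      (algebraMap (OAinfBar p S Sbar) (OAinfInv p S Sbar))).toAddMonoidHom.range
  have h1 : U ∈ nhds z := hU.mem_nhds hz
  have h2 : nhds z = ⨅ n, @nhds _ (TopologicalSpace.induced (BdRPlus.proj p S Sbar n) (T n)) z :=
    nhds_iInf
  rw [h2, Filter.mem_iInf] at h1
  obtain ⟨I, hI, W, hW, rfl⟩ := h1
  have h3 : ∀ i : I, ∃ m : ℕ, ∀ w, (∃ y : OAinfBar p S Sbar, BdRPlus.proj p S Sbar i w =
      BdRPlus.proj p S Sbar i z +
        (p : OAinfInv p S Sbar ⧸ RingHom.ker (thetaInv p S Sbar) ^ (i : ℕ)) ^ m *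
          Ideal.Quotient.mk _ (algebraMap _ (OAinfInv p S Sbar) y)) → w ∈ W i := by
    intro i
    have h4 := hW i
    rw [@nhds_induced _ _ (T i), Filter.mem_comap] at h4
    obtain ⟨G, hG, hGW⟩ := h4
    let _ := T i
    obtain ⟨G', hG', hG'o, hzG'⟩ := mem_nhds_iff.1 hG
    obtain ⟨m, hm⟩ := hG'o _ hzG'
    refine ⟨m, ?_⟩
    rintro w ⟨y, hy⟩
    refine hGW (hG' ?_)
    rw [hy]
    exact hm _ ⟨y, rfl⟩
  choose m hm using h3
  have := hI.to_subtype
  -- A neighbourhood in the projective limit constrains finitely many levels; take the largest level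
  -- and the largest exponent.
  obtain ⟨N, hN⟩ := hI.bddAbove
  obtain ⟨K, hK⟩ := (Set.finite_range m).bddAbove
  refine ⟨N, K, ?_⟩
  rintro w ⟨y, hy⟩
  refine Set.mem_iInter.2 fun i => hm i w ?_
  obtain ⟨d, hd⟩ := Nat.exists_eq_add_of_le (hK ⟨i, rfl⟩)
  refine ⟨p ^ d * y, ?_⟩
  rw [hy i (hN i.2), hd, pow_add, mul_assoc]
  simp

theorem BdRPlus.denseRange_of : DenseRange (BdRPlus.of p S Sbar) := by
  intro z
  refine mem_closure_iff.2 fun U hU hz => ?_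
  obtain ⟨N, m, h⟩ := BdRPlus.exists_of_isOpen hU hz
  obtain ⟨a, ha⟩ := BdRPlus.exists_proj_eq z N
  refine ⟨_, h (BdRPlus.of p S Sbar a) ⟨0, fun i hi => ?_⟩, a, rfl⟩
  rw [BdRPlus.proj_of, ha i hi, map_zero, map_zero, mul_zero, add_zero]

theorem thetaBdR_of (a : OAinfInv p S Sbar) :
    thetaBdR p S Sbar (BdRPlus.of p S Sbar a) = thetaInv p S Sbar a :=
  thetaBdR_of_proj_eq (BdRPlus.proj_of 1 a)

theorem thetaInv_algebraMap (x : OAinfBar p S Sbar) :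
    thetaInv p S Sbar (algebraMap _ (OAinfInv p S Sbar) x) = algebraMap _ _
      (thetaOAinf p (spectralIntegers S) (OHat p S Sbar) x) :=
  thetaInvRingHom_algebraMap p S Sbar x

variable {B : Type w} [NormedCommRing B] [IsUltrametricDist B] [NormedAlgebra ℚ_[p] B]
  [Algebra S B]

theorem exists_OAinfInv_hom {f : OAinfBar p S Sbar →+* B}
    (hf : ∀ x : spectralIntegers S, f (algebraMap _ _ x) = algebraMap S B x) :
    ∃ F : OAinfInv p S Sbar →ₐ[S] B, ∀ x, F (algebraMap _ _ x) = f x := by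
  have hp : IsUnit (f (p : OAinfBar p S Sbar)) := by
    rw [map_natCast]
    exact natCast_isUnit_of_padic p
  let F : OAinfInv p S Sbar →+* B := IsLocalization.Away.lift (p : OAinfBar p S Sbar) hp
  have hF : ∀ x, F (algebraMap _ _ x) = f x := fun x => IsLocalization.Away.lift_eq _ hp x
  have hS : F.comp (algebraMap S (OAinfInv p S Sbar)) = algebraMap S B := by
    refine IsLocalization.ringHom_ext (Submonoid.powers (p : spectralIntegers S))
      (RingHom.ext fun x => ?_)
    change F (algebraMap S (OAinfInv p S Sbar) (x : S)) = algebraMap S B (x : S)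
    rw [OAinfInv.algebraMap_spectralIntegers, hF, hf]
  exact ⟨{ F with commutes' := RingHom.congr_fun hS }, hF⟩

theorem OAinfInv_hom_ext {R : Type*} [CommRing R] {F G : OAinfInv p S Sbar →+* R}
    (h : ∀ x : OAinfBar p S Sbar, F (algebraMap _ _ x) = G (algebraMap _ _ x)) : F = G :=
  IsLocalization.ringHom_ext (Submonoid.powers (p : OAinfBar p S Sbar)) (RingHom.ext h)

/-- A homomorphism from `OA_inf[1/p]` that is bounded on `OA_inf` and compatible with a nilpotent
thickening extends to `B_dR^+`. -/
theorem exists_BdRPlus_hom {F : OAinfInv p S Sbar →ₐ[S] B} {C : ℝ}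
    (hF : ∀ x : OAinfBar p S Sbar, ‖F (algebraMap _ _ x)‖ ≤ C)
    {θ : B →ₐ[S] CompletedSbar p S Sbar} (hθ : ∀ a, θ (F a) = thetaInv p S Sbar a)
    {k : ℕ} (hnil : RingHom.ker θ ^ (k + 1) = ⊥) :
    ∃ α : BdRPlus p S Sbar →ₐ[S] B, Continuous α ∧ θ.comp α = thetaBdR p S Sbar := by
  let J := RingHom.ker (thetaInv p S Sbar)
  -- `F` sends `Ker θ` into `ker θ_B`, whose `(k + 1)`-th power is zero; so the extension only uses
  -- the projection to level `k + 1`.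
  have hJ : ∀ a ∈ J ^ (k + 1), F a = 0 := by
    have hle : J ≤ (RingHom.ker θ).comap F := fun a ha => by
      change θ (F a) = 0
      rw [hθ]; exact ha
    intro a ha
    have h1 := pow_le_comap_pow F J _ hle (k + 1) ha
    rw [hnil] at h1
    exact h1
  let Fq : OAinfInv p S Sbar ⧸ J ^ (k + 1) →+* B := Ideal.Quotient.lift _ (F : _ →+* B) hJ
  have hFq : ∀ a, Fq (Ideal.Quotient.mk _ a) = F a := fun a => Ideal.Quotient.lift_mk _ _ _
  let α : BdRPlus p S Sbar →ₐ[S] B :=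
    { Fq.comp (BdRPlus.proj p S Sbar (k + 1)) with
      commutes' := fun s => by
        change Fq (BdRPlus.proj p S Sbar (k + 1) (algebraMap S _ s)) = _
        rw [← (BdRPlus.of p S Sbar).commutes, BdRPlus.proj_of, hFq, F.commutes] }
  have hα : ∀ x, α x = Fq (BdRPlus.proj p S Sbar (k + 1) x) := fun x => rfl
  refine ⟨α, ?_, AlgHom.ext fun x => ?_⟩
  · let T : TopologicalSpace (OAinfInv p S Sbar ⧸ J ^ (k + 1)) :=
      latticeTopology p ((Ideal.Quotient.mk (J ^ (k + 1))).comp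
        (algebraMap (OAinfBar p S Sbar) (OAinfInv p S Sbar))).toAddMonoidHom.range
    have h1 : Continuous (BdRPlus.proj p S Sbar (k + 1)) :=
      continuous_iInf_dom (i := k + 1) continuous_induced_dom
    have h2 : Continuous Fq := continuous_latticeTopology (p := p) Fq (C := C) (by
      rintro _ ⟨y, rfl⟩
      exact hF y)
    exact h2.comp h1
  · obtain ⟨a, ha⟩ := BdRPlus.exists_proj_eq x (k + 1)
    rw [AlgHom.comp_apply, hα, ha _ le_rfl, hFq, hθ, thetaBdR_of_proj_eq (ha 1 (by omega))]

/-- The preimage of the unit ball contains the image of `p ^ m OA_inf` for some `m`. This is how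
continuity yields the boundedness needed for uniqueness. -/
theorem exists_norm_le_of_continuous {α : BdRPlus p S Sbar →ₐ[S] B} (hα : Continuous α) :
    ∃ C : ℝ, ∀ x : OAinfBar p S Sbar, ‖α (BdRPlus.of p S Sbar (algebraMap _ _ x))‖ ≤ C := by
  obtain ⟨N, m, h⟩ := BdRPlus.exists_of_isOpen ((Metric.isOpen_ball (x := (0 : B))
    (ε := 1)).preimage hα) (z := 0) (by simp)
  have hp : (0 : ℝ) < p := by exact_mod_cast (Fact.out : p.Prime).pos
  refine ⟨(p : ℝ) ^ m, fun x => ?_⟩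
  have h1 := h (BdRPlus.of p S Sbar (p ^ m • algebraMap _ (OAinfInv p S Sbar) x)) ⟨x, fun i _ => by
    rw [BdRPlus.proj_of, map_zero, zero_add, map_nsmul, nsmul_eq_mul, Nat.cast_pow]⟩
  rw [Set.mem_preimage, mem_ball_zero_iff, map_nsmul, map_nsmul, norm_pow_nsmul, inv_pow] at h1
  have h2 := (inv_mul_le_iff₀ (by positivity)).1 h1.le
  rwa [mul_one] at h2

variable [CompleteSpace S] [IsReduced S] [CompleteSpace B] [IsScalarTower ℚ_[p] S B]

/-- The restrictions to `OA_inf` are bounded lifts of `θ`, hence equal; equality persists after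
inverting `p` and then by density. -/
theorem BdRPlus_hom_unique (hS : IsAffinoid p S) (hB : Continuous (algebraMap S B))
    (θ : B →ₐ[S] CompletedSbar p S Sbar) (hθ : Continuous θ) (hsurj : Function.Surjective θ)
    {k : ℕ} (hnil : RingHom.ker θ ^ (k + 1) = ⊥) {α β : BdRPlus p S Sbar →ₐ[S] B}
    (hα : Continuous α) (hβ : Continuous β) (hαθ : θ.comp α = thetaBdR p S Sbar)
    (hβθ : θ.comp β = thetaBdR p S Sbar) : α = β := by
  let j := algebraMap (OAinfBar p S Sbar) (OAinfInv p S Sbar)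
  let r : (BdRPlus p S Sbar →ₐ[S] B) → OAinfBar p S Sbar →+* B := fun γ =>
    ((γ.comp (BdRPlus.of p S Sbar) : OAinfInv p S Sbar →ₐ[S] B) : OAinfInv p S Sbar →+* B).comp j
  have h1 : ∀ γ : BdRPlus p S Sbar →ₐ[S] B, ∀ x : spectralIntegers S,
      r γ (algebraMap _ _ x) = algebraMap S B x := fun γ x => by
    change (γ.comp (BdRPlus.of p S Sbar)) (j (algebraMap _ _ x)) = _
    rw [← OAinfInv.algebraMap_spectralIntegers, AlgHom.commutes]
  have h2 : ∀ γ : BdRPlus p S Sbar →ₐ[S] B, θ.comp γ = thetaBdR p S Sbar → ∀ x,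
      θ (r γ x) = algebraMap _ _ (thetaOAinf p (spectralIntegers S) (OHat p S Sbar) x) := by
    intro γ hγ x
    change (θ.comp γ) (BdRPlus.of p S Sbar (j x)) = _
    rw [hγ, thetaBdR_of, thetaInv_algebraMap]
  have h3 : r α = r β := OAinf_hom_unique hS hB θ hθ hsurj hnil (h1 α) (h1 β) (h2 α hαθ) (h2 β hβθ)
    (exists_norm_le_of_continuous hα) (exists_norm_le_of_continuous hβ)
  have h4 := OAinfInv_hom_ext
    (F := ((α.comp (BdRPlus.of p S Sbar) : OAinfInv p S Sbar →ₐ[S] B) : OAinfInv p S Sbar →+* B))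
    (G := ((β.comp (BdRPlus.of p S Sbar) : OAinfInv p S Sbar →ₐ[S] B) : OAinfInv p S Sbar →+* B))
    (RingHom.congr_fun h3)
  refine DFunLike.coe_injective (BdRPlus.denseRange_of.equalizer hα hβ (funext fun a => ?_))
  exact RingHom.congr_fun h4 a

end BdRPlus
-- The universal property.
theorem mainTheorem1 (p : ℕ) [Fact p.Prime]
    (S : Type u) [NormedCommRing S] [NormOneClass S] [IsUltrametricDist S]
    [NormedAlgebra ℚ_[p] S] [CompleteSpace S] [IsReduced S] (hS : IsAffinoid p S)
    (Sbar : Type v) [CommRing Sbar] [Algebra S Sbar] [IsMaximalEtaleExtension S Sbar]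
    (B : Type w) [NormedCommRing B] [IsUltrametricDist B] [NormedAlgebra ℚ_[p] B]
    [CompleteSpace B] [Algebra S B] [IsScalarTower ℚ_[p] S B]
    (hB : Continuous (algebraMap S B))
    (θB : B →ₐ[S] CompletedSbar p S Sbar) (hθB : Continuous θB)
    (hsurj : Function.Surjective θB)
    (hnil : ∃ k : ℕ, RingHom.ker θB ^ (k + 1) = ⊥) :
    ∃! α : BdRPlus p S Sbar →ₐ[S] B, Continuous α ∧ θB.comp α = thetaBdR p S Sbar := by
  obtain ⟨k, hnil⟩ := hnil
  obtain ⟨f, hfS, hfθ, C, hfC⟩ := exists_OAinf_hom hS hB θB hθB hsurj hnil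
  obtain ⟨F, hF⟩ := exists_OAinfInv_hom hfS
  have hFθ : ∀ a, θB (F a) = thetaInv p S Sbar a := by
    have h := OAinfInv_hom_ext (F := ((θB.comp F : OAinfInv p S Sbar →ₐ[S] CompletedSbar p S Sbar) :
        OAinfInv p S Sbar →+* CompletedSbar p S Sbar))
      (G := (thetaInv p S Sbar : OAinfInv p S Sbar →+* CompletedSbar p S Sbar)) (fun x => by
        change θB (F _) = thetaInv p S Sbar _
        rw [hF, hfθ, thetaInv_algebraMap])
    exact fun a => RingHom.congr_fun h a
  obtain ⟨α, hα, hαθ⟩ := exists_BdRPlus_hom (fun x => by rw [hF]; exact hfC x) hFθ hnil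
  exact ⟨α, ⟨hα, hαθ⟩, fun β hβ =>
    BdRPlus_hom_unique hS hB θB hθB hsurj hnil hβ.1 hα hβ.2 hαθ⟩
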